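/- Let $n \ge 3$, let $G$ be a compact subgroup of $O(n)$, and let $so(n)$ carry the inner product $\langle X, Y\rangle = \alpha \sum_{a,b} X_{ab}Y_{ab}$, where $\alpha > 0$. Put $a_G = \frac{2}{\sqrt{3\alpha}}$ if $n = 3$ and $a_G = \frac{2\sqrt2}{\sqrt{3\alpha}}$ if $n \ge 4$. Let $(M, g)$ be a smooth oriented four-dimensional Riemannian manifold with Levi-Civita connection $\nabla$, Laplacian $\Delta = \operatorname{tr} \nabla^2$ and scalar curvature $R$ (positive on the round sphere), and let $\lambda_{\max}(W^+)$ be the largest eigenvalue of the self-dual part of the Weyl tensor, regarded as the operator $(W\omega)_{ij} = \sum_{k<l} W_{ijkl}\,\omega_{kl}$ (orthonormal frame) on self-dual two-forms. Let $A$ be a smooth connection on a smooth $G$-bundle over $M$ (a rank-$n$ vector bundle with $G$-valued transition functions, and connection forms with values in the Lie algebra of $G$) which is Yang-Mills, that is $d_A^* F_A = 0$. Let $F_A^+ = \frac12 (F_A + *F_A)$, with $|F_A^+|^2 = \sum_{i<j} \langle F^+_{ij}, F^+_{ij}\rangle$ in an orthonormal frame. Let $p > 0$. Then $|F_A^+|^p$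 is $C^\infty$ near every point at which $F_A^+ \neq 0$, and at every point of $M$ near which $|F_A^+|^p$ is of class $C^2$ (in particular wherever $F_A^+ \ne 0$), $$|F_A^+|^p \Delta |F_A^+|^p \ge \left(1 - \frac{1}{2p}\right) \big|\nabla |F_A^+|^p\big|^2 + \frac{p}{3} R\, |F_A^+|^{2p} - 2p\, \lambda_{\max}(W^+)\, |F_A^+|^{2p} - p\, a_G\, |F_A^+|^{2p+1}.$$ -/

import Mathlib

open scoped Manifold ContDiff Topology

noncomputable section

namespace YangMills

/-- The model space `ℝ⁴`. -/
abbrev E4 : Type := EuclideanSpace ℝ (Fin 4)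

/-- Real `n × n` matrices. -/
abbrev Mat (n : ℕ) : Type := Matrix (Fin n) (Fin n) ℝ

/-! ### Pointwise algebra of two-forms

A two-form on `ℝ⁴` with values in `V` is given by its components `η i j`, and the metric by its
Gram matrix `Q`. -/

section Algebra

/-- The Levi-Civita symbol `ε_{ijkl}`: the determinant of the matrix with rows
`e_i, e_j, e_k, e_l`. -/
def leviCivita (i j k l : Fin 4) : ℝ :=
  ((Matrix.of fun a b : Fin 4 => if ![i, j, k, l] a = b then (1 : ℤ) else 0).det : ℤ)

/-- Hodge star on two-forms in positively oriented coordinates: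
`(⋆η)_{ij} = ½ √(det Q) ∑ ε_{klij} Q^{kp} Q^{lq} η_{pq}`. -/
def hodgeStar {V : Type*} [AddCommGroup V] [Module ℝ V] (Q : Matrix (Fin 4) (Fin 4) ℝ)
    (η : Fin 4 → Fin 4 → V) : Fin 4 → Fin 4 → V := fun i j =>
  (1 / 2 * √Q.det) • ∑ k, ∑ l, ∑ p, ∑ q, (leviCivita k l i j * Q⁻¹ k p * Q⁻¹ l q) • η p q

/-- The self-dual part `η⁺ = ½ (η + ⋆η)`. -/
def selfDualPart {V : Type*} [AddCommGroup V] [Module ℝ V] (Q : Matrix (Fin 4) (Fin 4) ℝ)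
    (η : Fin 4 → Fin 4 → V) : Fin 4 → Fin 4 → V := fun i j =>
  (1 / 2 : ℝ) • (η i j + hodgeStar Q η i j)

/-- The inner product `⟨X, Y⟩ = α ∑ X_{ab} Y_{ab}` of matrices. -/
def matInner {n : ℕ} (α : ℝ) (X Y : Mat n) : ℝ := α * ∑ a, ∑ b, X a b * Y a b

/-- The norm of a matrix-valued two-form, `|η|² = ½ ∑ Q^{ik} Q^{jl} ⟨η_{ij}, η_{kl}⟩`, so that
`|dxⁱ ∧ dxʲ| = 1` for `i ≠ j` in an orthonormal frame. -/
def formNorm {n : ℕ} (α : ℝ) (Q : Matrix (Fin 4) (Fin 4) ℝ) (η : Fin 4 → Fin 4 → Mat n) : ℝ :=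
  √(1 / 2 * ∑ i, ∑ j, ∑ k, ∑ l, Q⁻¹ i k * Q⁻¹ j l * matInner α (η i j) (η k l))

/-- The constant `a_G` for a structure group embedded in `O(n)`, `n ≥ 3`, where `so(n)` carries the
inner product `matInner α`. -/
def aG (n : ℕ) (α : ℝ) : ℝ := if n = 3 then 2 / √(3 * α) else 2 * √2 / √(3 * α)

end Algebra

/-! ### Riemannian geometry in charts -/

section Geometry

variable {M : Type*} [TopologicalSpace M] [ChartedSpace E4 M]

/-- The atlas is oriented: all coordinate changes have positive Jacobian determinant. -/
def OrientedAtlas (M : Type*) [TopologicalSpace M] [ChartedSpace E4 M] : Prop :=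
  ∀ e ∈ atlas E4 M, ∀ e' ∈ atlas E4 M, ∀ y ∈ (e.symm.trans e').source,
    0 < (fderiv ℝ (e' ∘ e.symm) y).det

/-- Smooth Riemannian metrics on `M`. -/
abbrev Metric (M : Type*) [TopologicalSpace M] [ChartedSpace E4 M] [IsManifold (𝓡 4) ∞ M] :
    Type _ :=
  Bundle.ContMDiffRiemannianMetric (𝓡 4) ∞ E4 (fun x : M => TangentSpace (𝓡 4) x)

/-- The partial derivative `∂_i f` of a function on `ℝ⁴`. -/
def pd (i : Fin 4) (f : E4 → ℝ) (y : E4) : ℝ := fderiv ℝ f y (EuclideanSpace.single i 1)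

/-- The coordinate vector field `∂_i` of the chart `e`, at the point with coordinates `y`. -/
def coordVec (e : OpenPartialHomeomorph M E4) (i : Fin 4) (y : E4) :
    TangentSpace (𝓡 4) (e.symm y) :=
  mfderiv (𝓡 4) (𝓡 4) e.symm y (EuclideanSpace.single i 1 : E4)

variable [IsManifold (𝓡 4) ∞ M]

/-- The matrix `g_{ij}` of the metric in the chart `e`. -/
def metricMat (g : Metric M) (e : OpenPartialHomeomorph M E4) (y : E4) :
    Matrix (Fin 4) (Fin 4) ℝ :=
  Matrix.of fun i j => g.inner (e.symm y) (coordVec e i y) (coordVec e j y)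

/-- The Christoffel symbols `Γᵏ_{ij}` of the Levi-Civita connection. -/
def christoffel (g : Metric M) (e : OpenPartialHomeomorph M E4) (k i j : Fin 4) (y : E4) : ℝ :=
  1 / 2 * ∑ l, (metricMat g e y)⁻¹ k l *
    (pd i (fun z => metricMat g e z j l) y + pd j (fun z => metricMat g e z i l) y
      - pd l (fun z => metricMat g e z i j) y)

/-- `Rⁱ_{jkl}`, the `i`-th component of `R(∂_k, ∂_l) ∂_j`, where
`R(X, Y) = ∇_X ∇_Y - ∇_Y ∇_X - ∇_[X, Y]`. -/
def riemannUp (g : Metric M) (e : OpenPartialHomeomorph M E4) (i j k l : Fin 4) (y : E4) : ℝ :=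
  pd k (christoffel g e i l j) y - pd l (christoffel g e i k j) y
    + ∑ m, (christoffel g e i k m y * christoffel g e m l j y
      - christoffel g e i l m y * christoffel g e m k j y)

/-- The Riemann tensor `R_{ijkl}`, with `R_{ijij} > 0` on the round sphere for `i ≠ j`. -/
def riemann (g : Metric M) (e : OpenPartialHomeomorph M E4) (i j k l : Fin 4) (y : E4) : ℝ :=
  ∑ m, metricMat g e y i m * riemannUp g e m j k l y

/-- The Ricci tensor `R_{jl} = ∑ g^{ik} R_{ijkl}`. -/
def ricci (g : Metric M) (e : OpenPartialHomeomorph M E4) (j l : Fin 4) (y : E4) : ℝ :=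
  ∑ i, ∑ k, (metricMat g e y)⁻¹ i k * riemann g e i j k l y

/-- The scalar curvature in the chart `e`. -/
def scalarLoc (g : Metric M) (e : OpenPartialHomeomorph M E4) (y : E4) : ℝ :=
  ∑ j, ∑ l, (metricMat g e y)⁻¹ j l * ricci g e j l y

/-- The Weyl tensor `W_{ijkl}` in dimension four. -/
def weyl (g : Metric M) (e : OpenPartialHomeomorph M E4) (i j k l : Fin 4) (y : E4) : ℝ :=
  let Q := metricMat g e y
  riemann g e i j k l y
    - 1 / 2 * (ricci g e i k y * Q j l - ricci g e i l y * Q j k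
      + Q i k * ricci g e j l y - Q i l * ricci g e j k y)
    + 1 / 6 * scalarLoc g e y * (Q i k * Q j l - Q i l * Q j k)

/-- The Weyl tensor as an operator on two-forms:
`(W η)_{ij} = ½ ∑ W_{ijkl} η^{kl} = ∑_{k<l} W_{ijkl} η^{kl}`. -/
def weylOp (g : Metric M) (e : OpenPartialHomeomorph M E4) (y : E4) (η : Fin 4 → Fin 4 → ℝ) :
    Fin 4 → Fin 4 → ℝ := fun i j =>
  1 / 2 * ∑ k, ∑ l, ∑ p, ∑ q,
    weyl g e i j k l y * (metricMat g e y)⁻¹ k p * (metricMat g e y)⁻¹ l q * η p q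

/-- The eigenvalues of `W⁺`, the operator on self-dual two-forms induced by the Weyl tensor. -/
def weylPlusEigenvalues (g : Metric M) (e : OpenPartialHomeomorph M E4) (y : E4) : Set ℝ :=
  {lam | ∃ η : Fin 4 → Fin 4 → ℝ, η ≠ 0 ∧ (∀ i j, η i j = -η j i) ∧
    hodgeStar (metricMat g e y) η = η ∧
    selfDualPart (metricMat g e y) (weylOp g e y η) = lam • η}

/-- The scalar curvature `R`. -/
def scalarCurv (g : Metric M) (x : M) : ℝ := scalarLoc g (chartAt E4 x) (chartAt E4 x x)

/-- `λ_max(W⁺)`, the largest eigenvalue of `W⁺` (for an oriented atlas). -/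
def lambdaMax (g : Metric M) (x : M) : ℝ :=
  sSup (weylPlusEigenvalues g (chartAt E4 x) (chartAt E4 x x))

/-- The Laplace-Beltrami operator
`Δ f = ∑ g^{ij} (∂_i ∂_j f - ∑ Γᵏ_{ij} ∂_k f)`. -/
def laplacian (g : Metric M) (f : M → ℝ) (x : M) : ℝ :=
  let e := chartAt E4 x
  ∑ i, ∑ j, (metricMat g e (e x))⁻¹ i j *
    (pd i (pd j (f ∘ e.symm)) (e x) - ∑ k, christoffel g e k i j (e x) * pd k (f ∘ e.symm) (e x))

/-- `|∇ f|² = ∑ g^{ij} ∂_i f ∂_j f`. -/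
def gradNormSq (g : Metric M) (f : M → ℝ) (x : M) : ℝ :=
  let e := chartAt E4 x
  ∑ i, ∑ j, (metricMat g e (e x))⁻¹ i j * pd i (f ∘ e.symm) (e x) * pd j (f ∘ e.symm) (e x)

end Geometry

/-! ### Bundles and connections -/

section Gauge

variable {M : Type*} [TopologicalSpace M] [ChartedSpace E4 M]
  {n : ℕ} {ι : Type*}

/-- The transition function from the local trivialization `a` to `b`, as a matrix. -/
def transMat (Z : VectorBundleCore ℝ M (Fin n → ℝ) ι) (a b : ι) (x : M) : Mat n :=
  LinearMap.toMatrix' (Z.coordChange a b x : (Fin n → ℝ) →ₗ[ℝ] (Fin n → ℝ))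

/-- The bundle has structure group `G`: all transition functions are `G`-valued. -/
def IsGBundle (G : Subgroup (Matrix.orthogonalGroup (Fin n) ℝ))
    (Z : VectorBundleCore ℝ M (Fin n → ℝ) ι) : Prop :=
  ∀ a b, ∀ x ∈ Z.baseSet a ∩ Z.baseSet b, ∃ h ∈ G, (h : Mat n) = transMat Z a b x

/-- The Lie algebra of `G`: all matrices `X` with `exp (t X) ∈ G` for every real `t`. -/
def lieAlg (G : Subgroup (Matrix.orthogonalGroup (Fin n) ℝ)) : Set (Mat n) :=
  {X | ∀ t : ℝ, ∃ h ∈ G, (h : Mat n) = NormedSpace.exp (t • X)}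

/-- The components `A_i` of a matrix-valued one-form in the chart `e`. -/
def formCoeff (θ : (x : M) → TangentSpace (𝓡 4) x →ₗ[ℝ] Mat n)
    (e : OpenPartialHomeomorph M E4) (i : Fin 4) (y : E4) : Mat n :=
  θ (e.symm y) (coordVec e i y)

/-- A smooth connection on a `G`-bundle, given by its connection one-forms in the local
trivializations: in the trivialization `a` the covariant derivative is `d + A_a`. The values of
`form a` outside the domain of the trivialization `a` are irrelevant. -/
structure Connection (G : Subgroup (Matrix.orthogonalGroup (Fin n) ℝ))
    (Z : VectorBundleCore ℝ M (Fin n → ℝ) ι) where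
  /-- The connection one-form in each local trivialization. -/
  form : ι → (x : M) → TangentSpace (𝓡 4) x →ₗ[ℝ] Mat n
  mem_lieAlg : ∀ a, ∀ x ∈ Z.baseSet a, ∀ v, form a x v ∈ lieAlg G
  smooth : ∀ a, ∀ e ∈ atlas E4 M, ∀ i r s,
    ContDiffOn ℝ ∞ (fun y => formCoeff (form a) e i y r s) (e.target ∩ e.symm ⁻¹' Z.baseSet a)
  /-- The transformation law `A_b t + dt = t A_a`, where `t` is the transition function. -/
  compat : ∀ a b, ∀ x ∈ Z.baseSet a ∩ Z.baseSet b, ∀ v : TangentSpace (𝓡 4) x,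
    form b x v * transMat Z a b x
      + Matrix.of (fun r s => (mfderiv (𝓡 4) 𝓘(ℝ, ℝ) (fun z => transMat Z a b z r s) x v : ℝ))
      = transMat Z a b x * form a x v

/-- Entrywise partial derivative of a matrix-valued function. -/
def pdMat (i : Fin 4) (f : E4 → Mat n) (y : E4) : Mat n :=
  Matrix.of fun r s => pd i (fun z => f z r s) y

variable {G : Subgroup (Matrix.orthogonalGroup (Fin n) ℝ)}
  {Z : VectorBundleCore ℝ M (Fin n → ℝ) ι}

namespace Connection

/-- The curvature `F_{ij} = ∂_i A_j - ∂_j A_i + [A_i, A_j]` in the trivialization `a` and the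
chart `e`. -/
def curv (A : Connection G Z) (a : ι) (e : OpenPartialHomeomorph M E4) (y : E4) (i j : Fin 4) :
    Mat n :=
  pdMat i (formCoeff (A.form a) e j) y - pdMat j (formCoeff (A.form a) e i) y
    + (formCoeff (A.form a) e i y * formCoeff (A.form a) e j y
      - formCoeff (A.form a) e j y * formCoeff (A.form a) e i y)

variable [IsManifold (𝓡 4) ∞ M]

/-- The covariant derivative `∇_k F_{ij}` of the curvature, for the Levi-Civita connection and
`A`. -/
def covDerivCurv (A : Connection G Z) (g : Metric M) (a : ι) (e : OpenPartialHomeomorph M E4)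
    (y : E4) (k i j : Fin 4) : Mat n :=
  pdMat k (fun z => A.curv a e z i j) y
    - ∑ l, christoffel g e l k i y • A.curv a e y l j
    - ∑ l, christoffel g e l k j y • A.curv a e y i l
    + (formCoeff (A.form a) e k y * A.curv a e y i j
      - A.curv a e y i j * formCoeff (A.form a) e k y)

/-- The Yang-Mills equation `d_A^* F_A = 0`, that is `∑ g^{ki} ∇_k F_{ij} = 0`. -/
def IsYangMills (A : Connection G Z) (g : Metric M) : Prop :=
  ∀ a, ∀ e ∈ atlas E4 M, ∀ y ∈ e.target ∩ e.symm ⁻¹' Z.baseSet a, ∀ j,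
    ∑ k, ∑ i, (metricMat g e y)⁻¹ k i • A.covDerivCurv g a e y k i j = 0

/-- `F_A⁺` at `x`: its components in the preferred chart and local trivialization at `x`
(for an oriented atlas). -/
def curvPlus (A : Connection G Z) (g : Metric M) (x : M) : Fin 4 → Fin 4 → Mat n :=
  selfDualPart (metricMat g (chartAt E4 x) (chartAt E4 x x))
    (A.curv (Z.indexAt x) (chartAt E4 x) (chartAt E4 x x))

/-- The function `|F_A⁺|` on `M`. -/
def normCurvPlus (A : Connection G Z) (g : Metric M) (α : ℝ) (x : M) : ℝ :=
  formNorm α (metricMat g (chartAt E4 x) (chartAt E4 x x)) (A.curvPlus g x)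

end Connection

end Gauge

end YangMills

end

open scoped Manifold ContDiff Topology

noncomputable section

namespace YangMills

/-! ### The Levi-Civita symbol -/

/-! Put N = |F⁺|². The proof is a Bochner argument for N, followed by the substitution u = N^(p/2).

The Bianchi identity and the Yang-Mills equation say that F is closed and coclosed. The star is
parallel (`cov_starForm`) and exchanges the two conditions, so F⁺ satisfies both
(`selfDualPart_closed`). For such a form, closedness rewrites ∇^m∇_m F⁺ through commutators of
covariant derivatives (`rough_laplacian`), and the Ricci identity `cov_comm` evaluates these. The
outcome is the Weitzenböck formula ½ΔN = |∇F⁺|² + (R/3)N − 2⟨W F⁺, F⁺⟩ − (a cubic bracket term). Of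
the Ricci tensor only R survives, because a self-dual X has X Xᵀ proportional to the metric
(`IsSelfDual.raise_mul`, `IsSelfDual.riemann_term`).

Three pointwise estimates finish the computation for N. Refined Kato: a closed and coclosed
self-dual form satisfies |∇N|² ≤ (8/3) N |∇F⁺|² (`refined_kato`), because g ⊗ F⁺ loses a third of
its squared length when projected to the kernel of the divergence symbol (`kato_core`). Weyl term:
W⁺ is a symmetric operator on a three-dimensional space, so its quadratic form is at most its
largest eigenvalue times the squared norm (`formDot_tensorOp_le`). Bracket term: in a frame it is
−24⟨[X, Y], Z⟩ for the three components of F⁺ (`sum_triForm_eq`). The bound |[X, Y]| ≤ |X||Y| for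
skew matrices in the Frobenius norm, improved by 1/√2 when n = 3, together with the
arithmetic-geometric mean inequality, produces a_G (`abs_gaugeTerm_le`).

Together: N·½ΔN ≥ (3/8)|∇N|² + (R/3 − 2λ_max)N² − a_G N^(5/2) (`bochner`). Where N > 0, the chain
rule turns p·N^(p−2) times this into the claim. Where N = 0, the nonnegative function u has a
minimum with value 0, so its gradient vanishes and both sides are 0.

The differential identities are proved over a commutative ring with four commuting derivations,
where they are pure algebra, and are then read in the ring `SmoothFun U` of smooth functions on a
chart domain and evaluated at points. Since |F⁺| is defined through a chart and a trivialization
that change with the point, `normCurvPlus_eq` is needed to compute it near a point in a single chart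
and trivialization. -/

/-- An integer version of the Levi-Civita symbol, convenient for evaluation. -/
def leviInt (i j k l : Fin 4) : ℤ :=
  (((j : ℤ) - i) * ((k : ℤ) - i) * ((l : ℤ) - i) * ((k : ℤ) - j) * ((l : ℤ) - j) * ((l : ℤ) - k)) / 12

/-- The Vandermonde product of 0, 1, 2, 3 is 12, so division by 12 leaves the sign of a permutation,
and 0 when two indices agree. Over the integers the finitely many cases are settled by evaluation.
-/
theorem leviCivita_eq_leviInt (i j k l : Fin 4) : leviCivita i j k l = (leviInt i j k l : ℝ) := by
  have h : ∀ i j k l : Fin 4,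
      (Matrix.of fun a b : Fin 4 => if ![i, j, k, l] a = b then (1 : ℤ) else 0).det
        = leviInt i j k l := by
    decide +kernel
  rw [leviCivita, h]

/-- The determinant as a sum against the Levi-Civita symbol. -/
theorem sum_leviCivita_mul (v : Fin 4 → Fin 4 → ℝ) :
    ∑ a, ∑ b, ∑ c, ∑ d, leviCivita a b c d * v 0 a * v 1 b * v 2 c * v 3 d
      = (Matrix.of v).det := by
  have key : ∀ r : Fin 4 → Fin 4, (Matrix.of fun a b : Fin 4 => if r a = b then (1 : ℝ) else 0).det
      = leviCivita (r 0) (r 1) (r 2) (r 3) := by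
    intro r
    have : r = ![r 0, r 1, r 2, r 3] := by ext i; fin_cases i <;> rfl
    rw [leviCivita, ← this]
    have := (Int.castRingHom ℝ).map_det (Matrix.of fun a b : Fin 4 => if r a = b then (1 : ℤ) else 0)
    simp only [eq_intCast] at this
    rw [this]
    congr 1
    ext a b
    by_cases h : r a = b <;> simp [h]
  have hv : ∀ a, v a = ∑ b, v a b • (fun c => if b = c then (1 : ℝ) else 0) := by
    intro a; ext c; simp
  -- Every row is expanded in the standard basis; by multilinearity the determinant becomes a sum
  -- over choices `r` of one column per row.
  have := (Matrix.detRowAlternating (n := Fin 4) (R := ℝ)).toMultilinearMap.map_sum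
    (fun a b => v a b • (fun c => if b = c then (1 : ℝ) else 0))
  simp only [← hv] at this
  have h2 : (Matrix.of v).det = ∑ r : Fin 4 → Fin 4, (∏ a, v a (r a)) *
      leviCivita (r 0) (r 1) (r 2) (r 3) := by
    refine this.trans (Finset.sum_congr rfl fun r _ => ?_)
    rw [MultilinearMap.map_smul_univ, smul_eq_mul, ← key]
    rfl
  rw [h2]
  -- Splitting off one value of `r` at a time turns the sum over functions into four nested sums.
  rw [← (Fin.consEquiv (fun _ : Fin 4 => Fin 4)).sum_comp, Fintype.sum_prod_type]
  refine Finset.sum_congr rfl fun a _ => ?_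
  rw [← (Fin.consEquiv (fun _ : Fin 3 => Fin 4)).sum_comp, Fintype.sum_prod_type]
  refine Finset.sum_congr rfl fun b _ => ?_
  rw [← (Fin.consEquiv (fun _ : Fin 2 => Fin 4)).sum_comp, Fintype.sum_prod_type]
  refine Finset.sum_congr rfl fun c _ => ?_
  rw [← (Fin.consEquiv (fun _ : Fin 1 => Fin 4)).sum_comp, Fintype.sum_prod_type]
  refine Finset.sum_congr rfl fun d _ => ?_
  rw [Fintype.sum_unique]
  rw [Fin.prod_univ_four]
  change _ = v 0 a * v 1 b * v 2 c * v 3 d * leviCivita a b c d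
  ring

/-- Both sides are the determinant of the matrix whose rows are columns i, j, k, l of P, which
factors as a row-selection matrix times Pᵀ. -/
theorem sum_leviCivita_mul_matrix (P : Matrix (Fin 4) (Fin 4) ℝ) (i j k l : Fin 4) :
    ∑ a, ∑ b, ∑ c, ∑ d, leviCivita a b c d * P a i * P b j * P c k * P d l
      = P.det * leviCivita i j k l := by
  have h1 := sum_leviCivita_mul ![fun a => P a i, fun a => P a j, fun a => P a k, fun a => P a l]
  simp only [Matrix.cons_val] at h1
  rw [h1]
  have h2 : Matrix.of ![fun a => P a i, fun a => P a j, fun a => P a k, fun a => P a l]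
      = (Matrix.of fun a b : Fin 4 => if ![i, j, k, l] a = b then (1 : ℝ) else 0) * P.transpose := by
    ext a b
    simp only [Matrix.mul_apply, Matrix.of_apply, ite_mul, one_mul, zero_mul, Finset.sum_ite_eq,
      Finset.mem_univ, if_true, Matrix.transpose_apply]
    fin_cases a <;> rfl
  rw [h2, Matrix.det_mul, Matrix.det_transpose, mul_comm]
  congr 1
  have := (Int.castRingHom ℝ).map_det
    (Matrix.of fun a b : Fin 4 => if ![i, j, k, l] a = b then (1 : ℤ) else 0)
  simp only [eq_intCast] at this
  rw [leviCivita, this]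
  congr 1
  ext a b
  simp only [RingHom.mapMatrix_apply, Matrix.map_apply, Matrix.of_apply]
  split_ifs <;> simp

/-- Infinitesimal version of the transformation law of the Levi-Civita symbol. -/
theorem sum_leviCivita_deriv (k l i j a b : Fin 4) :
    (if a = b then leviCivita k l i j else 0)
      = (if b = k then leviCivita a l i j else 0) + (if b = l then leviCivita k a i j else 0)
      + (if b = i then leviCivita k l a j else 0) + (if b = j then leviCivita k l i a else 0) := by
  have h : ∀ k l i j a b : Fin 4, (if a = b then leviInt k l i j else 0)
      = (if b = k then leviInt a l i j else 0) + (if b = l then leviInt k a i j else 0)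
      + (if b = i then leviInt k l a j else 0) + (if b = j then leviInt k l i a else 0) := by
    decide +kernel
  simp only [leviCivita_eq_leviInt]
  exact_mod_cast h k l i j a b

/-! ### Naturality of the Hodge star, orthonormal frames -/

/-- Real `4 × 4` matrices, also used for the components of real two-forms. -/
abbrev Mat4 : Type := Matrix (Fin 4) (Fin 4) ℝ

theorem sum_six {K : Type*} [AddCommMonoid K] (f : Fin 4 → Fin 4 → Fin 4 → Fin 4 → Fin 4 → Fin 4 → K) :
    ∑ a, ∑ b, ∑ c, ∑ d, ∑ k, ∑ l, f a b c d k l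
      = ∑ x : Fin 4 × Fin 4 × Fin 4 × Fin 4 × Fin 4 × Fin 4,
        f x.1 x.2.1 x.2.2.1 x.2.2.2.1 x.2.2.2.2.1 x.2.2.2.2.2 := by
  simp only [Fintype.sum_prod_type]

theorem sum_four {K : Type*} [AddCommMonoid K] (f : Fin 4 → Fin 4 → Fin 4 → Fin 4 → K) :
    ∑ a, ∑ b, ∑ c, ∑ d, f a b c d
      = ∑ x : Fin 4 × Fin 4 × Fin 4 × Fin 4, f x.1 x.2.1 x.2.2.1 x.2.2.2 := by
  simp only [Fintype.sum_prod_type]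

/-- With the raising of indices written as a matrix product, changes of basis can be followed by
matrix algebra. -/
theorem hodgeStar_real_apply (Q X : Mat4) (i j : Fin 4) :
    hodgeStar Q X i j = 1 / 2 * √Q.det * ∑ k, ∑ l, leviCivita k l i j *
      (Q⁻¹ * X * (Q⁻¹).transpose) k l := by
  simp only [hodgeStar, smul_eq_mul]
  congr 1
  refine Finset.sum_congr rfl fun k _ => Finset.sum_congr rfl fun l _ => ?_
  rw [Matrix.mul_apply, Finset.mul_sum, Finset.sum_comm]
  refine Finset.sum_congr rfl fun q _ => ?_
  rw [Matrix.mul_apply, Finset.sum_mul, Finset.mul_sum]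
  refine Finset.sum_congr rfl fun p _ => ?_
  rw [Matrix.transpose_apply]
  ring

theorem hodgeStar_entry {n : ℕ} (Q : Mat4) (η : Fin 4 → Fin 4 → Mat n) (i j : Fin 4)
    (r s : Fin n) :
    hodgeStar Q η i j r s = hodgeStar Q (fun i j => η i j r s) i j := by
  simp [hodgeStar, Matrix.sum_apply]

theorem selfDualPart_entry {n : ℕ} (Q : Mat4) (η : Fin 4 → Fin 4 → Mat n) (i j : Fin 4)
    (r s : Fin n) :
    selfDualPart Q η i j r s = selfDualPart Q (fun i j => η i j r s) i j := by
  simp [selfDualPart, hodgeStar_entry]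

theorem inv_conj (Q J : Mat4) :
    (J.transpose * Q * J)⁻¹ = J⁻¹ * Q⁻¹ * (J⁻¹).transpose := by
  rw [Matrix.mul_inv_rev, Matrix.mul_inv_rev, Matrix.transpose_nonsing_inv, Matrix.mul_assoc]

theorem det_conj (Q J : Mat4) : (J.transpose * Q * J).det = J.det ^ 2 * Q.det := by
  rw [Matrix.det_mul, Matrix.det_mul, Matrix.det_transpose]; ring

/-- Raised components are contravariant: J carries those of the new basis to those of the old one.
-/
theorem conj_inv_cancel (Q J X : Mat4) (hJ : J.det ≠ 0) :
    J * ((J.transpose * Q * J)⁻¹ * (J.transpose * X * J) * ((J.transpose * Q * J)⁻¹).transpose)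
      * J.transpose = Q⁻¹ * X * (Q⁻¹).transpose := by
  have h : IsUnit J.det := isUnit_iff_ne_zero.mpr hJ
  rw [inv_conj Q J]
  simp only [Matrix.transpose_mul, Matrix.transpose_transpose]
  have h1 : J * J⁻¹ = 1 := Matrix.mul_nonsing_inv J h
  have h2 : (J⁻¹).transpose * J.transpose = 1 := by
    rw [← Matrix.transpose_mul, h1, Matrix.transpose_one]
  calc _ = (J * J⁻¹) * Q⁻¹ * ((J⁻¹).transpose * J.transpose) * X * (J * J⁻¹) *
        (Q⁻¹).transpose * ((J⁻¹).transpose * J.transpose) := by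
          simp only [Matrix.mul_assoc]
    _ = _ := by rw [h1, h2]; simp only [Matrix.mul_one, Matrix.one_mul]

/-- The Hodge star commutes with orientation preserving changes of basis. -/
theorem hodgeStar_conj (Q J X : Mat4) (hJ : 0 < J.det) :
    hodgeStar (J.transpose * Q * J) (J.transpose * X * J)
      = J.transpose * Matrix.of (hodgeStar Q X) * J := by
  have hne := hJ.ne'
  set g := (J.transpose * Q * J)⁻¹ * (J.transpose * X * J) *
    ((J.transpose * Q * J)⁻¹).transpose with hg
  have hh : J * g * J.transpose = Q⁻¹ * X * (Q⁻¹).transpose := conj_inv_cancel Q J X hne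
  ext i j
  -- Orientation enters here: √(det J)² is det J, and it has to match the factor det J, without
  -- absolute value, that the Levi-Civita symbol produces.
  rw [hodgeStar_real_apply, ← hg, det_conj, Real.sqrt_mul (sq_nonneg _), Real.sqrt_sq hJ.le]
  have hstar : Matrix.of (hodgeStar Q X) = Matrix.of fun a b => 1 / 2 * √Q.det * ∑ k, ∑ l,
      leviCivita k l a b * ∑ c, ∑ d, J k c * g c d * J l d := by
    ext a b
    rw [Matrix.of_apply, hodgeStar_real_apply, ← hh, Matrix.of_apply]
    congr 1
    refine Finset.sum_congr rfl fun k _ => Finset.sum_congr rfl fun l _ => ?_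
    congr 1
    rw [Matrix.mul_apply, Finset.sum_comm]
    refine Finset.sum_congr rfl fun q _ => ?_
    rw [Matrix.mul_apply, Finset.sum_mul]
    rfl
  rw [hstar]
  have e1 : (J.transpose * (Matrix.of fun a b => 1 / 2 * √Q.det * ∑ k, ∑ l,
      leviCivita k l a b * ∑ c, ∑ d, J k c * g c d * J l d) * J) i j
      = 1 / 2 * √Q.det * ∑ c, ∑ d, g c d * (∑ k, ∑ l, ∑ a, ∑ b, leviCivita k l a b *
        J k c * J l d * J a i * J b j) := by
    simp only [Matrix.mul_apply, Matrix.of_apply, Matrix.transpose_apply, Finset.mul_sum,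
      Finset.sum_mul]
    have r1 : ∀ f : Fin 4 → Fin 4 → Fin 4 → Fin 4 → Fin 4 → Fin 4 → ℝ,
        ∑ b, ∑ a, ∑ k, ∑ l, ∑ c, ∑ d, f a b c d k l = ∑ c, ∑ d, ∑ k, ∑ l, ∑ a, ∑ b,
          f a b c d k l := by
      intro f
      rw [sum_six fun b a k l c d => f a b c d k l, sum_six fun c d k l a b => f a b c d k l]
      exact Fintype.sum_equiv ⟨fun ⟨b, a, k, l, c, d⟩ => ⟨c, d, k, l, a, b⟩,
        fun ⟨c, d, k, l, a, b⟩ => ⟨b, a, k, l, c, d⟩, fun _ => rfl, fun _ => rfl⟩ _ _ fun _ => rfl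
    rw [r1]
    refine Finset.sum_congr rfl fun _ _ => Finset.sum_congr rfl fun _ _ =>
      Finset.sum_congr rfl fun _ _ => Finset.sum_congr rfl fun _ _ =>
      Finset.sum_congr rfl fun _ _ => Finset.sum_congr rfl fun _ _ => ?_
    ring
  rw [e1]
  simp only [sum_leviCivita_mul_matrix, Finset.mul_sum]
  refine Finset.sum_congr rfl fun _ _ => Finset.sum_congr rfl fun _ _ => ?_
  ring

/-! ### Inner products of two-forms -/

/-- The inner product `½ ∑ Q^{ik} Q^{jl} X_{ij} Y_{kl}` of real two-forms. -/
def formDot (Q X Y : Mat4) : ℝ :=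
  1 / 2 * ∑ i, ∑ j, ∑ k, ∑ l, Q⁻¹ i k * Q⁻¹ j l * (X i j * Y k l)

/-- The inner product of matrix-valued two-forms. -/
def formInner {n : ℕ} (α : ℝ) (Q : Mat4) (η ζ : Fin 4 → Fin 4 → Mat n) : ℝ :=
  1 / 2 * ∑ i, ∑ j, ∑ k, ∑ l, Q⁻¹ i k * Q⁻¹ j l * matInner α (η i j) (ζ k l)

theorem formNorm_eq_sqrt {n : ℕ} (α : ℝ) (Q : Mat4) (η : Fin 4 → Fin 4 → Mat n) :
    formNorm α Q η = √(formInner α Q η η) := rfl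

/-- The `(r, s)` entry of a matrix-valued two-form. -/
def entryForm {n : ℕ} (η : Fin 4 → Fin 4 → Mat n) (r s : Fin n) : Mat4 :=
  Matrix.of fun i j => η i j r s

/-- The star, the Weyl operator and changes of frame act on each matrix entry separately, so
statements about them reduce to real forms. Only brackets mix the entries. -/
theorem formInner_eq_sum {n : ℕ} (α : ℝ) (Q : Mat4) (η ζ : Fin 4 → Fin 4 → Mat n) :
    formInner α Q η ζ = α * ∑ r, ∑ s, formDot Q (entryForm η r s) (entryForm ζ r s) := by
  simp only [formInner, formDot, matInner, entryForm, Matrix.of_apply, Finset.mul_sum]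
  have r1 : ∀ f : Fin 4 → Fin 4 → Fin 4 → Fin 4 → Fin n → Fin n → ℝ,
      ∑ i, ∑ j, ∑ k, ∑ l, ∑ r, ∑ s, f i j k l r s = ∑ r, ∑ s, ∑ i, ∑ j, ∑ k, ∑ l, f i j k l r s := by
    intro f
    have h1 : ∑ i, ∑ j, ∑ k, ∑ l, ∑ r, ∑ s, f i j k l r s = ∑ x : Fin 4 × Fin 4 × Fin 4 × Fin 4,
        ∑ y : Fin n × Fin n, f x.1 x.2.1 x.2.2.1 x.2.2.2 y.1 y.2 := by
      simp only [Fintype.sum_prod_type]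
    rw [h1, Finset.sum_comm]
    simp only [Fintype.sum_prod_type]
  rw [r1]
  refine Finset.sum_congr rfl fun _ _ => Finset.sum_congr rfl fun _ _ =>
    Finset.sum_congr rfl fun _ _ => Finset.sum_congr rfl fun _ _ =>
    Finset.sum_congr rfl fun _ _ => Finset.sum_congr rfl fun _ _ => ?_
  ring

/-- Written as a trace, the inner product is invariant under changes of basis by cyclicity. -/
theorem formDot_eq_trace (Q X Y : Mat4) :
    formDot Q X Y = 1 / 2 * ((Q⁻¹).transpose * X * Q⁻¹ * Y.transpose).trace := by
  simp only [formDot, Matrix.trace, Matrix.diag, Matrix.mul_apply, Matrix.transpose_apply,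
    Finset.sum_mul]
  congr 1
  rw [sum_four fun i j k l => Q⁻¹ i k * Q⁻¹ j l * (X i j * Y k l),
    sum_four fun k l j i => Q⁻¹ i k * X i j * Q⁻¹ j l * Y k l]
  refine Fintype.sum_equiv ⟨fun ⟨i, j, k, l⟩ => ⟨k, l, j, i⟩,
        fun ⟨k, l, j, i⟩ => ⟨i, j, k, l⟩, fun _ => rfl, fun _ => rfl⟩ _ _ fun _ => ?_
  simp only [Equiv.coe_fn_mk]
  ring

theorem formDot_conj (Q J X Y : Mat4) (hJ : J.det ≠ 0) :
    formDot (J.transpose * Q * J) (J.transpose * X * J) (J.transpose * Y * J) = formDot Q X Y := by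
  have h1 : J * J⁻¹ = 1 := Matrix.mul_nonsing_inv J (isUnit_iff_ne_zero.mpr hJ)
  have h2 : (J⁻¹).transpose * J.transpose = 1 := by
    rw [← Matrix.transpose_mul, h1, Matrix.transpose_one]
  rw [formDot_eq_trace, formDot_eq_trace, inv_conj]
  congr 1
  simp only [Matrix.transpose_mul, Matrix.transpose_transpose]
  calc _ = (J⁻¹ * ((Q⁻¹).transpose * ((J⁻¹).transpose * J.transpose) * X * (J * J⁻¹) * Q⁻¹ *
        ((J⁻¹).transpose * J.transpose) * Y.transpose * J)).trace := by
          simp only [Matrix.mul_assoc]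
    _ = _ := by
      rw [Matrix.trace_mul_comm, h1, h2, Matrix.mul_assoc _ J, h1]
      simp only [Matrix.mul_one]

theorem entryForm_selfDualPart {n : ℕ} (Q : Mat4) (η : Fin 4 → Fin 4 → Mat n) (r s : Fin n) :
    entryForm (selfDualPart Q η) r s = Matrix.of (selfDualPart Q (entryForm η r s)) := by
  ext i j; exact selfDualPart_entry Q η i j r s

theorem selfDualPart_conj (Q J X : Mat4) (hJ : 0 < J.det) :
    Matrix.of (selfDualPart (J.transpose * Q * J) (J.transpose * X * J))
      = J.transpose * Matrix.of (selfDualPart Q X) * J := by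
  have h : ∀ Q X : Mat4, Matrix.of (selfDualPart Q X) =
      (1 / 2 : ℝ) • (X + Matrix.of (hodgeStar Q X)) := fun Q X => rfl
  rw [h, h, hodgeStar_conj Q J X hJ, Matrix.mul_smul, Matrix.smul_mul, Matrix.mul_add,
    Matrix.add_mul]
  rfl

/-- Positively oriented orthonormal frames exist. -/
theorem exists_frame (Q : Mat4) (hQ : Q.PosDef) :
    ∃ P : Mat4, P.transpose * Q * P = 1 ∧ 0 < P.det := by
  -- With B the positive square root of Q, the columns of B⁻¹ are orthonormal; only the orientation
  -- may be wrong.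
  obtain ⟨B, hB⟩ : ∃ B : Mat4, Q = B.transpose * B := by
    open scoped MatrixOrder in
    have h0 : 0 ≤ Q := Matrix.nonneg_iff_posSemidef.mpr hQ.posSemidef
    have h1 : (CFC.sqrt Q).IsHermitian :=
      (Matrix.nonneg_iff_posSemidef.mp (CFC.sqrt_nonneg Q)).isHermitian
    rw [Matrix.IsHermitian, Matrix.conjTranspose_eq_transpose_of_trivial] at h1
    exact ⟨CFC.sqrt Q, by rw [h1, CFC.sqrt_mul_sqrt_self Q h0]⟩
  have hdet : B.det ≠ 0 := by
    intro h
    have := hQ.det_pos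
    rw [hB, Matrix.det_mul, h, mul_zero] at this
    exact lt_irrefl _ this
  have hu : IsUnit B.det := isUnit_iff_ne_zero.mpr hdet
  have h1 : B * B⁻¹ = 1 := Matrix.mul_nonsing_inv B hu
  have h2 : (B⁻¹).transpose * B.transpose = 1 := by
    rw [← Matrix.transpose_mul, h1, Matrix.transpose_one]
  have key : (B⁻¹).transpose * Q * B⁻¹ = 1 := by
    rw [hB]
    calc _ = ((B⁻¹).transpose * B.transpose) * (B * B⁻¹) := by simp only [Matrix.mul_assoc]
      _ = 1 := by rw [h1, h2, one_mul]
  have hd : B⁻¹.det ≠ 0 := (Matrix.isUnit_nonsing_inv_det B hu).ne_zero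
  rcases lt_or_gt_of_ne hd with h | h
  -- Reversing the first frame vector corrects the orientation.
  · let D : Mat4 := Matrix.diagonal ![-1, 1, 1, 1]
    have hD : D.transpose * D = 1 := by
      rw [Matrix.diagonal_transpose, Matrix.diagonal_mul_diagonal]
      ext i j; fin_cases i <;> fin_cases j <;> simp
    refine ⟨B⁻¹ * D, ?_, ?_⟩
    · rw [Matrix.transpose_mul]
      calc _ = D.transpose * ((B⁻¹).transpose * Q * B⁻¹) * D := by simp only [Matrix.mul_assoc]
        _ = 1 := by rw [key, Matrix.mul_one, hD]
    · rw [Matrix.det_mul, Matrix.det_diagonal, Fin.prod_univ_four]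
      simpa using h
  · exact ⟨B⁻¹, key, h⟩

theorem inv_eq_frame {Q P : Mat4} (hP : P.transpose * Q * P = 1) : Q⁻¹ = P * P.transpose := by
  apply Matrix.inv_eq_left_inv
  have h := mul_eq_one_comm.mp hP
  rw [Matrix.mul_assoc]; exact h

theorem formDot_one (X Y : Mat4) : formDot 1 X Y = 1 / 2 * ∑ i, ∑ j, X i j * Y i j := by
  simp [formDot, Matrix.one_apply]

theorem formDot_frame {Q P : Mat4} (hP : P.transpose * Q * P = 1) (hd : 0 < P.det) (X Y : Mat4) :
    formDot Q X Y = formDot 1 (P.transpose * X * P) (P.transpose * Y * P) := by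
  rw [← formDot_conj Q P X Y hd.ne', hP]

theorem hodgeStar_frame {Q P : Mat4} (hP : P.transpose * Q * P = 1) (hd : 0 < P.det) (X : Mat4) :
    hodgeStar 1 (P.transpose * X * P) = P.transpose * Matrix.of (hodgeStar Q X) * P := by
  rw [← hodgeStar_conj Q P X hd, hP]

/-! ### Self-dual forms in an orthonormal frame -/

theorem hodgeStar_one_apply (X : Mat4) (i j : Fin 4) :
    hodgeStar 1 X i j = 1 / 2 * ∑ k, ∑ l, (leviInt k l i j : ℝ) * X k l := by
  rw [hodgeStar_real_apply]
  simp [leviCivita_eq_leviInt]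

/-- The Hodge star of an antisymmetric form in an orthonormal frame. -/
theorem hodgeStar_one_eq (X : Mat4) (hX : X.transpose = -X) :
    hodgeStar 1 X = !![0, X 2 3, -X 1 3, X 1 2; -X 2 3, 0, X 0 3, -X 0 2;
      X 1 3, -X 0 3, 0, X 0 1; -X 1 2, X 0 2, -X 0 1, 0] := by
  have h : ∀ i j, X j i = -X i j := fun i j => congrFun (congrFun hX i) j
  ext i j
  rw [hodgeStar_one_apply]
  fin_cases i <;> fin_cases j <;>
    simp [Fin.sum_univ_four, leviInt, h 0 1, h 0 2, h 0 3, h 1 2, h 1 3, h 2 3] <;> ring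

/-- The standard basis of self-dual two-forms on `ℝ⁴`. -/
def sdForm : Fin 3 → Mat4 :=
  ![!![0, 1, 0, 0; -1, 0, 0, 0; 0, 0, 0, 1; 0, 0, -1, 0],
    !![0, 0, 1, 0; 0, 0, 0, -1; -1, 0, 0, 0; 0, 1, 0, 0],
    !![0, 0, 0, 1; 0, 0, 1, 0; 0, -1, 0, 0; -1, 0, 0, 0]]

/-- Self-duality determines the components 23, 13, 12 from 01, 02, 03, so the first row already
contains all coordinates. -/
theorem eq_sum_sdForm (X : Mat4) (hX : X.transpose = -X) (hs : hodgeStar 1 X = X) :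
    X = ∑ a, X 0 a.succ • sdForm a := by
  have h : ∀ i j, X j i = -X i j := fun i j => congrFun (congrFun hX i) j
  rw [hodgeStar_one_eq X hX] at hs
  have h0 : ∀ i, X i i = 0 := fun i => by linarith [h i i]
  have h01 : X 2 3 = X 0 1 := congrFun (congrFun hs 0) 1
  have h02 : X 1 3 = -X 0 2 := by have := congrFun (congrFun hs 0) 2; simp at this; linarith
  have h03 : X 1 2 = X 0 3 := congrFun (congrFun hs 0) 3
  ext i j
  fin_cases i <;> fin_cases j <;>
    simp [Fin.sum_univ_three, sdForm, h0, h 0 1, h 0 2, h 0 3, h 1 2, h 1 3, h 2 3, h01, h02, h03]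

theorem sdForm_transpose (a : Fin 3) : (sdForm a).transpose = -sdForm a := by
  ext i j
  fin_cases a <;> fin_cases i <;> fin_cases j <;> simp [sdForm]

theorem hodgeStar_sdForm (a : Fin 3) : hodgeStar 1 (sdForm a) = sdForm a := by
  rw [hodgeStar_one_eq _ (sdForm_transpose a)]
  ext i j
  fin_cases a <;> fin_cases i <;> fin_cases j <;> simp [sdForm]

theorem formDot_sdForm (a b : Fin 3) :
    formDot 1 (sdForm a) (sdForm b) = if a = b then 2 else 0 := by
  rw [formDot_one]
  fin_cases a <;> fin_cases b <;> simp [sdForm, Fin.sum_univ_four] <;> norm_num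

/-! ### Commutators of skew-symmetric matrices -/

section Commutator

theorem sum_norm_sq_eq_trace {m : Type*} [Fintype m] (Z : Matrix m m ℂ) :
    ((∑ a, ∑ b, ‖Z a b‖ ^ 2 : ℝ) : ℂ) = (Z.conjTranspose * Z).trace := by
  rw [Finset.sum_comm]
  simp only [Matrix.trace, Matrix.diag, Matrix.mul_apply, Matrix.conjTranspose_apply]
  push_cast
  refine Finset.sum_congr rfl fun _ _ => Finset.sum_congr rfl fun _ _ => ?_
  rw [RCLike.star_def, Complex.conj_mul']

variable {m : Type*} [Fintype m] [DecidableEq m]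

/-- Unitary invariance of the Frobenius norm, which allows the commutator to be measured in an
eigenbasis. -/
theorem sum_norm_sq_conj (U Z : Matrix m m ℂ) (hU : U * U.conjTranspose = 1) :
    ∑ a, ∑ b, ‖(U.conjTranspose * Z * U) a b‖ ^ 2 = ∑ a, ∑ b, ‖Z a b‖ ^ 2 := by
  have : ((∑ a, ∑ b, ‖(U.conjTranspose * Z * U) a b‖ ^ 2 : ℝ) : ℂ)
      = ((∑ a, ∑ b, ‖Z a b‖ ^ 2 : ℝ) : ℂ) := by
    rw [sum_norm_sq_eq_trace, sum_norm_sq_eq_trace]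
    simp only [Matrix.conjTranspose_mul, Matrix.conjTranspose_conjTranspose]
    calc _ = (U.conjTranspose * (Z.conjTranspose * (U * U.conjTranspose) * Z * U)).trace := by
          simp only [Matrix.mul_assoc]
      _ = _ := by
        rw [Matrix.trace_mul_comm, hU, Matrix.mul_assoc _ U, hU]; simp only [Matrix.mul_one]
  exact_mod_cast this

/-- Here `lam` stands for the spectrum of iX, M for Y in an eigenbasis, and C for complex
conjugation in that basis, which pairs each eigenvalue with its negative. Eigenvalues of equal sign
need only the indices j and k. For opposite signs, four distinct indices with eigenvalues ±λ_j and
±λ_k are produced, and (λ_j − λ_k)² ≤ 2λ_j² + 2λ_k² concludes. -/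
theorem sq_sub_le_of_ne_zero (lam : m → ℝ) (M C : Matrix m m ℂ)
    (hCne : ∀ l j, C l j ≠ 0 → lam l = - lam j) (hCcol : ∀ j, ∃ l, C l j ≠ 0)
    (hMC : ∀ j, ∑ l, M j l * C l j = 0) (hCM : ∀ k, ∑ l, star (C l k) * M l k = 0)
    (j k : m) (hjk : M j k ≠ 0) : (lam j - lam k) ^ 2 ≤ ∑ i, lam i ^ 2 := by
  have hsub : ∀ s : Finset m, ∑ i ∈ s, lam i ^ 2 ≤ ∑ i, lam i ^ 2 := fun s =>
    Finset.sum_le_sum_of_subset_of_nonneg (Finset.subset_univ s) fun _ _ _ => sq_nonneg _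
  by_cases hjk' : j = k
  · subst hjk'; simp; exact Finset.sum_nonneg fun _ _ => sq_nonneg _
  rcases le_or_gt 0 (lam j * lam k) with hpos | hneg
  · refine le_trans ?_ (hsub {j, k})
    rw [Finset.sum_pair hjk']
    nlinarith
  have hfour : ∀ l l', lam l = lam k → lam l' = lam j → l ≠ k → l' ≠ j → lam k = - lam j →
      (lam j - lam k) ^ 2 ≤ ∑ i, lam i ^ 2 := by
    intro l l' hl hl' hlk hlj hab
    have hne : lam j ≠ lam k := fun h => by rw [h] at hneg; nlinarith
    refine le_trans ?_ (hsub {j, l', k, l})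
    have n1 : k ≠ l := Ne.symm hlk
    have n2 : l' ≠ k := fun h => hne (by rw [← hl', h])
    have n3 : l' ≠ l := fun h => hne (by rw [← hl', h, hl])
    have n4 : j ≠ l := fun h => hne (by rw [h, hl])
    rw [Finset.sum_insert (by simp [Ne.symm hlj, hjk', n4]),
      Finset.sum_insert (by simp [n2, n3]), Finset.sum_pair n1, hl, hl', hab]
    nlinarith
  -- When λ_k = −λ_j, the partner of j may be k itself. If C joined j to no other index, `hMC` would
  -- force M j k = 0; likewise `hCM` for k. Hence both eigenvalues are repeated.
  by_cases hab : lam k = - lam j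
  · obtain ⟨l, hlk, hl⟩ : ∃ l, l ≠ k ∧ C l j ≠ 0 := by
      by_contra hcon
      push Not at hcon
      have h1 := hMC j
      rw [Finset.sum_eq_single k (fun l _ h => by rw [hcon l h, mul_zero]) (by simp)] at h1
      obtain ⟨l, hl⟩ := hCcol j
      have : l = k := by by_contra h; exact hl (hcon l h)
      subst this
      exact (mul_ne_zero hjk hl) h1
    obtain ⟨l', hlj, hl'⟩ : ∃ l, l ≠ j ∧ C l k ≠ 0 := by
      by_contra hcon
      push Not at hcon
      have h1 := hCM k
      rw [Finset.sum_eq_single j (fun l _ h => by rw [hcon l h, star_zero, zero_mul])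
        (by simp)] at h1
      obtain ⟨q, hq⟩ := hCcol k
      have : q = j := by by_contra h; exact hq (hcon q h)
      subst this
      exact (mul_ne_zero (star_ne_zero.mpr hq) hjk) h1
    exact hfour l l' (by rw [hCne l j hl, hab]) (by rw [hCne l' k hl', hab, neg_neg]) hlk hlj hab
  · obtain ⟨l, hl⟩ := hCcol j
    obtain ⟨l', hl'⟩ := hCcol k
    have e1 := hCne l j hl
    have e2 := hCne l' k hl'
    have nj : lam j ≠ 0 := fun h => by rw [h] at hneg; simp at hneg
    have nk : lam k ≠ 0 := fun h => by rw [h] at hneg; simp at hneg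
    have n1 : j ≠ l := fun h => nj (by rw [← h] at e1; linarith)
    have n2 : j ≠ l' := fun h => hab (by rw [← h] at e2; linarith)
    have n3 : k ≠ l := fun h => hab (by rw [← h] at e1; linarith)
    have n4 : k ≠ l' := fun h => nk (by rw [← h] at e2; linarith)
    have n5 : l ≠ l' := fun h => by
      rw [← h, e1] at e2
      have : lam j = lam k := by linarith
      rw [this] at hneg; nlinarith
    refine le_trans ?_ (hsub {j, k, l, l'})
    rw [Finset.sum_insert (by simp [hjk', n1, n2]), Finset.sum_insert (by simp [n3, n4]),
      Finset.sum_pair n5, e1, e2]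
    nlinarith [sq_nonneg (lam j + lam k)]

/-- The Frobenius norm is submultiplicative for commutators of skew-symmetric matrices, with
constant one. -/
theorem sum_commutator_sq_le (X Y : Matrix m m ℝ) (hX : X.transpose = -X)
    (hY : Y.transpose = -Y) :
    ∑ a, ∑ b, (X * Y - Y * X) a b ^ 2 ≤ (∑ a, ∑ b, X a b ^ 2) * ∑ a, ∑ b, Y a b ^ 2 := by
  set Xc : Matrix m m ℂ := X.map Complex.ofRealHom with hXc
  set Yc : Matrix m m ℂ := Y.map Complex.ofRealHom with hYc
  have hYct : Yc.transpose = -Yc := by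
    ext a b
    have := congrFun (congrFun hY a) b
    simp only [Matrix.transpose_apply, Matrix.neg_apply] at this
    simp [hYc, this]
  -- iX is Hermitian and its entrywise conjugate is −iX, which makes the spectrum symmetric about 0.
  set H : Matrix m m ℂ := Complex.I • Xc with hHdef
  have hXs : ∀ a b, X a b = - X b a := fun a b => congrFun (congrFun hX b) a
  have hH : H.IsHermitian := by
    ext a b
    simp only [hHdef, hXc, Matrix.conjTranspose_apply, Matrix.smul_apply, Matrix.map_apply,
      smul_eq_mul, star_mul', RCLike.star_def, Complex.conj_I, Complex.ofRealHom_eq_coe,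
      Complex.conj_ofReal]
    rw [hXs b a]; push_cast; ring
  have hHconj : H.map star = -H := by
    ext a b
    simp [hHdef, hXc]
  set U : Matrix m m ℂ := (hH.eigenvectorUnitary : Matrix m m ℂ) with hUdef
  set lam := hH.eigenvalues with hlam
  have hU1 : U * U.conjTranspose = 1 := Unitary.mul_star_self_of_mem hH.eigenvectorUnitary.2
  have hU2 : U.conjTranspose * U = 1 := Unitary.star_mul_self_of_mem hH.eigenvectorUnitary.2
  set D : Matrix m m ℂ := Matrix.diagonal fun i => (lam i : ℂ) with hD
  have hspec : U.conjTranspose * H * U = D := by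
    have := Matrix.IsHermitian.conjStarAlgAut_star_eigenvectorUnitary hH
    rw [Unitary.conjStarAlgAut_star_apply] at this
    exact this
  have hspec' : U.conjTranspose * H = D * U.conjTranspose := by
    rw [← hspec, Matrix.mul_assoc _ U, hU1, Matrix.mul_one]
  have hspec2 : H * U = U * D := by
    rw [← hspec]
    calc H * U = (U * U.conjTranspose) * H * U := by rw [hU1, Matrix.one_mul]
      _ = _ := by simp only [Matrix.mul_assoc]
  set M := U.conjTranspose * Yc * U with hM
  set Ub : Matrix m m ℂ := U.map star with hUb
  -- Column j of C holds the coordinates of the conjugate of the j-th eigenvector, which is an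
  -- eigenvector for −λ_j.
  set C := U.conjTranspose * Ub with hC
  have hHUb : H * Ub = -(Ub * D) := by
    have h1 : (H * U).map star = (U * D).map star := by rw [hspec2]
    have h2 : (D.map star) = D := by
      ext a b
      by_cases hab : a = b
      · subst hab; simp [hD]
      · simp [hD, Matrix.diagonal_apply_ne _ hab]
    have hmap : ∀ A B : Matrix m m ℂ, (A * B).map star = A.map star * B.map star := by
      intro A B
      exact Matrix.map_mul (f := starRingEnd ℂ)
    rw [hmap, hmap, hHconj, h2] at h1
    rw [← h1, Matrix.neg_mul, neg_neg]
  have hCD : D * C = -(C * D) := by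
    rw [hC, ← Matrix.mul_assoc, ← hspec', Matrix.mul_assoc, hHUb, Matrix.mul_neg,
      Matrix.mul_assoc]
  have hCne : ∀ l j, C l j ≠ 0 → lam l = - lam j := by
    intro l j h
    have := congrFun (congrFun hCD l) j
    rw [Matrix.neg_apply, hD, Matrix.diagonal_mul, Matrix.mul_diagonal] at this
    have h2 : ((lam l : ℂ) + lam j) * C l j = 0 := by linear_combination this
    have h3 := (mul_eq_zero.mp h2).resolve_right h
    have h4 : lam l + lam j = 0 := by exact_mod_cast h3
    linarith
  have hCsymm : ∀ l j, C l j = C j l := by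
    intro l j
    simp only [hC, hUb, Matrix.mul_apply, Matrix.conjTranspose_apply, Matrix.map_apply]
    exact Finset.sum_congr rfl fun _ _ => mul_comm _ _
  have hUbC : U * C = Ub := by rw [hC, ← Matrix.mul_assoc, hU1, Matrix.one_mul]
  have hCcol : ∀ j, ∃ l, C l j ≠ 0 := by
    intro j
    by_contra hcon
    push Not at hcon
    have h0 : ∀ a, Ub a j = 0 := by
      intro a
      rw [← hUbC, Matrix.mul_apply]
      exact Finset.sum_eq_zero fun l _ => by rw [hcon l, mul_zero]
    have h1 := congrFun (congrFun hU2 j) j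
    rw [Matrix.mul_apply, Matrix.one_apply_eq] at h1
    have h2 : ∀ a, U a j = 0 := fun a => by
      have := h0 a
      simpa [hUb] using this
    simp [h2] at h1
  -- The form is bilinear rather than Hermitian, so skewness kills it on the diagonal also for
  -- complex v. Eigenvectors and their conjugates are inserted below.
  have hskew : ∀ v : m → ℂ, ∑ a, ∑ b, v a * Yc a b * v b = 0 := by
    intro v
    have h : ∑ a, ∑ b, v a * Yc a b * v b = - ∑ a, ∑ b, v a * Yc a b * v b := by
      conv_lhs => rw [Finset.sum_comm]
      rw [← Finset.sum_neg_distrib]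
      refine Finset.sum_congr rfl fun a _ => ?_
      rw [← Finset.sum_neg_distrib]
      refine Finset.sum_congr rfl fun b _ => ?_
      have := congrFun (congrFun hYct a) b
      rw [Matrix.transpose_apply, Matrix.neg_apply] at this
      rw [this]; ring
    have h2 : (2 : ℂ) * ∑ a, ∑ b, v a * Yc a b * v b = 0 := by linear_combination h
    simpa using h2
  have hMC : ∀ j, ∑ l, M j l * C l j = 0 := by
    intro j
    have h1 : (M * C) j j = (U.conjTranspose * Yc * Ub) j j := by
      rw [hM, Matrix.mul_assoc, hUbC]
    rw [Matrix.mul_apply] at h1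
    rw [h1, Matrix.mul_apply, Finset.sum_congr rfl fun b _ => by rw [Matrix.mul_apply, Finset.sum_mul]]
    rw [Finset.sum_comm, ← hskew fun a => star (U a j)]
    rfl
  have hCM : ∀ k, ∑ l, star (C l k) * M l k = 0 := by
    intro k
    have h1 : (C.conjTranspose * M) k k = (Ub.conjTranspose * Yc * U) k k := by
      rw [hM, ← Matrix.mul_assoc, ← Matrix.mul_assoc, hC, Matrix.conjTranspose_mul,
        Matrix.conjTranspose_conjTranspose, Matrix.mul_assoc _ U, hU1, Matrix.mul_one]
    rw [Matrix.mul_apply] at h1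
    simp only [Matrix.conjTranspose_apply] at h1
    rw [h1, Matrix.mul_apply, Finset.sum_congr rfl fun b _ => by rw [Matrix.mul_apply, Finset.sum_mul]]
    rw [Finset.sum_comm, ← hskew fun a => U a k]
    simp [hUb]
  have key := sq_sub_le_of_ne_zero lam M C hCne hCcol hMC hCM
  have hnormX : ∑ a, ∑ b, X a b ^ 2 = ∑ i, lam i ^ 2 := by
    have h1 := sum_norm_sq_conj U H hU1
    rw [hspec] at h1
    have h2 : ∑ a, ∑ b, ‖D a b‖ ^ 2 = ∑ i, lam i ^ 2 := by
      refine Finset.sum_congr rfl fun a _ => ?_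
      rw [Finset.sum_eq_single a (fun b _ h => by rw [hD, Matrix.diagonal_apply_ne' _ h]; simp)
        (by simp)]
      simp [hD]
    rw [← h2, h1]
    simp [hHdef, hXc]
  have hnormY : ∑ a, ∑ b, Y a b ^ 2 = ∑ j, ∑ k, ‖M j k‖ ^ 2 := by
    rw [hM, sum_norm_sq_conj U Yc hU1]
    simp [hYc]
  -- In the eigenbasis the bracket with H multiplies entry (j, k) of M by λ_j − λ_k.
  have hnormC : ∑ a, ∑ b, (X * Y - Y * X) a b ^ 2
      = ∑ j, ∑ k, (lam j - lam k) ^ 2 * ‖M j k‖ ^ 2 := by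
    have h1 : ∑ a, ∑ b, (X * Y - Y * X) a b ^ 2 = ∑ a, ∑ b, ‖(H * Yc - Yc * H) a b‖ ^ 2 := by
      refine Finset.sum_congr rfl fun a _ => Finset.sum_congr rfl fun b _ => ?_
      have : (H * Yc - Yc * H) = Complex.I • (X * Y - Y * X).map Complex.ofRealHom := by
        rw [hHdef, Matrix.smul_mul, Matrix.mul_smul, ← smul_sub, hXc, hYc, ← Matrix.map_mul,
          ← Matrix.map_mul, Matrix.map_sub _ (fun a b => map_sub _ a b)]
      rw [this, Matrix.smul_apply, Matrix.map_apply, smul_eq_mul, norm_mul, Complex.norm_I,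
        one_mul, Complex.ofRealHom_eq_coe, Complex.norm_real, Real.norm_eq_abs, sq_abs]
    rw [h1, ← sum_norm_sq_conj U _ hU1]
    have h2 : U.conjTranspose * (H * Yc - Yc * H) * U = D * M - M * D := by
      rw [Matrix.mul_sub, Matrix.sub_mul, hM]
      congr 1
      · rw [← Matrix.mul_assoc, hspec']; simp only [Matrix.mul_assoc]
      · simp only [Matrix.mul_assoc]; rw [hspec2]
    rw [h2]
    refine Finset.sum_congr rfl fun a _ => Finset.sum_congr rfl fun b _ => ?_
    rw [Matrix.sub_apply, hD, Matrix.diagonal_mul, Matrix.mul_diagonal]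
    have : (lam a : ℂ) * M a b - M a b * lam b = ((lam a - lam b : ℝ) : ℂ) * M a b := by
      push_cast; ring
    rw [this, norm_mul, mul_pow, Complex.norm_real, Real.norm_eq_abs, sq_abs]
  rw [hnormC, hnormX, hnormY, Finset.mul_sum]
  refine Finset.sum_le_sum fun j _ => ?_
  rw [Finset.mul_sum]
  refine Finset.sum_le_sum fun k _ => ?_
  by_cases h : M j k = 0
  · simp [h]
  · exact mul_le_mul_of_nonneg_right (key j k h) (sq_nonneg _)

/-- The sharper bound in dimension three. -/
theorem sum_commutator_sq_le_three (X Y : Matrix (Fin 3) (Fin 3) ℝ) (hX : X.transpose = -X)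
    (hY : Y.transpose = -Y) :
    ∑ a, ∑ b, (X * Y - Y * X) a b ^ 2
      ≤ 1 / 2 * ((∑ a, ∑ b, X a b ^ 2) * ∑ a, ∑ b, Y a b ^ 2) := by
  have hx : ∀ i j, X j i = -X i j := fun i j => congrFun (congrFun hX i) j
  have hy : ∀ i j, Y j i = -Y i j := fun i j => congrFun (congrFun hY i) j
  have hx0 : ∀ i, X i i = 0 := fun i => by linarith [hx i i]
  have hy0 : ∀ i, Y i i = 0 := fun i => by linarith [hy i i]
  simp only [Fin.sum_univ_three, Matrix.sub_apply, Matrix.mul_apply, hx0, hy0, hx 0 1, hx 0 2,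
    hx 1 2, hy 0 1, hy 0 2, hy 1 2]
  -- The bracket on so(3) is a cross product, and Lagrange's identity makes the defect twice the
  -- square of this scalar product. The factor 1/2 arises because each component is counted twice in
  -- a Frobenius norm.
  nlinarith [sq_nonneg (X 0 1 * Y 0 1 + X 0 2 * Y 0 2 + X 1 2 * Y 1 2)]

end Commutator

/-! ### Pointwise inequalities for self-dual forms -/

/-- Antisymmetric self-dual real two-forms. -/
structure IsSelfDual (Q X : Mat4) : Prop where
  antisymm : X.transpose = -X
  star : hodgeStar Q X = X

theorem IsSelfDual.frame {Q P X : Mat4} (h : IsSelfDual Q X) (hP : P.transpose * Q * P = 1)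
    (hd : 0 < P.det) : IsSelfDual 1 (P.transpose * X * P) := by
  constructor
  · simp only [Matrix.transpose_mul, Matrix.transpose_transpose, h.antisymm, Matrix.mul_neg,
      Matrix.neg_mul, Matrix.mul_assoc]
  · rw [hodgeStar_frame hP hd, h.star]; rfl

/-- The components of a self-dual form with respect to the basis `sdForm` of a frame. -/
def sdCoord (P X : Mat4) (a : Fin 3) : ℝ := (P.transpose * X * P) 0 a.succ

theorem IsSelfDual.frame_eq {Q P X : Mat4} (h : IsSelfDual Q X) (hP : P.transpose * Q * P = 1)
    (hd : 0 < P.det) : P.transpose * X * P = ∑ a, sdCoord P X a • sdForm a :=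
  eq_sum_sdForm _ (h.frame hP hd).antisymm (h.frame hP hd).star

theorem formDot_sum_sdForm (c d : Fin 3 → ℝ) :
    formDot 1 (∑ a, c a • sdForm a) (∑ a, d a • sdForm a) = 2 * ∑ a, c a * d a := by
  rw [formDot_one]
  simp [Fin.sum_univ_three, Fin.sum_univ_four, sdForm]
  ring

theorem IsSelfDual.formDot_eq {Q P X Y : Mat4} (hX : IsSelfDual Q X) (hY : IsSelfDual Q Y)
    (hP : P.transpose * Q * P = 1) (hd : 0 < P.det) :
    formDot Q X Y = 2 * ∑ a, sdCoord P X a * sdCoord P Y a := by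
  rw [formDot_frame hP hd, hX.frame_eq hP hd, hY.frame_eq hP hd, formDot_sum_sdForm]

/-- The basis forms multiply like imaginary quaternions: each squares to −1 and any two anticommute,
so the cross terms cancel. -/
theorem sum_sdForm_mul_transpose (c : Fin 3 → ℝ) :
    (∑ a, c a • sdForm a) * (∑ a, c a • sdForm a).transpose = (∑ a, c a * c a) • (1 : Mat4) := by
  ext i j
  fin_cases i <;> fin_cases j <;>
    simp [Fin.sum_univ_three, Fin.sum_univ_four, sdForm, Matrix.mul_apply] <;> ring

/-- For a self-dual form `X`, the endomorphism `X Xᵀ` is a multiple of the metric. -/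
theorem IsSelfDual.raise_mul {Q X : Mat4} (hQ : Q.PosDef) (hX : IsSelfDual Q X) :
    (Q⁻¹ * X * Q⁻¹) * Q * (Q⁻¹ * X * Q⁻¹).transpose = (formDot Q X X / 2) • Q⁻¹ := by
  obtain ⟨P, hP, hd⟩ := exists_frame Q hQ
  have hi := inv_eq_frame hP
  have h1 : (P.transpose * X * P) * (P.transpose * X * P).transpose
      = (formDot Q X X / 2) • (1 : Mat4) := by
    rw [hX.formDot_eq hX hP hd, hX.frame_eq hP hd, sum_sdForm_mul_transpose]
    congr 1; ring
  have h2 := congrArg (fun Z : Mat4 => P * Z * P.transpose) h1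
  simp only [Matrix.mul_smul, Matrix.smul_mul, Matrix.mul_one, ← hi] at h2
  rw [← h2, hi]
  simp only [Matrix.transpose_mul, Matrix.transpose_transpose]
  calc _ = P * (P.transpose * X * P * (P.transpose * Q * P) * (P.transpose *
        (X.transpose * (P)))) * P.transpose := by simp only [Matrix.mul_assoc]
    _ = _ := by rw [hP, Matrix.mul_one]

/-! ### The refined Kato inequality -/

/-- Since v lies in the kernel of the divergence symbol δ, pairing it with g ⊗ φ is the same as
pairing it with the projection w of g ⊗ φ to that kernel. One has δδ* = 3 and |δ(g ⊗ φ)| = |g||φ|,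
so |w|² = (1 − 1/3)|g|²|φ|². Cauchy-Schwarz for w and v then improves the ordinary Kato inequality
by 2/3. -/
theorem kato_core {ρ : Type*} [Fintype ρ] (φ : Fin 3 → ρ → ℝ) (v : Fin 4 → Fin 3 → ρ → ℝ)
    (hv : ∀ r j, ∑ c, ∑ a, sdForm a c j * v c a r = 0) :
    ∑ c, (∑ r, ∑ a, φ a r * v c a r) ^ 2
      ≤ 2 / 3 * (∑ r, ∑ a, φ a r ^ 2) * ∑ r, ∑ c, ∑ a, v c a r ^ 2 := by
  set g : Fin 4 → ℝ := fun c => ∑ r, ∑ a, φ a r * v c a r with hg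
  -- This is the projection 1 − (1/3)δ*δ applied to g ⊗ φ.
  set w : Fin 4 → Fin 3 → ρ → ℝ := fun c a r => g c * φ a r
    - 1 / 3 * ∑ j, sdForm a c j * ∑ d, ∑ b, sdForm b d j * (g d * φ b r) with hw
  have h1 : ∑ r, ∑ c, ∑ a, w c a r * v c a r = ∑ c, g c ^ 2 := by
    have e : ∀ r, ∑ c, ∑ a, w c a r * v c a r = ∑ c, g c * ∑ a, φ a r * v c a r := by
      intro r
      have e1 : ∑ c, ∑ a, w c a r * v c a r = ∑ c, g c * ∑ a, φ a r * v c a r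
          - 1 / 3 * ∑ j, (∑ d, ∑ b, sdForm b d j * (g d * φ b r)) *
            ∑ c, ∑ a, sdForm a c j * v c a r := by
        simp only [hw]
        simp [Fin.sum_univ_three, Fin.sum_univ_four, sdForm]
        ring
      rw [e1]; simp [hv]
    simp only [e]
    rw [Finset.sum_comm]
    refine Finset.sum_congr rfl fun c _ => ?_
    rw [← Finset.mul_sum, sq]
  have h2 : ∑ r, ∑ c, ∑ a, w c a r ^ 2 = 2 / 3 * (∑ c, g c ^ 2) * ∑ r, ∑ a, φ a r ^ 2 := by
    rw [Finset.mul_sum]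
    refine Finset.sum_congr rfl fun r _ => ?_
    simp only [hw]
    simp [Fin.sum_univ_three, Fin.sum_univ_four, sdForm]
    ring
  have h3 := Finset.sum_mul_sq_le_sq_mul_sq Finset.univ
    (fun x : ρ × Fin 4 × Fin 3 => w x.2.1 x.2.2 x.1) (fun x => v x.2.1 x.2.2 x.1)
  simp only [Fintype.sum_prod_type] at h3
  rw [h1, h2] at h3
  have hgn : 0 ≤ ∑ c, g c ^ 2 := Finset.sum_nonneg fun _ _ => sq_nonneg _
  -- Cauchy-Schwarz gives the claim multiplied by |g|², which is cancelled unless it is 0.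
  rcases hgn.eq_or_lt with h0 | h0
  · rw [← h0]
    have : 0 ≤ ∑ r, ∑ a, φ a r ^ 2 :=
      Finset.sum_nonneg fun _ _ => Finset.sum_nonneg fun _ _ => sq_nonneg _
    have : 0 ≤ ∑ r, ∑ c, ∑ a, v c a r ^ 2 :=
      Finset.sum_nonneg fun _ _ => Finset.sum_nonneg fun _ _ => Finset.sum_nonneg fun _ _ =>
        sq_nonneg _
    positivity
  · refine le_of_mul_le_mul_left ?_ h0
    calc _ = (∑ c, g c ^ 2) ^ 2 := by ring
      _ ≤ _ := h3
      _ = _ := by ring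

/-- The refined Kato inequality: `T` and all `S k` are self-dual, and `S` is divergence free. -/
theorem refined_kato {n : ℕ} {α : ℝ} {Q : Mat4} (hQ : Q.PosDef)
    (T : Fin 4 → Fin 4 → Mat n) (S : Fin 4 → Fin 4 → Fin 4 → Mat n)
    (hT : ∀ r s, IsSelfDual Q (entryForm T r s))
    (hS : ∀ k r s, IsSelfDual Q (entryForm (S k) r s))
    (hdiv : ∀ j, ∑ k, ∑ i, Q⁻¹ k i • S k i j = 0) :
    ∑ m, ∑ k, Q⁻¹ m k * (formInner α Q (S m) T * formInner α Q (S k) T)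
      ≤ 2 / 3 * formInner α Q T T * ∑ m, ∑ k, Q⁻¹ m k * formInner α Q (S m) (S k) := by
  obtain ⟨P, hP, hd⟩ := exists_frame Q hQ
  have hi := inv_eq_frame hP
  have hQi : ∀ m k, Q⁻¹ m k = ∑ c, P m c * P k c := fun m k => by
    rw [hi, Matrix.mul_apply]; rfl
  set φ : Fin 3 → Fin n × Fin n → ℝ := fun a r => sdCoord P (entryForm T r.1 r.2) a with hφ
  set u : Fin 4 → Fin 3 → Fin n × Fin n → ℝ :=
    fun k a r => sdCoord P (entryForm (S k) r.1 r.2) a with hu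
  -- The derivative index is referred to the orthonormal frame as well.
  set v : Fin 4 → Fin 3 → Fin n × Fin n → ℝ := fun c a r => ∑ k, P k c * u k a r with hv
  have hTT : formInner α Q T T = 2 * α * ∑ r, ∑ a, φ a r ^ 2 := by
    rw [formInner_eq_sum, ← Fintype.sum_prod_type', mul_comm 2 α, mul_assoc, Finset.mul_sum _ _ (2 : ℝ)]
    congr 1
    refine Finset.sum_congr rfl fun r _ => ?_
    rw [(hT r.1 r.2).formDot_eq (hT r.1 r.2) hP hd]
    simp only [sq]; rfl
  have hST : ∀ k, formInner α Q (S k) T = 2 * α * ∑ r, ∑ a, φ a r * u k a r := by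
    intro k
    rw [formInner_eq_sum, ← Fintype.sum_prod_type', mul_comm 2 α, mul_assoc, Finset.mul_sum _ _ (2 : ℝ)]
    congr 1
    refine Finset.sum_congr rfl fun r _ => ?_
    rw [(hS k r.1 r.2).formDot_eq (hT r.1 r.2) hP hd]
    congr 1
    exact Finset.sum_congr rfl fun a _ => mul_comm _ _
  have hSS : ∀ m k, formInner α Q (S m) (S k) = 2 * α * ∑ r, ∑ a, u m a r * u k a r := by
    intro m k
    rw [formInner_eq_sum, ← Fintype.sum_prod_type', mul_comm 2 α, mul_assoc, Finset.mul_sum _ _ (2 : ℝ)]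
    congr 1
    refine Finset.sum_congr rfl fun r _ => ?_
    rw [(hS m r.1 r.2).formDot_eq (hS k r.1 r.2) hP hd]
  have hbil : ∀ x y : Fin 4 → ℝ, ∑ m, ∑ k, Q⁻¹ m k * (x m * y k)
      = ∑ c, (∑ m, P m c * x m) * ∑ k, P k c * y k := by
    intro x y
    simp only [hQi, Finset.sum_mul, Finset.mul_sum]
    rw [Finset.sum_congr rfl fun m _ => Finset.sum_comm, Finset.sum_comm]
    refine Finset.sum_congr rfl fun _ _ => ?_
    rw [Finset.sum_comm]
    refine Finset.sum_congr rfl fun _ _ => Finset.sum_congr rfl fun _ _ => ?_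
    ring
  have hgv : ∀ c, ∑ m, P m c * formInner α Q (S m) T = 2 * α * ∑ r, ∑ a, φ a r * v c a r := by
    intro c
    simp only [hST, hv, Finset.mul_sum]
    rw [Finset.sum_comm]
    refine Finset.sum_congr rfl fun r _ => ?_
    rw [Finset.sum_comm]
    refine Finset.sum_congr rfl fun _ _ => Finset.sum_congr rfl fun _ _ => ?_
    ring
  have hvv : ∑ m, ∑ k, Q⁻¹ m k * formInner α Q (S m) (S k)
      = 2 * α * ∑ r, ∑ c, ∑ a, v c a r ^ 2 := by
    have e : ∀ r, ∑ c, ∑ a, v c a r ^ 2 = ∑ a, ∑ m, ∑ k, Q⁻¹ m k * (u m a r * u k a r) := by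
      intro r
      rw [Finset.sum_comm]
      refine Finset.sum_congr rfl fun a _ => ?_
      rw [hbil (fun m => u m a r) fun m => u m a r]
      simp only [hv, sq]
    simp only [e, hSS, Finset.mul_sum]
    have e2 : ∀ f : Fin 4 → Fin 4 → (Fin n × Fin n) → Fin 3 → ℝ,
        ∑ m, ∑ k, ∑ r, ∑ a, f m k r a = ∑ r, ∑ a, ∑ m, ∑ k, f m k r a := by
      intro f
      rw [← Fintype.sum_prod_type' (fun m k => ∑ r, ∑ a, f m k r a),
        Finset.sum_comm]
      refine Finset.sum_congr rfl fun r _ => ?_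
      rw [Finset.sum_comm]
      simp only [Fintype.sum_prod_type]
    rw [e2]
    refine Finset.sum_congr rfl fun _ _ => Finset.sum_congr rfl fun _ _ =>
      Finset.sum_congr rfl fun _ _ => Finset.sum_congr rfl fun _ _ => ?_
    ring
  -- The vanishing divergence, expressed in the frame and in the basis `sdForm`, is the kernel
  -- condition of `kato_core`.
  have hdirac : ∀ r j, ∑ c, ∑ a, sdForm a c j * v c a r = 0 := by
    intro r j
    have h1 : ∀ k, P.transpose * entryForm (S k) r.1 r.2 * P = ∑ a, u k a r • sdForm a :=
      fun k => (hS k r.1 r.2).frame_eq hP hd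
    have h2 : ∑ c, ∑ a, sdForm a c j * v c a r
        = ∑ c, ∑ k, P k c * (P.transpose * entryForm (S k) r.1 r.2 * P) c j := by
      refine Finset.sum_congr rfl fun c _ => ?_
      simp only [h1, Matrix.sum_apply, Matrix.smul_apply, smul_eq_mul, hv, Finset.mul_sum]
      rw [Finset.sum_comm]
      refine Finset.sum_congr rfl fun _ _ => Finset.sum_congr rfl fun _ _ => ?_
      ring
    rw [h2]
    have h3 : ∀ l, ∑ k, ∑ i, Q⁻¹ k i * S k i l r.1 r.2 = 0 := by
      intro l
      have := congrFun (congrFun (hdiv l) r.1) r.2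
      simpa [Matrix.sum_apply] using this
    calc _ = ∑ l, P l j * ∑ k, ∑ i, Q⁻¹ k i * S k i l r.1 r.2 := by
          simp only [Matrix.mul_apply, Matrix.transpose_apply, entryForm, Matrix.of_apply, hQi,
            Finset.mul_sum, Finset.sum_mul]
          rw [sum_four fun c k l i => P k c * (P i c * S k i l r.1 r.2 * P l j),
            sum_four fun l k i c => P l j * (P k c * P i c * S k i l r.1 r.2)]
          refine Fintype.sum_equiv ⟨fun ⟨c, k, l, i⟩ => ⟨l, k, i, c⟩,
            fun ⟨l, k, i, c⟩ => ⟨c, k, l, i⟩, fun _ => rfl, fun _ => rfl⟩ _ _ fun _ => ?_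
          simp only [Equiv.coe_fn_mk]
          ring
      _ = 0 := by simp [h3]
  have hk := kato_core φ v hdirac
  rw [hbil, hTT, hvv]
  simp only [hgv]
  calc _ = (2 * α) ^ 2 * ∑ c, (∑ r, ∑ a, φ a r * v c a r) ^ 2 := by
        rw [Finset.mul_sum]; exact Finset.sum_congr rfl fun _ _ => by ring
    _ ≤ (2 * α) ^ 2 * (2 / 3 * (∑ r, ∑ a, φ a r ^ 2) * ∑ r, ∑ c, ∑ a, v c a r ^ 2) :=
        mul_le_mul_of_nonneg_left hk (sq_nonneg _)
    _ = _ := by ring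

/-! ### The Weyl operator on self-dual forms -/

/-- The components of a two-form with both indices raised. -/
def raise (Q X : Mat4) : Mat4 := Q⁻¹ * X * (Q⁻¹).transpose

theorem raise_apply (Q X : Mat4) (i j : Fin 4) :
    raise Q X i j = ∑ k, ∑ l, Q⁻¹ i k * Q⁻¹ j l * X k l := by
  rw [raise, Matrix.mul_apply, Finset.sum_congr rfl fun b _ => by
    rw [Matrix.mul_apply, Finset.sum_mul], Finset.sum_comm]
  refine Finset.sum_congr rfl fun _ _ => Finset.sum_congr rfl fun _ _ => ?_
  rw [Matrix.transpose_apply]; ring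

theorem formDot_eq_raise (Q X Y : Mat4) :
    formDot Q X Y = 1 / 2 * ∑ i, ∑ j, X i j * raise Q Y i j := by
  simp only [formDot, raise_apply, Finset.mul_sum]
  refine Finset.sum_congr rfl fun _ _ => Finset.sum_congr rfl fun _ _ =>
    Finset.sum_congr rfl fun _ _ => Finset.sum_congr rfl fun _ _ => ?_
  ring

theorem formDot_comm {Q : Mat4} (hQ : Q.PosDef) (X Y : Mat4) : formDot Q X Y = formDot Q Y X := by
  obtain ⟨P, hP, hd⟩ := exists_frame Q hQ
  rw [formDot_frame hP hd, formDot_frame hP hd Y, formDot_one, formDot_one]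
  simp only [mul_comm]

theorem formDot_add_left (Q X Y Z : Mat4) : formDot Q (X + Y) Z = formDot Q X Z + formDot Q Y Z := by
  simp only [formDot_eq_raise, Matrix.add_apply, add_mul, Finset.sum_add_distrib, mul_add]

theorem formDot_smul_left (Q X Z : Mat4) (c : ℝ) : formDot Q (c • X) Z = c * formDot Q X Z := by
  simp only [formDot_eq_raise, Matrix.smul_apply, smul_eq_mul, Finset.mul_sum]
  refine Finset.sum_congr rfl fun _ _ => Finset.sum_congr rfl fun _ _ => ?_
  ring

theorem formDot_sum_left {κ : Type*} (s : Finset κ) (Q : Mat4) (X : κ → Mat4) (Z : Mat4) :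
    formDot Q (∑ a ∈ s, X a) Z = ∑ a ∈ s, formDot Q (X a) Z := by
  classical
  induction s using Finset.induction_on with
  | empty => simp [formDot]
  | insert a s ha ih => rw [Finset.sum_insert ha, Finset.sum_insert ha, formDot_add_left, ih]

/-- The operator on two-forms defined by a 4-tensor. -/
def tensorOp (W : Fin 4 → Fin 4 → Fin 4 → Fin 4 → ℝ) (Q : Mat4) (η : Fin 4 → Fin 4 → ℝ) :
    Fin 4 → Fin 4 → ℝ := fun i j =>
  1 / 2 * ∑ k, ∑ l, ∑ p, ∑ q, W i j k l * Q⁻¹ k p * Q⁻¹ l q * η p q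

theorem tensorOp_eq (W : Fin 4 → Fin 4 → Fin 4 → Fin 4 → ℝ) (Q X : Mat4) (i j : Fin 4) :
    tensorOp W Q X i j = 1 / 2 * ∑ k, ∑ l, W i j k l * raise Q X k l := by
  simp only [tensorOp, raise_apply, Finset.mul_sum]
  refine Finset.sum_congr rfl fun _ _ => Finset.sum_congr rfl fun _ _ =>
    Finset.sum_congr rfl fun _ _ => Finset.sum_congr rfl fun _ _ => ?_
  ring

theorem formDot_tensorOp (W : Fin 4 → Fin 4 → Fin 4 → Fin 4 → ℝ) (Q X Y : Mat4) :
    formDot Q (Matrix.of (tensorOp W Q X)) Y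
      = 1 / 4 * ∑ i, ∑ j, ∑ k, ∑ l, W i j k l * (raise Q Y i j * raise Q X k l) := by
  simp only [formDot_eq_raise, Matrix.of_apply, tensorOp_eq, Finset.mul_sum, Finset.sum_mul]
  refine Finset.sum_congr rfl fun _ _ => Finset.sum_congr rfl fun _ _ =>
    Finset.sum_congr rfl fun _ _ => Finset.sum_congr rfl fun _ _ => ?_
  ring

theorem formDot_tensorOp_comm (W : Fin 4 → Fin 4 → Fin 4 → Fin 4 → ℝ)
    (hW : ∀ i j k l, W i j k l = W k l i j) (Q X Y : Mat4) :
    formDot Q (Matrix.of (tensorOp W Q X)) Y = formDot Q (Matrix.of (tensorOp W Q Y)) X := by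
  rw [formDot_tensorOp, formDot_tensorOp]
  congr 1
  rw [sum_four fun i j k l => W i j k l * (raise Q Y i j * raise Q X k l),
    sum_four fun i j k l => W i j k l * (raise Q X i j * raise Q Y k l)]
  refine Fintype.sum_equiv ⟨fun ⟨i, j, k, l⟩ => ⟨k, l, i, j⟩,
    fun ⟨i, j, k, l⟩ => ⟨k, l, i, j⟩, fun _ => rfl, fun _ => rfl⟩ _ _ fun x => ?_
  simp only [Equiv.coe_fn_mk]
  rw [hW]; ring

theorem tensorOp_sum_smul (W : Fin 4 → Fin 4 → Fin 4 → Fin 4 → ℝ) (Q : Mat4) (c : Fin 3 → ℝ)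
    (θ : Fin 3 → Mat4) : Matrix.of (tensorOp W Q (∑ a, c a • θ a : Mat4))
      = ∑ a, c a • Matrix.of (tensorOp W Q (θ a)) := by
  have hr : ∀ k l, raise Q (∑ a, c a • θ a) k l = ∑ a, c a * raise Q (θ a) k l := by
    intro k l
    simp only [raise, Matrix.mul_sum, Matrix.sum_mul, Matrix.mul_smul, Matrix.smul_mul,
      Matrix.sum_apply, Matrix.smul_apply, smul_eq_mul]
  ext i j
  simp only [Matrix.of_apply, tensorOp_eq, hr, Matrix.sum_apply, Matrix.smul_apply, smul_eq_mul,
    Finset.mul_sum]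
  rw [Finset.sum_congr rfl fun _ _ => Finset.sum_comm, Finset.sum_comm]
  refine Finset.sum_congr rfl fun _ _ => Finset.sum_congr rfl fun _ _ =>
    Finset.sum_congr rfl fun _ _ => ?_
  ring

theorem tensorOp_antisymm (W : Fin 4 → Fin 4 → Fin 4 → Fin 4 → ℝ)
    (hW : ∀ i j k l, W i j k l = - W j i k l) (Q X : Mat4) :
    (Matrix.of (tensorOp W Q X)).transpose = -Matrix.of (tensorOp W Q X) := by
  ext i j
  simp only [Matrix.transpose_apply, Matrix.neg_apply, Matrix.of_apply, tensorOp_eq]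
  rw [← mul_neg, ← Finset.sum_neg_distrib]
  congr 1
  refine Finset.sum_congr rfl fun _ _ => ?_
  rw [← Finset.sum_neg_distrib]
  refine Finset.sum_congr rfl fun _ _ => ?_
  rw [hW]; ring

/-- The largest eigenvalue bounds the quadratic form of a symmetric `3 × 3` matrix. -/
theorem exists_max_eigenvalue (w : Matrix (Fin 3) (Fin 3) ℝ) (hw : w.transpose = w) :
    ∃ lam : ℝ, (∃ c : Fin 3 → ℝ, c ≠ 0 ∧ w.mulVec c = lam • c) ∧
      ∀ c : Fin 3 → ℝ, ∑ a, ∑ b, c a * w a b * c b ≤ lam * ∑ a, c a * c a := by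
  have hH : w.IsHermitian := by
    rw [Matrix.IsHermitian, Matrix.conjTranspose_eq_transpose_of_trivial, hw]
  obtain ⟨i, -, hi⟩ := Finset.exists_max_image Finset.univ hH.eigenvalues ⟨0, Finset.mem_univ _⟩
  refine ⟨hH.eigenvalues i, ⟨hH.eigenvectorBasis i, ?_, hH.mulVec_eigenvectorBasis i⟩, ?_⟩
  · intro h
    have := hH.eigenvectorBasis.orthonormal.ne_zero i
    exact this (by ext j; exact congrFun h j)
  · intro c
    -- In an eigenbasis this difference is diagonal with entries λ_i − λ_j, nonnegative by the
    -- choice of i.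
    have hps : (hH.eigenvalues i • (1 : Matrix (Fin 3) (Fin 3) ℝ) - w).PosSemidef := by
      have hsp := hH.spectral_theorem
      rw [Unitary.conjStarAlgAut_apply] at hsp
      set U := (hH.eigenvectorUnitary : Matrix (Fin 3) (Fin 3) ℝ)
      have hUU : U * star U = 1 := Unitary.mul_star_self_of_mem hH.eigenvectorUnitary.2
      have : hH.eigenvalues i • (1 : Matrix (Fin 3) (Fin 3) ℝ) - w
          = U * Matrix.diagonal (fun j => hH.eigenvalues i - hH.eigenvalues j) * star U := by
        have hdiag : Matrix.diagonal (fun j => hH.eigenvalues i - hH.eigenvalues j)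
            = hH.eigenvalues i • (1 : Matrix (Fin 3) (Fin 3) ℝ)
              - Matrix.diagonal (RCLike.ofReal ∘ hH.eigenvalues) := by
          ext a b
          by_cases hab : a = b
          · subst hab; simp
          · simp [hab]
        rw [hdiag, Matrix.mul_sub, Matrix.sub_mul, Matrix.mul_smul, Matrix.smul_mul,
          Matrix.mul_one, hUU, ← hsp]
      rw [this]
      refine Matrix.PosSemidef.mul_mul_conjTranspose_same (Matrix.PosSemidef.diagonal ?_) U
      intro j
      simpa using hi j (Finset.mem_univ _)
    have h2 := (Matrix.posSemidef_iff_dotProduct_mulVec.mp hps).2 c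
    simp [Matrix.sub_mulVec, Matrix.smul_mulVec, dotProduct, Matrix.mulVec, Finset.mul_sum,
      mul_sub, Fin.sum_univ_three] at h2
    simp [Fin.sum_univ_three]
    linarith

/-- The set of eigenvalues of the operator `W⁺` defined by a 4-tensor `W`. -/
def sdEigenvalues (W : Fin 4 → Fin 4 → Fin 4 → Fin 4 → ℝ) (Q : Mat4) : Set ℝ :=
  {lam | ∃ η : Fin 4 → Fin 4 → ℝ, η ≠ 0 ∧ (∀ i j, η i j = -η j i) ∧
    hodgeStar Q η = η ∧ selfDualPart Q (tensorOp W Q η) = lam • η}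

/-- A frame yields a basis θ of the self-dual forms in which W⁺ is a symmetric 3 × 3 matrix `w`. Its
eigenvalues are the elements of `sdEigenvalues`, so the supremum bounds the Rayleigh quotient. -/
theorem formDot_tensorOp_le (W : Fin 4 → Fin 4 → Fin 4 → Fin 4 → ℝ)
    (hW : ∀ i j k l, W i j k l = W k l i j) (hW' : ∀ i j k l, W i j k l = - W j i k l)
    {Q : Mat4} (hQ : Q.PosDef) {X : Mat4} (hX : IsSelfDual Q X) :
    formDot Q (Matrix.of (tensorOp W Q X)) X ≤ sSup (sdEigenvalues W Q) * formDot Q X X := by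
  obtain ⟨P, hP, hd⟩ := exists_frame Q hQ
  have hu : IsUnit P.det := isUnit_iff_ne_zero.mpr hd.ne'
  have hPB : P * P⁻¹ = 1 := Matrix.mul_nonsing_inv P hu
  have hBP : P⁻¹ * P = 1 := Matrix.nonsing_inv_mul P hu
  have hBPt : P.transpose * (P⁻¹).transpose = 1 := by
    rw [← Matrix.transpose_mul, hBP, Matrix.transpose_one]
  have hPBt : (P⁻¹).transpose * P.transpose = 1 := by
    rw [← Matrix.transpose_mul, hPB, Matrix.transpose_one]
  set θ : Fin 3 → Mat4 := fun a => (P⁻¹).transpose * sdForm a * P⁻¹ with hθ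
  have hback : ∀ Y : Mat4, (P⁻¹).transpose * (P.transpose * Y * P) * P⁻¹ = Y := by
    intro Y
    calc _ = ((P⁻¹).transpose * P.transpose) * Y * (P * P⁻¹) := by simp only [Matrix.mul_assoc]
      _ = Y := by rw [hPBt, hPB]; simp
  have hfwd : ∀ Y : Mat4, P.transpose * ((P⁻¹).transpose * Y * P⁻¹) * P = Y := by
    intro Y
    calc _ = (P.transpose * (P⁻¹).transpose) * Y * (P⁻¹ * P) := by simp only [Matrix.mul_assoc]
      _ = Y := by rw [hBPt, hBP]; simp
  have hinj : ∀ Y Z : Mat4, P.transpose * Y * P = P.transpose * Z * P → Y = Z := by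
    intro Y Z h
    rw [← hback Y, h, hback]
  have hθf : ∀ a, P.transpose * θ a * P = sdForm a := fun a => hfwd _
  have hθsd : ∀ a, IsSelfDual Q (θ a) := by
    intro a
    constructor
    · apply hinj
      have : P.transpose * (θ a).transpose * P = (P.transpose * θ a * P).transpose := by
        simp only [Matrix.transpose_mul, Matrix.transpose_transpose, Matrix.mul_assoc]
      rw [this, Matrix.mul_neg, Matrix.neg_mul, hθf, sdForm_transpose]
    · have : Matrix.of (hodgeStar Q (θ a)) = θ a := by
        apply hinj
        rw [← hodgeStar_frame hP hd, hθf]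
        exact hodgeStar_sdForm a
      exact this
  have hdec : ∀ Y : Mat4, IsSelfDual Q Y → Y = ∑ a, sdCoord P Y a • θ a := by
    intro Y hY
    apply hinj
    rw [hY.frame_eq hP hd, Matrix.mul_sum, Matrix.sum_mul]
    refine Finset.sum_congr rfl fun a _ => ?_
    rw [Matrix.mul_smul, Matrix.smul_mul, hθf]
  have hθθ : ∀ a b, formDot Q (θ a) (θ b) = if a = b then 2 else 0 := by
    intro a b
    rw [formDot_frame hP hd, hθf, hθf, formDot_sdForm]
  -- Taking the self-dual part is orthogonal projection onto the span of θ; the factor 1/2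
  -- compensates |θ_a|² = 2.
  have hproj : ∀ Y : Mat4, Y.transpose = -Y →
      Matrix.of (selfDualPart Q Y) = ∑ a, (1 / 2 * formDot Q Y (θ a)) • θ a := by
    intro Y hY
    have hY' : (P.transpose * Y * P).transpose = -(P.transpose * Y * P) := by
      simp only [Matrix.transpose_mul, Matrix.transpose_transpose, hY, Matrix.mul_neg,
        Matrix.neg_mul, Matrix.mul_assoc]
    apply hinj
    rw [← selfDualPart_conj Q P Y hd, hP, Matrix.mul_sum, Matrix.sum_mul]
    simp only [Matrix.mul_smul, Matrix.smul_mul, hθf, formDot_frame hP hd, formDot_one]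
    set Z := P.transpose * Y * P
    have h : ∀ i j, Z j i = -Z i j := fun i j => congrFun (congrFun hY' i) j
    have h0 : ∀ i, Z i i = 0 := fun i => by linarith [h i i]
    ext i j
    simp only [Matrix.of_apply, selfDualPart]
    rw [hodgeStar_one_eq Z hY']
    fin_cases i <;> fin_cases j <;>
      simp [Fin.sum_univ_three, Fin.sum_univ_four, sdForm, h0, h 0 1, h 0 2, h 0 3, h 1 2, h 1 3,
        h 2 3] <;> ring
  set w : Matrix (Fin 3) (Fin 3) ℝ := Matrix.of fun a b =>
    1 / 2 * formDot Q (Matrix.of (tensorOp W Q (θ b))) (θ a) with hw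
  have hwt : w.transpose = w := by
    ext a b
    simp only [hw, Matrix.transpose_apply, Matrix.of_apply]
    rw [formDot_tensorOp_comm W hW]
  set cmb : (Fin 3 → ℝ) → Mat4 := fun c => ∑ a, c a • θ a with hcmb
  have hcmbop : ∀ c, Matrix.of (tensorOp W Q (cmb c))
      = ∑ a, c a • Matrix.of (tensorOp W Q (θ a)) := fun c => tensorOp_sum_smul W Q c θ
  have hop : ∀ c : Fin 3 → ℝ, Matrix.of (selfDualPart Q (tensorOp W Q (cmb c)))
      = cmb (w.mulVec c) := by
    intro c
    have := hproj (Matrix.of (tensorOp W Q (cmb c))) (tensorOp_antisymm W hW' Q _)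
    refine this.trans (Finset.sum_congr rfl fun a _ => ?_)
    congr 1
    rw [hcmbop, formDot_sum_left, Finset.mul_sum, Matrix.mulVec, dotProduct]
    refine Finset.sum_congr rfl fun b _ => ?_
    rw [formDot_smul_left, hw, Matrix.of_apply]; ring
  have hcoef : ∀ c d : Fin 3 → ℝ, cmb c = cmb d → c = d := by
    intro c d h
    ext b
    have := congrArg (fun Y => formDot Q Y (θ b)) h
    simp only [hcmb, formDot_sum_left, formDot_smul_left, hθθ] at this
    simpa using this
  obtain ⟨lam, ⟨c₀, hc₀, hc₀e⟩, hmax⟩ := exists_max_eigenvalue w hwt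
  have hmem : lam ∈ sdEigenvalues W Q := by
    have hsd : IsSelfDual Q (cmb c₀) := by
      constructor
      · rw [hcmb, Matrix.transpose_sum, ← Finset.sum_neg_distrib]
        refine Finset.sum_congr rfl fun a _ => ?_
        rw [Matrix.transpose_smul, (hθsd a).antisymm, smul_neg]
      · have : Matrix.of (hodgeStar Q (cmb c₀)) = cmb c₀ := by
          apply hinj
          have hc' : P.transpose * cmb c₀ * P = ∑ a, c₀ a • sdForm a := by
            simp only [hcmb, Matrix.mul_sum, Matrix.sum_mul, Matrix.mul_smul, Matrix.smul_mul, hθf]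
          rw [← hodgeStar_frame hP hd, hc']
          have ht : (∑ a, c₀ a • sdForm a).transpose = -∑ a, c₀ a • sdForm a := by
            rw [Matrix.transpose_sum, ← Finset.sum_neg_distrib]
            refine Finset.sum_congr rfl fun a _ => ?_
            rw [Matrix.transpose_smul, sdForm_transpose, smul_neg]
          rw [hodgeStar_one_eq _ ht]
          ext i j
          fin_cases i <;> fin_cases j <;> simp [Fin.sum_univ_three, sdForm]
        exact this
    refine ⟨cmb c₀, ?_, ?_, hsd.star, ?_⟩
    · intro h
      apply hc₀
      apply hcoef c₀ 0
      have h' : cmb c₀ = 0 := h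
      rw [h']; simp [hcmb]
    · intro i j
      exact congrFun (congrFun hsd.antisymm j) i
    · have := hop c₀
      rw [hc₀e] at this
      refine this.trans ?_
      simp only [hcmb, Pi.smul_apply, smul_eq_mul, mul_smul, ← Finset.smul_sum]
      rfl
  -- Needed for `le_csSup`: the real supremum of an unbounded set would be 0. Every eigenvalue is a
  -- Rayleigh quotient of `w`, hence at most `lam`.
  have hbdd : BddAbove (sdEigenvalues W Q) := by
    refine ⟨lam, ?_⟩
    rintro μ ⟨η, hη0, hηa, hηs, hηe⟩
    have hη : IsSelfDual Q (Matrix.of η) := ⟨by ext i j; exact hηa j i, hηs⟩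
    set c : Fin 3 → ℝ := fun a => sdCoord P (Matrix.of η) a with hc
    have hηc : Matrix.of η = cmb c := hdec _ hη
    have h1 := hop c
    rw [← hηc] at h1
    have h2 : w.mulVec c = μ • c := by
      apply hcoef
      rw [← h1]
      have h3 : Matrix.of (selfDualPart Q (tensorOp W Q η)) = μ • Matrix.of η := hηe
      refine h3.trans ?_
      rw [hηc, hcmb, Finset.smul_sum]
      exact Finset.sum_congr rfl fun a _ => by rw [smul_smul]; rfl
    have h4 := hmax c
    have h5 : ∑ a, ∑ b, c a * w a b * c b = μ * ∑ a, c a * c a := by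
      rw [Finset.mul_sum]
      refine Finset.sum_congr rfl fun a _ => ?_
      have := congrFun h2 a
      simp only [Matrix.mulVec, dotProduct, Pi.smul_apply, smul_eq_mul] at this
      calc _ = c a * ∑ b, w a b * c b := by
            rw [Finset.mul_sum]; exact Finset.sum_congr rfl fun _ _ => by ring
        _ = _ := by rw [this]; ring
    have h6 : 0 < ∑ a, c a * c a := by
      have hcne : c ≠ 0 := by
        intro h
        apply hη0
        have : Matrix.of η = 0 := by rw [hηc, h]; simp [hcmb]
        exact this
      obtain ⟨a, ha⟩ := Function.ne_iff.mp hcne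
      exact Finset.sum_pos' (fun _ _ => mul_self_nonneg _) ⟨a, Finset.mem_univ _,
        mul_self_pos.mpr ha⟩
    rw [h5] at h4
    exact le_of_mul_le_mul_right h4 h6
  have hXc := hdec X hX
  set c : Fin 3 → ℝ := fun a => sdCoord P X a with hc
  have hnn : 0 ≤ ∑ a, c a * c a := Finset.sum_nonneg fun _ _ => mul_self_nonneg _
  have e1 : formDot Q X X = 2 * ∑ a, c a * c a := hX.formDot_eq hX hP hd
  have e2 : formDot Q (Matrix.of (tensorOp W Q X)) X = 2 * ∑ a, ∑ b, c a * w a b * c b := by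
    have h7 : X = cmb c := hXc
    have h8 : ∀ Y, formDot Q Y X = ∑ a, c a * formDot Q Y (θ a) := by
      intro Y
      rw [formDot_comm hQ, h7, hcmb, formDot_sum_left]
      refine Finset.sum_congr rfl fun a _ => ?_
      rw [formDot_smul_left, formDot_comm hQ]
    rw [h8, Finset.mul_sum]
    refine Finset.sum_congr rfl fun a _ => ?_
    conv_lhs => rw [h7]
    rw [hcmbop, formDot_sum_left, Finset.mul_sum, Finset.mul_sum]
    refine Finset.sum_congr rfl fun b _ => ?_
    rw [formDot_smul_left, hw, Matrix.of_apply]; ring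
  rw [e1, e2]
  have := mul_le_mul_of_nonneg_right (le_csSup hbdd hmem) hnn
  linarith [hmax c]

/-! ### The curvature term of the Weitzenböck formula -/

section CurvatureTerm

variable (R : Fin 4 → Fin 4 → Fin 4 → Fin 4 → ℝ) (Q : Mat4)

/-- The Ricci contraction of a 4-tensor. -/
def ricciOf (j l : Fin 4) : ℝ := ∑ i, ∑ k, Q⁻¹ i k * R i j k l

/-- The scalar contraction of a 4-tensor. -/
def scalarOf : ℝ := ∑ j, ∑ l, Q⁻¹ j l * ricciOf R Q j l

/-- The Weyl part of a 4-tensor. -/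
def weylOf (i j k l : Fin 4) : ℝ :=
  R i j k l
    - 1 / 2 * (ricciOf R Q i k * Q j l - ricciOf R Q i l * Q j k
      + Q i k * ricciOf R Q j l - Q i l * ricciOf R Q j k)
    + 1 / 6 * scalarOf R Q * (Q i k * Q j l - Q i l * Q j k)

/-- The algebraic symmetries of a curvature tensor. -/
structure IsCurvatureTensor : Prop where
  antisymm : ∀ i j k l, R i j k l = -R j i k l
  antisymm' : ∀ i j k l, R i j k l = -R i j l k
  pair : ∀ i j k l, R i j k l = R k l i j
  bianchi : ∀ i j k l, R i j k l + R i k l j + R i l j k = 0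

variable {R Q}

theorem inv_symm (hQ : Q.PosDef) (i j : Fin 4) : Q⁻¹ i j = Q⁻¹ j i := by
  have := hQ.inv.isHermitian.apply i j
  simpa using this.symm

theorem posDef_symm (hQ : Q.PosDef) (i j : Fin 4) : Q i j = Q j i := by
  have := hQ.isHermitian.apply i j
  simpa using this.symm

theorem inv_transpose (hQ : Q.PosDef) : (Q⁻¹).transpose = Q⁻¹ := by
  ext i j; exact inv_symm hQ j i

theorem raise_antisymm {X : Mat4} (hX : X.transpose = -X) :
    (raise Q X).transpose = -raise Q X := by
  simp only [raise, Matrix.transpose_mul, Matrix.transpose_transpose, hX, Matrix.neg_mul,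
    Matrix.mul_neg, Matrix.mul_assoc]

theorem ricciOf_symm (hQ : Q.PosDef) (hR : IsCurvatureTensor R) (j l : Fin 4) :
    ricciOf R Q j l = ricciOf R Q l j := by
  simp only [ricciOf]
  rw [Finset.sum_comm]
  refine Finset.sum_congr rfl fun k _ => Finset.sum_congr rfl fun i _ => ?_
  rw [inv_symm hQ, hR.pair]

theorem weylOf_antisymm (i j k l : Fin 4) (hR : IsCurvatureTensor R) :
    weylOf R Q i j k l = -weylOf R Q j i k l := by
  simp only [weylOf]; rw [hR.antisymm]; ring

theorem weylOf_pair (hQ : Q.PosDef) (hR : IsCurvatureTensor R) (i j k l : Fin 4) :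
    weylOf R Q i j k l = weylOf R Q k l i j := by
  simp only [weylOf]
  rw [hR.pair, ricciOf_symm hQ hR i k, ricciOf_symm hQ hR i l, ricciOf_symm hQ hR j l,
    ricciOf_symm hQ hR j k, posDef_symm hQ i k, posDef_symm hQ i l, posDef_symm hQ j l,
    posDef_symm hQ j k]
  ring

/-- Contracting two copies of X over one index leaves a multiple of Q⁻¹, so only the trace of B is
seen. For this reason the trace-free Ricci tensor drops out of the Weitzenböck formula. -/
theorem IsSelfDual.sum_raise_raise (hQ : Q.PosDef) {X : Mat4} (hX : IsSelfDual Q X)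
    (B : Fin 4 → Fin 4 → ℝ) :
    ∑ i, ∑ j, ∑ k, ∑ l, B i k * Q j l * (raise Q X i j * raise Q X k l)
      = formDot Q X X / 2 * ∑ i, ∑ k, Q⁻¹ i k * B i k := by
  have h := hX.raise_mul hQ
  have hr : raise Q X = Q⁻¹ * X * Q⁻¹ := by rw [raise, inv_transpose hQ]
  rw [← hr] at h
  have h2 : ∀ i k, formDot Q X X / 2 * Q⁻¹ i k = ∑ l, ∑ j, raise Q X i j * Q j l * raise Q X k l := by
    intro i k
    have := congrFun (congrFun h i) k
    rw [Matrix.smul_apply, smul_eq_mul] at this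
    rw [← this, Matrix.mul_apply]
    refine Finset.sum_congr rfl fun l _ => ?_
    rw [Matrix.mul_apply, Finset.sum_mul]; rfl
  simp only [Finset.mul_sum, ← mul_assoc, h2, Finset.sum_mul]
  rw [sum_four fun i j k l => B i k * Q j l * raise Q X i j * raise Q X k l,
    sum_four fun i k l j => raise Q X i j * Q j l * raise Q X k l * B i k]
  refine Fintype.sum_equiv ⟨fun ⟨i, j, k, l⟩ => ⟨i, k, l, j⟩,
    fun ⟨i, k, l, j⟩ => ⟨i, j, k, l⟩, fun _ => rfl, fun _ => rfl⟩ _ _ fun x => ?_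
  simp only [Equiv.coe_fn_mk]
  ring

/-- Every correction term of the Weyl tensor is a product with the metric, hence collapses to a
multiple of R|X|² by `IsSelfDual.sum_raise_raise`. The four Ricci terms give −1, the scalar terms
2/3. -/
theorem IsSelfDual.formDot_weylOf (hQ : Q.PosDef) {X : Mat4}
    (hX : IsSelfDual Q X) :
    4 * formDot Q (Matrix.of (tensorOp (weylOf R Q) Q X)) X
      = ∑ i, ∑ j, ∑ k, ∑ l, R i j k l * (raise Q X i j * raise Q X k l)
        - scalarOf R Q / 3 * formDot Q X X := by
  set t := raise Q X with ht
  have hta : ∀ i j, t i j = - t j i := fun i j => by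
    have := congrFun (congrFun (raise_antisymm (Q := Q) hX.antisymm) j) i
    simpa using this
  have main : ∀ B : Fin 4 → Fin 4 → ℝ, ∑ i, ∑ j, ∑ k, ∑ l, B i k * Q j l * (t i j * t k l)
      = formDot Q X X / 2 * ∑ i, ∑ k, Q⁻¹ i k * B i k := hX.sum_raise_raise hQ
  have v2 : ∀ B : Fin 4 → Fin 4 → ℝ, ∑ i, ∑ j, ∑ k, ∑ l, B i l * Q j k * (t i j * t k l)
      = -(formDot Q X X / 2 * ∑ i, ∑ k, Q⁻¹ i k * B i k) := by
    intro B
    rw [← main, ← Finset.sum_neg_distrib]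
    refine Finset.sum_congr rfl fun i _ => ?_
    rw [← Finset.sum_neg_distrib]
    refine Finset.sum_congr rfl fun j _ => ?_
    rw [Finset.sum_comm, ← Finset.sum_neg_distrib]
    refine Finset.sum_congr rfl fun k _ => ?_
    rw [← Finset.sum_neg_distrib]
    refine Finset.sum_congr rfl fun l _ => ?_
    rw [hta l k]; ring
  have v3 : ∀ B : Fin 4 → Fin 4 → ℝ, ∑ i, ∑ j, ∑ k, ∑ l, Q i l * B j k * (t i j * t k l)
      = -(formDot Q X X / 2 * ∑ i, ∑ k, Q⁻¹ i k * B i k) := by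
    intro B
    rw [← main, ← Finset.sum_neg_distrib, Finset.sum_comm]
    refine Finset.sum_congr rfl fun i _ => ?_
    rw [← Finset.sum_neg_distrib]
    refine Finset.sum_congr rfl fun j _ => ?_
    rw [← Finset.sum_neg_distrib]
    refine Finset.sum_congr rfl fun k _ => ?_
    rw [← Finset.sum_neg_distrib]
    refine Finset.sum_congr rfl fun l _ => ?_
    rw [hta j i]; ring
  have v4 : ∀ B : Fin 4 → Fin 4 → ℝ, ∑ i, ∑ j, ∑ k, ∑ l, Q i k * B j l * (t i j * t k l)
      = formDot Q X X / 2 * ∑ i, ∑ k, Q⁻¹ i k * B i k := by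
    intro B
    rw [← neg_neg (formDot Q X X / 2 * ∑ i, ∑ k, Q⁻¹ i k * B i k), ← v3, ← Finset.sum_neg_distrib]
    refine Finset.sum_congr rfl fun i _ => ?_
    rw [← Finset.sum_neg_distrib]
    refine Finset.sum_congr rfl fun j _ => ?_
    rw [Finset.sum_comm, ← Finset.sum_neg_distrib]
    refine Finset.sum_congr rfl fun k _ => ?_
    rw [← Finset.sum_neg_distrib]
    refine Finset.sum_congr rfl fun l _ => ?_
    rw [hta l k]; ring
  have hQQ : ∑ i, ∑ k, Q⁻¹ i k * Q i k = 4 := by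
    have h1 : Q⁻¹ * Q = 1 := Matrix.nonsing_inv_mul Q (isUnit_iff_ne_zero.mpr hQ.det_pos.ne')
    have h2 : ∀ i, ∑ k, Q⁻¹ i k * Q i k = 1 := by
      intro i
      have := congrFun (congrFun h1 i) i
      rw [Matrix.mul_apply, Matrix.one_apply_eq] at this
      rw [← this]
      exact Finset.sum_congr rfl fun k _ => by rw [posDef_symm hQ]
    simp [h2]
  have hsc : ∑ i, ∑ k, Q⁻¹ i k * ricciOf R Q i k = scalarOf R Q := rfl
  rw [formDot_tensorOp, ← ht]
  have e : ∀ i j k l, weylOf R Q i j k l * (t i j * t k l) = R i j k l * (t i j * t k l)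
      - 1 / 2 * (ricciOf R Q i k * Q j l * (t i j * t k l))
      + 1 / 2 * (ricciOf R Q i l * Q j k * (t i j * t k l))
      - 1 / 2 * (Q i k * ricciOf R Q j l * (t i j * t k l))
      + 1 / 2 * (Q i l * ricciOf R Q j k * (t i j * t k l))
      + 1 / 6 * scalarOf R Q * (Q i k * Q j l * (t i j * t k l))
      - 1 / 6 * scalarOf R Q * (Q i l * Q j k * (t i j * t k l)) := by
    intro i j k l; simp only [weylOf]; ring
  simp only [e, Finset.sum_add_distrib, Finset.sum_sub_distrib, ← Finset.mul_sum]
  have m1 : ∑ i, ∑ j, ∑ k, ∑ l, Q i k * Q j l * (t i j * t k l) = _ := main fun i k => Q i k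
  have m2 : ∑ i, ∑ j, ∑ k, ∑ l, Q i l * Q j k * (t i j * t k l) = _ := v2 fun i k => Q i k
  rw [main (ricciOf R Q), v2 (ricciOf R Q), v3 (ricciOf R Q), v4 (ricciOf R Q), m1, m2, hQQ, hsc]
  ring

/-- The contribution of the Riemann tensor to the Weitzenböck formula for self-dual forms. -/
theorem IsSelfDual.riemann_term (hQ : Q.PosDef) (hR : IsCurvatureTensor R)
    (Rup : Fin 4 → Fin 4 → Fin 4 → Fin 4 → ℝ)
    (hRup : ∀ i j k l, R i j k l = ∑ m, Q i m * Rup m j k l) {X : Mat4} (hX : IsSelfDual Q X) :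
    2 * formDot Q (Matrix.of fun i j => ∑ m, ∑ k, Q⁻¹ m k *
        ∑ p, (Rup p j m i * X p k + Rup p k m i * X j p)) X
      = scalarOf R Q / 3 * formDot Q X X
        - 2 * formDot Q (Matrix.of (tensorOp (weylOf R Q) Q X)) X := by
  set t := raise Q X with ht
  have hta : ∀ i j, t i j = - t j i := fun i j => by
    have := congrFun (congrFun (raise_antisymm (Q := Q) hX.antisymm) j) i
    simpa using this
  have hQi : Q⁻¹ * Q = 1 := Matrix.nonsing_inv_mul Q (isUnit_iff_ne_zero.mpr hQ.det_pos.ne')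
  have hQi' : Q * Q⁻¹ = 1 := Matrix.mul_nonsing_inv Q (isUnit_iff_ne_zero.mpr hQ.det_pos.ne')
  have hup : ∀ p j k l, Rup p j k l = ∑ q, Q⁻¹ p q * R q j k l := by
    intro p j k l
    simp only [hRup, Finset.mul_sum, ← mul_assoc]
    rw [Finset.sum_comm]
    simp only [← Finset.sum_mul, ← Matrix.mul_apply, hQi, Matrix.one_apply]
    simp
  have hA : ∀ i j, ∑ m, ∑ k, Q⁻¹ m k * ∑ p, Rup p j m i * X p k
      = ∑ q, ∑ m, R q j m i * t q m := by
    intro i j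
    simp only [hup, ht, raise_apply, Finset.mul_sum, Finset.sum_mul]
    rw [sum_four fun m k p q => Q⁻¹ m k * (Q⁻¹ p q * R q j m i * X p k),
      sum_four fun q m p k => R q j m i * (Q⁻¹ q p * Q⁻¹ m k * X p k)]
    refine Fintype.sum_equiv ⟨fun ⟨m, k, p, q⟩ => ⟨q, m, p, k⟩,
      fun ⟨q, m, p, k⟩ => ⟨m, k, p, q⟩, fun _ => rfl, fun _ => rfl⟩ _ _ fun x => ?_
    simp only [Equiv.coe_fn_mk]
    rw [inv_symm hQ x.2.2.1]; ring
  -- The derivative index meets the second slot of the curvature here, so this half is a Ricci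
  -- contraction; the sign comes from exchanging the first two slots.
  have hB : ∀ i j, ∑ m, ∑ k, Q⁻¹ m k * ∑ p, Rup p k m i * X j p
      = -∑ q, (X * Q⁻¹) j q * ricciOf R Q q i := by
    intro i j
    simp only [hup, ricciOf, Matrix.mul_apply, Finset.mul_sum, Finset.sum_mul,
      ← Finset.sum_neg_distrib]
    rw [sum_four fun m k p q => Q⁻¹ m k * (Q⁻¹ p q * R q k m i * X j p),
      sum_four fun q k m p => -(X j p * Q⁻¹ p q * (Q⁻¹ k m * R k q m i))]
    refine Fintype.sum_equiv ⟨fun ⟨m, k, p, q⟩ => ⟨q, k, m, p⟩,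
      fun ⟨q, k, m, p⟩ => ⟨m, k, p, q⟩, fun _ => rfl, fun _ => rfl⟩ _ _ fun x => ?_
    simp only [Equiv.coe_fn_mk]
    rw [inv_symm hQ x.1, hR.antisymm]; ring
  have hXt : X * Q⁻¹ = Q * t := by
    rw [ht, raise, inv_transpose hQ, Matrix.mul_assoc Q⁻¹, ← Matrix.mul_assoc, hQi',
      Matrix.one_mul]
  have hBsum : ∑ i, ∑ j, (-∑ q, (X * Q⁻¹) j q * ricciOf R Q q i) * t i j
      = formDot Q X X / 2 * scalarOf R Q := by
    have h1 := hX.sum_raise_raise hQ (ricciOf R Q)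
    rw [← ht] at h1
    change _ = formDot Q X X / 2 * ∑ i, ∑ k, Q⁻¹ i k * ricciOf R Q i k
    rw [← h1, hXt]
    simp only [Matrix.mul_apply, Finset.sum_mul, ← Finset.sum_neg_distrib]
    refine Finset.sum_congr rfl fun i _ => Finset.sum_congr rfl fun j _ =>
      Finset.sum_congr rfl fun k _ => Finset.sum_congr rfl fun l _ => ?_
    rw [hta l k, ricciOf_symm hQ hR k i]; ring
  -- The first Bianchi identity: two of its three terms contribute `x` each and the third
  -- contributes `z`, so 2x + z = 0.
  have hAsum : ∑ i, ∑ j, (∑ q, ∑ m, R q j m i * t q m) * t i j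
      = -(1 / 2) * ∑ i, ∑ j, ∑ k, ∑ l, R i j k l * (t i j * t k l) := by
    set x := ∑ i, ∑ j, (∑ q, ∑ m, R q j m i * t q m) * t i j with hx
    set z := ∑ i, ∑ j, ∑ k, ∑ l, R i j k l * (t i j * t k l) with hz
    have e1 : x = ∑ a : Fin 4 × Fin 4 × Fin 4 × Fin 4,
        R a.1 a.2.1 a.2.2.1 a.2.2.2 * (t a.1 a.2.2.1 * t a.2.2.2 a.2.1) := by
      rw [hx]
      simp only [Finset.sum_mul]
      rw [sum_four fun i j q m => R q j m i * t q m * t i j]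
      refine Fintype.sum_equiv ⟨fun ⟨i, j, q, m⟩ => ⟨q, j, m, i⟩,
        fun ⟨q, j, m, i⟩ => ⟨i, j, q, m⟩, fun _ => rfl, fun _ => rfl⟩ _ _ fun x => ?_
      simp only [Equiv.coe_fn_mk]
      ring
    have e2 : x = ∑ a : Fin 4 × Fin 4 × Fin 4 × Fin 4,
        R a.1 a.2.2.2 a.2.1 a.2.2.1 * (t a.1 a.2.2.1 * t a.2.2.2 a.2.1) := by
      rw [e1]
      refine Fintype.sum_equiv ⟨fun ⟨q, j, m, i⟩ => ⟨q, i, m, j⟩,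
        fun ⟨q, j, m, i⟩ => ⟨q, i, m, j⟩, fun _ => rfl, fun _ => rfl⟩ _ _ fun x => ?_
      simp only [Equiv.coe_fn_mk]
      rw [hR.antisymm', hta x.2.2.2]; ring
    have e3 : z = ∑ a : Fin 4 × Fin 4 × Fin 4 × Fin 4,
        R a.1 a.2.2.1 a.2.2.2 a.2.1 * (t a.1 a.2.2.1 * t a.2.2.2 a.2.1) := by
      rw [hz, sum_four fun i j k l => R i j k l * (t i j * t k l)]
      refine Fintype.sum_equiv ⟨fun ⟨i, j, k, l⟩ => ⟨i, l, j, k⟩,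
        fun ⟨i, l, j, k⟩ => ⟨i, j, k, l⟩, fun _ => rfl, fun _ => rfl⟩ _ _ fun x => ?_
      simp only [Equiv.coe_fn_mk]
    have e4 : x + x + z = 0 := by
      nth_rewrite 1 [e1]
      rw [e2, e3, ← Finset.sum_add_distrib, ← Finset.sum_add_distrib]
      refine Finset.sum_eq_zero fun a _ => ?_
      have := hR.bianchi a.1 a.2.1 a.2.2.1 a.2.2.2
      linear_combination (t a.1 a.2.2.1 * t a.2.2.2 a.2.1) * this
    linarith
  have h4 := hX.formDot_weylOf (R := R) hQ
  rw [← ht] at h4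
  rw [formDot_eq_raise, ← ht]
  have e : ∀ i j, (Matrix.of fun i j => ∑ m, ∑ k, Q⁻¹ m k *
        ∑ p, (Rup p j m i * X p k + Rup p k m i * X j p) : Mat4) i j * t i j
      = (∑ q, ∑ m, R q j m i * t q m) * t i j
        + (-∑ q, (X * Q⁻¹) j q * ricciOf R Q q i) * t i j := by
    intro i j
    rw [← hA, ← hB, ← add_mul, Matrix.of_apply]
    simp only [Finset.sum_add_distrib, mul_add]
  rw [Finset.sum_congr rfl fun i _ => Finset.sum_congr rfl fun j _ => e i j]
  simp only [Finset.sum_add_distrib]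
  rw [hAsum, hBsum]
  linarith

end CurvatureTerm

/-! ### The gauge term of the Weitzenböck formula -/

section GaugeTerm

variable {n : ℕ}

/-- The components of a matrix-valued two-form in a frame. -/
def framePull (P : Mat4) (η : Fin 4 → Fin 4 → Mat n) (a b : Fin 4) : Mat n :=
  Matrix.of fun r s => (P.transpose * entryForm η r s * P) a b

theorem formInner_frame {α : ℝ} {Q P : Mat4} (hP : P.transpose * Q * P = 1) (hd : 0 < P.det)
    (η ζ : Fin 4 → Fin 4 → Mat n) :
    formInner α Q η ζ = 1 / 2 * ∑ a, ∑ b, matInner α (framePull P η a b) (framePull P ζ a b) := by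
  rw [formInner_eq_sum]
  simp only [formDot_frame hP hd, formDot_one, matInner, framePull, Matrix.of_apply,
    Finset.mul_sum]
  have h : ∀ f : Fin 4 → Fin 4 → Fin n → Fin n → ℝ,
      ∑ r, ∑ s, ∑ a, ∑ b, f a b r s = ∑ a, ∑ b, ∑ r, ∑ s, f a b r s := by
    intro f
    have h1 : ∑ r, ∑ s, ∑ a, ∑ b, f a b r s
        = ∑ x : Fin n × Fin n, ∑ y : Fin 4 × Fin 4, f y.1 y.2 x.1 x.2 := by
      simp only [Fintype.sum_prod_type]
    rw [h1, Finset.sum_comm]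
    simp only [Fintype.sum_prod_type]
  rw [h]
  refine Finset.sum_congr rfl fun _ _ => Finset.sum_congr rfl fun _ _ =>
    Finset.sum_congr rfl fun _ _ => Finset.sum_congr rfl fun _ _ => ?_
  ring

/-- The trilinear form `⟨[X, Y], Z⟩`. -/
def triForm (α : ℝ) (X Y Z : Mat n) : ℝ := matInner α (X * Y - Y * X) Z

theorem matInner_eq_trace (α : ℝ) (X Y : Mat n) : matInner α X Y = α * (X * Y.transpose).trace := by
  simp [matInner, Matrix.trace, Matrix.mul_apply]

/-- For skew arguments the trace formula shows that ⟨[X, Y], Z⟩ is totally antisymmetric;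
`triForm_swap` and `triForm_cycle` are read off from it. -/
theorem triForm_eq_trace (α : ℝ) (X Y Z : Mat n) (hZ : Z.transpose = -Z) :
    triForm α X Y Z = -α * ((X * Y * Z).trace - (X * Z * Y).trace) := by
  rw [triForm, matInner_eq_trace, hZ, Matrix.mul_neg, Matrix.trace_neg, Matrix.sub_mul,
    Matrix.trace_sub, Matrix.mul_assoc Y X Z, Matrix.trace_mul_comm Y]
  ring

theorem triForm_swap (α : ℝ) (X Y Z : Mat n) (hY : Y.transpose = -Y) (hZ : Z.transpose = -Z) :
    triForm α X Y Z = -triForm α X Z Y := by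
  rw [triForm_eq_trace α X Y Z hZ, triForm_eq_trace α X Z Y hY]; ring

theorem triForm_cycle (α : ℝ) (X Y Z : Mat n) (hX : X.transpose = -X) (hZ : Z.transpose = -Z) :
    triForm α X Y Z = triForm α Y Z X := by
  rw [triForm_eq_trace α X Y Z hZ, triForm_eq_trace α Y Z X hX, Matrix.mul_assoc X Y Z,
    Matrix.trace_mul_comm X, Matrix.mul_assoc Y X Z, Matrix.mul_assoc X Z Y,
    Matrix.trace_mul_comm X, Matrix.mul_assoc Z Y X, Matrix.trace_mul_comm Z,
    Matrix.mul_assoc Y X Z]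

theorem triForm_neg_left (α : ℝ) (X Y Z : Mat n) : triForm α (-X) Y Z = -triForm α X Y Z := by
  simp only [triForm, matInner_eq_trace, Matrix.neg_mul, Matrix.mul_neg, ← neg_sub',
    Matrix.trace_neg, mul_neg]

theorem triForm_neg_mid (α : ℝ) (X Y Z : Mat n) : triForm α X (-Y) Z = -triForm α X Y Z := by
  simp only [triForm, matInner_eq_trace, Matrix.neg_mul, Matrix.mul_neg, ← neg_sub',
    Matrix.trace_neg, mul_neg]

theorem triForm_neg_right (α : ℝ) (X Y Z : Mat n) : triForm α X Y (-Z) = -triForm α X Y Z := by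
  simp only [triForm, matInner_eq_trace, Matrix.transpose_neg, Matrix.mul_neg,
    Matrix.trace_neg, mul_neg]

theorem triForm_add_left (α : ℝ) (X X' Y Z : Mat n) :
    triForm α (X + X') Y Z = triForm α X Y Z + triForm α X' Y Z := by
  simp only [triForm, matInner_eq_trace, Matrix.add_mul, Matrix.mul_add, Matrix.sub_mul,
    Matrix.trace_add, Matrix.trace_sub]
  ring

theorem triForm_smul_left (α c : ℝ) (X Y Z : Mat n) :
    triForm α (c • X) Y Z = c * triForm α X Y Z := by
  simp only [triForm, matInner_eq_trace, Matrix.smul_mul, Matrix.mul_smul, ← smul_sub,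
    Matrix.trace_smul, smul_eq_mul]
  ring

theorem triForm_zero_left (α : ℝ) (Y Z : Mat n) : triForm α 0 Y Z = 0 := by
  simp [triForm, matInner_eq_trace]

theorem triForm_zero_mid (α : ℝ) (X Z : Mat n) : triForm α X 0 Z = 0 := by
  simp [triForm, matInner_eq_trace]

theorem triForm_zero_right (α : ℝ) (X Y : Mat n) : triForm α X Y 0 = 0 := by
  simp [triForm, matInner_eq_trace]

theorem eq_zero_of_eq_neg_self {X : Mat n} (h : X = -X) : X = 0 := by
  ext r s
  have := congrFun (congrFun h r) s
  rw [Matrix.neg_apply] at this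
  rw [Matrix.zero_apply]; linarith

/-- The two factors T are contracted into a self-dual form, so only the self-dual combinations of F
survive. The pair F₀₁, F₂₃ enters as −4(F₀₁ + F₂₃) = −8T₀₁, similarly for the other two pairs, and
the three contributions agree by cyclicity. -/
theorem sum_triForm_eq (α : ℝ) (F T : Fin 4 → Fin 4 → Mat n) (hF : ∀ a b, F b a = -F a b)
    (hT : ∀ a b, T b a = -T a b) (hTs : ∀ a b, (T a b).transpose = -T a b)
    (h1 : T 2 3 = T 0 1) (h2 : T 1 3 = -T 0 2) (h3 : T 1 2 = T 0 3)
    (f1 : F 0 1 + F 2 3 = (2 : ℝ) • T 0 1) (f2 : F 0 2 - F 1 3 = (2 : ℝ) • T 0 2)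
    (f3 : F 0 3 + F 1 2 = (2 : ℝ) • T 0 3) :
    ∑ a, ∑ b, ∑ m, triForm α (F m a) (T b m) (T a b)
      = -(24 * triForm α (T 0 1) (T 0 2) (T 0 3)) := by
  have hF0 : ∀ a, F a a = 0 := fun a => eq_zero_of_eq_neg_self (hF a a)
  have hT0 : ∀ a, T a a = 0 := fun a => eq_zero_of_eq_neg_self (hT a a)
  have e1 := congrArg (fun X => triForm α X (T 0 2) (T 0 3)) f1
  have e2 := congrArg (fun X => triForm α X (T 0 3) (T 0 1)) f2
  have e3 := congrArg (fun X => triForm α X (T 0 1) (T 0 2)) f3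
  simp only [triForm_add_left, triForm_smul_left, sub_eq_add_neg, triForm_neg_left] at e1 e2 e3
  have c1 := triForm_cycle α (T 0 1) (T 0 2) (T 0 3) (hTs _ _) (hTs _ _)
  have c2 := triForm_cycle α (T 0 2) (T 0 3) (T 0 1) (hTs _ _) (hTs _ _)
  simp only [Fin.sum_univ_four, hF0, hT0, hF 0 1, hF 0 2, hF 0 3, hF 1 2, hF 1 3, hF 2 3, hT 0 1,
    hT 0 2, hT 0 3, hT 1 2, hT 1 3, hT 2 3, h1, h2, h3, triForm_neg_left, triForm_neg_mid,
    triForm_neg_right, triForm_zero_left, triForm_zero_mid, triForm_zero_right,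
    triForm_swap α _ (T 0 3) (T 0 2) (hTs _ _) (hTs _ _),
    triForm_swap α _ (T 0 1) (T 0 3) (hTs _ _) (hTs _ _),
    triForm_swap α _ (T 0 2) (T 0 1) (hTs _ _) (hTs _ _), neg_neg, neg_zero]
  linarith

/-- The sum of squares of the entries of a matrix. -/
def frobSq (X : Mat n) : ℝ := ∑ a, ∑ b, X a b ^ 2

theorem frobSq_nonneg (X : Mat n) : 0 ≤ frobSq X :=
  Finset.sum_nonneg fun _ _ => Finset.sum_nonneg fun _ _ => sq_nonneg _

theorem matInner_self (α : ℝ) (X : Mat n) : matInner α X X = α * frobSq X := by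
  simp [matInner, frobSq, sq]

theorem matInner_sq_le (α : ℝ) (X Y : Mat n) :
    matInner α X Y ^ 2 ≤ α ^ 2 * (frobSq X * frobSq Y) := by
  have h := Finset.sum_mul_sq_le_sq_mul_sq Finset.univ
    (fun x : Fin n × Fin n => X x.1 x.2) (fun x => Y x.1 x.2)
  simp only [Fintype.sum_prod_type] at h
  rw [matInner, mul_pow]
  exact mul_le_mul_of_nonneg_left h (sq_nonneg _)

/-- The constant in the commutator estimate. -/
theorem frobSq_commutator_le (X Y : Mat n) (hX : X.transpose = -X) (hY : Y.transpose = -Y) :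
    frobSq (X * Y - Y * X) ≤ (if n = 3 then 1 / 2 else 1) * (frobSq X * frobSq Y) := by
  split_ifs with h
  · subst h; exact sum_commutator_sq_le_three X Y hX hY
  · rw [one_mul]; exact sum_commutator_sq_le X Y hX hY

theorem aG_nonneg (α : ℝ) : 0 ≤ aG n α := by
  rw [aG]; split_ifs <;> positivity

theorem aG_sq {α : ℝ} (hα : 0 < α) : aG n α ^ 2 = 8 / (3 * α) * (if n = 3 then 1 / 2 else 1) := by
  rw [aG]
  split_ifs
  · rw [div_pow, Real.sq_sqrt (by positivity)]; ring
  · rw [div_pow, Real.sq_sqrt (by positivity), mul_pow, Real.sq_sqrt (by norm_num)]; ring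

/-- The arithmetic-geometric mean inequality, applied below to the squared norms of the three
components. -/
theorem mul_mul_le_cube {x y z : ℝ} (hx : 0 ≤ x) (hy : 0 ≤ y) (hz : 0 ≤ z) :
    27 * (x * y * z) ≤ (x + y + z) ^ 3 := by
  nlinarith [mul_nonneg hx (sq_nonneg (y - z)), mul_nonneg hy (sq_nonneg (z - x)),
    mul_nonneg hz (sq_nonneg (x - y)), mul_nonneg (add_nonneg (add_nonneg hx hy) hz)
    (add_nonneg (add_nonneg (sq_nonneg (x - y)) (sq_nonneg (y - z))) (sq_nonneg (z - x)))]

/-- Cauchy-Schwarz, the commutator estimate and the arithmetic-geometric mean, compared after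
squaring. The constants agree because 24²/27 = 64/3 = (8/3)·2³, where 2³ comes from cubing the
squared norm 2(|X|² + |Y|² + |Z|²). -/
theorem triForm_bound {α : ℝ} (hα : 0 < α) (X Y Z : Mat n) (hX : X.transpose = -X)
    (hY : Y.transpose = -Y) :
    |24 * triForm α X Y Z|
      ≤ aG n α * √(2 * (matInner α X X + matInner α Y Y + matInner α Z Z)) ^ 3 := by
  have hN : 0 ≤ 2 * (matInner α X X + matInner α Y Y + matInner α Z Z) := by
    simp only [matInner_self]
    have := frobSq_nonneg X; have := frobSq_nonneg Y; have := frobSq_nonneg Z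
    positivity
  refine abs_le_of_sq_le_sq ?_ (mul_nonneg (aG_nonneg α) (pow_nonneg (Real.sqrt_nonneg _) 3))
  rw [mul_pow (aG n α), ← pow_mul, mul_comm 3 2, pow_mul, Real.sq_sqrt hN, aG_sq hα]
  set c : ℝ := if n = 3 then 1 / 2 else 1 with hc
  have hc0 : 0 ≤ c := by rw [hc]; split_ifs <;> norm_num
  have h1 := matInner_sq_le α (X * Y - Y * X) Z
  have h2 := frobSq_commutator_le X Y hX hY
  rw [← hc] at h2
  have h3 := mul_mul_le_cube (frobSq_nonneg X) (frobSq_nonneg Y) (frobSq_nonneg Z)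
  have h4 := mul_le_mul_of_nonneg_right h2 (frobSq_nonneg Z)
  simp only [matInner_self]
  calc (24 * triForm α X Y Z) ^ 2 = 576 * triForm α X Y Z ^ 2 := by ring
    _ ≤ 576 * (α ^ 2 * (c * (frobSq X * frobSq Y) * frobSq Z)) := by
        refine mul_le_mul_of_nonneg_left (h1.trans ?_) (by norm_num)
        exact mul_le_mul_of_nonneg_left h4 (sq_nonneg _)
    _ = 64 / 3 * α ^ 2 * c * (27 * (frobSq X * frobSq Y * frobSq Z)) := by ring
    _ ≤ 64 / 3 * α ^ 2 * c * (frobSq X + frobSq Y + frobSq Z) ^ 3 :=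
        mul_le_mul_of_nonneg_left h3 (by positivity)
    _ = _ := by field_simp; ring

/-- The gauge term: `∑ Q^{mk} [F_{mi}, T_{jk}]`. -/
def gaugeTerm (Q : Mat4) (F T : Fin 4 → Fin 4 → Mat n) (i j : Fin 4) : Mat n :=
  ∑ m, ∑ k, Q⁻¹ m k • (F m i * T j k - T j k * F m i)

theorem entryForm_gaugeTerm (Q : Mat4) (F T : Fin 4 → Fin 4 → Mat n) (r s : Fin n) :
    entryForm (gaugeTerm Q F T) r s
      = ∑ q, ((entryForm F r q).transpose * Q⁻¹ * (entryForm T q s).transpose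
        - (entryForm F q s).transpose * Q⁻¹ * (entryForm T r q).transpose) := by
  ext i j
  simp only [entryForm, gaugeTerm, Matrix.of_apply, Matrix.sum_apply, Matrix.smul_apply,
    Matrix.sub_apply, Matrix.mul_apply, Matrix.transpose_apply, smul_eq_mul, Finset.sum_mul,
    Finset.mul_sum, mul_sub, Finset.sum_sub_distrib]
  congr 1
  · rw [Finset.sum_comm, Finset.sum_congr rfl fun _ _ => Finset.sum_comm, Finset.sum_comm]
    refine Finset.sum_congr rfl fun _ _ => Finset.sum_congr rfl fun _ _ =>
      Finset.sum_congr rfl fun _ _ => ?_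
    ring
  · rw [Finset.sum_comm, Finset.sum_congr rfl fun _ _ => Finset.sum_comm, Finset.sum_comm]
    refine Finset.sum_congr rfl fun _ _ => Finset.sum_congr rfl fun _ _ =>
      Finset.sum_congr rfl fun _ _ => ?_
    ring

/-- As Q⁻¹ = P Pᵀ, the contraction with the metric becomes a plain sum over the frame index. -/
theorem framePull_gaugeTerm {Q P : Mat4} (hP : P.transpose * Q * P = 1)
    (F T : Fin 4 → Fin 4 → Mat n) (a b : Fin 4) :
    framePull P (gaugeTerm Q F T) a b = ∑ m, (framePull P F m a * framePull P T b m
      - framePull P T b m * framePull P F m a) := by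
  have hi := inv_eq_frame hP
  have hx : ∀ X Y : Mat4, P.transpose * (X.transpose * Q⁻¹ * Y.transpose) * P
      = (P.transpose * X * P).transpose * (P.transpose * Y * P).transpose := by
    intro X Y
    rw [hi]
    simp only [Matrix.transpose_mul, Matrix.transpose_transpose, Matrix.mul_assoc]
  ext r s
  rw [framePull, Matrix.of_apply, entryForm_gaugeTerm, Matrix.mul_sum, Matrix.sum_mul]
  simp only [Matrix.mul_sub, Matrix.sub_mul, hx, Matrix.sum_apply, Matrix.sub_apply,
    Matrix.mul_apply (M := (P.transpose * _ * P).transpose), Matrix.transpose_apply]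
  rw [Finset.sum_sub_distrib, Finset.sum_sub_distrib, Finset.sum_comm]
  congr 1
  rw [Finset.sum_comm]
  refine Finset.sum_congr rfl fun m _ => ?_
  rw [Matrix.mul_apply]
  refine Finset.sum_congr rfl fun q _ => ?_
  simp only [framePull, Matrix.of_apply]
  ring

/-- The gauge term of the Weitzenböck formula is bounded by the cube of the norm. -/
theorem abs_gaugeTerm_le {α : ℝ} (hα : 0 < α) {Q : Mat4} (hQ : Q.PosDef)
    (F : Fin 4 → Fin 4 → Mat n) (hF : ∀ i j, F j i = -F i j)
    (hFs : ∀ i j, (F i j).transpose = -F i j) :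
    |2 * formInner α Q (gaugeTerm Q F (selfDualPart Q F)) (selfDualPart Q F)|
      ≤ aG n α * formNorm α Q (selfDualPart Q F) ^ 3 := by
  obtain ⟨P, hP, hd⟩ := exists_frame Q hQ
  set T := selfDualPart Q F with hTdef
  set F' := framePull P F with hF'
  set T' := framePull P T with hT'
  have hFe : ∀ r s, (entryForm F r s).transpose = -entryForm F r s := by
    intro r s; ext i j
    exact congrFun (congrFun (hF i j) r) s
  have hF'a : ∀ a b, F' b a = -F' a b := by
    intro a b; ext r s
    have : (P.transpose * entryForm F r s * P).transpose = -(P.transpose * entryForm F r s * P) := by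
      simp only [Matrix.transpose_mul, Matrix.transpose_transpose, hFe, Matrix.mul_neg,
        Matrix.neg_mul, Matrix.mul_assoc]
    exact congrFun (congrFun this a) b
  have hTF : ∀ r s, P.transpose * entryForm T r s * P
      = Matrix.of (selfDualPart 1 (P.transpose * entryForm F r s * P)) := by
    intro r s
    rw [hTdef, entryForm_selfDualPart, ← selfDualPart_conj Q P _ hd, hP]
  have hT'e : ∀ a b r s, T' a b r s = 1 / 2 * (F' a b r s
      + hodgeStar 1 (P.transpose * entryForm F r s * P) a b) := by
    intro a b r s
    change (P.transpose * entryForm T r s * P) a b = _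
    rw [hTF]; rfl
  have hst : ∀ r s, hodgeStar 1 (P.transpose * entryForm F r s * P)
      = !![0, F' 2 3 r s, -F' 1 3 r s, F' 1 2 r s; -F' 2 3 r s, 0, F' 0 3 r s, -F' 0 2 r s;
      F' 1 3 r s, -F' 0 3 r s, 0, F' 0 1 r s; -F' 1 2 r s, F' 0 2 r s, -F' 0 1 r s, 0] := by
    intro r s
    rw [hodgeStar_one_eq]
    · rfl
    · simp only [Matrix.transpose_mul, Matrix.transpose_transpose, hFe, Matrix.mul_neg,
        Matrix.neg_mul, Matrix.mul_assoc]
  have hF'e : ∀ a b r s, F' b a r s = -F' a b r s := fun a b r s =>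
    congrFun (congrFun (hF'a a b) r) s
  have hF'0 : ∀ a r s, F' a a r s = 0 := fun a r s => by linarith [hF'e a a r s]
  have hT'a : ∀ a b, T' b a = -T' a b := by
    intro a b; ext r s
    rw [Matrix.neg_apply, hT'e, hT'e, hst, hF'e]
    fin_cases a <;> fin_cases b <;> simp <;> ring
  have hF's : ∀ a b, (F' a b).transpose = -F' a b := by
    intro a b; ext r s
    have : entryForm F s r = -entryForm F r s := by
      ext i j; exact congrFun (congrFun (hFs i j) r) s
    change (P.transpose * entryForm F s r * P) a b = -(P.transpose * entryForm F r s * P) a b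
    rw [this]; simp
  have hF'se : ∀ a b r s, F' a b s r = -F' a b r s := fun a b r s =>
    congrFun (congrFun (hF's a b) r) s
  have hT's : ∀ a b, (T' a b).transpose = -T' a b := by
    intro a b; ext r s
    rw [Matrix.transpose_apply, Matrix.neg_apply, hT'e, hT'e, hst, hst, hF'se a b]
    fin_cases a <;> fin_cases b <;>
      simp [hF'se 0 1 r s, hF'se 0 2 r s, hF'se 0 3 r s, hF'se 1 2 r s, hF'se 1 3 r s,
        hF'se 2 3 r s] <;> ring
  have h1 : T' 2 3 = T' 0 1 := by
    ext r s; rw [hT'e, hT'e, hst]; simp; ring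
  have h2 : T' 1 3 = -T' 0 2 := by
    ext r s; rw [Matrix.neg_apply, hT'e, hT'e, hst]; simp; ring
  have h3 : T' 1 2 = T' 0 3 := by
    ext r s; rw [hT'e, hT'e, hst]; simp; ring
  have f1 : F' 0 1 + F' 2 3 = (2 : ℝ) • T' 0 1 := by
    ext r s; rw [Matrix.smul_apply, hT'e, hst]; simp
  have f2 : F' 0 2 - F' 1 3 = (2 : ℝ) • T' 0 2 := by
    ext r s; rw [Matrix.smul_apply, hT'e, hst]; simp; ring
  have f3 : F' 0 3 + F' 1 2 = (2 : ℝ) • T' 0 3 := by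
    ext r s; rw [Matrix.smul_apply, hT'e, hst]; simp
  -- The factor 2 cancels the 1/2 in the inner product of two-forms.
  have hG : 2 * formInner α Q (gaugeTerm Q F T) T
      = ∑ a, ∑ b, ∑ m, triForm α (F' m a) (T' b m) (T' a b) := by
    rw [formInner_frame hP hd, ← mul_assoc]
    norm_num
    refine Finset.sum_congr rfl fun a _ => Finset.sum_congr rfl fun b _ => ?_
    rw [framePull_gaugeTerm hP, matInner_eq_trace, Matrix.sum_mul, Matrix.trace_sum,
      Finset.mul_sum]
    refine Finset.sum_congr rfl fun m _ => ?_
    rw [triForm, matInner_eq_trace]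
  have hN : formInner α Q T T = 2 * (matInner α (T' 0 1) (T' 0 1) + matInner α (T' 0 2) (T' 0 2)
      + matInner α (T' 0 3) (T' 0 3)) := by
    have hneg : ∀ X : Mat n, matInner α (-X) (-X) = matInner α X X := by
      intro X; simp [matInner]
    have hT0 : ∀ a, T' a a = 0 := fun a => eq_zero_of_eq_neg_self (hT'a a a)
    have hz : matInner α (0 : Mat n) 0 = 0 := by simp [matInner]
    rw [formInner_frame hP hd]
    simp only [← hT', Fin.sum_univ_four, hT0, hT'a 0 1, hT'a 0 2, hT'a 0 3, hT'a 1 2, hT'a 1 3,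
      hT'a 2 3, h1, h2, h3, hneg, hz]
    ring
  rw [hG, sum_triForm_eq α F' T' hF'a hT'a hT's h1 h2 h3 f1 f2 f3, abs_neg, formNorm_eq_sqrt, hN]
  exact triForm_bound hα _ _ _ (hT's _ _) (hT's _ _)

end GaugeTerm

/-! ### Tensor calculus over a ring with commuting derivations -/

section Calculus

variable {K : Type*} [CommRing K] [Algebra ℝ K] (d : Fin 4 → Derivation ℝ K K)
  (Q Qi : Matrix (Fin 4) (Fin 4) K)

/-- The Christoffel symbols `Γᵏ_{ij}`. -/
def chr (k i j : Fin 4) : K :=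
  algebraMap ℝ K (1 / 2) * ∑ l, Qi k l * (d i (Q j l) + d j (Q i l) - d l (Q i j))

/-- The Christoffel symbols as matrices: the matrix `chrMat i` has entries `Γᵏ_{ij}`. -/
def chrMat (i : Fin 4) : Matrix (Fin 4) (Fin 4) K := Matrix.of fun k j => chr d Q Qi k i j

/-- The curvature endomorphisms `R(∂_k, ∂_l)`. -/
def curvMat (k l : Fin 4) : Matrix (Fin 4) (Fin 4) K :=
  (chrMat d Q Qi l).map (d k) - (chrMat d Q Qi k).map (d l)
    + (chrMat d Q Qi k * chrMat d Q Qi l - chrMat d Q Qi l * chrMat d Q Qi k)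

theorem map_mul_derivation {m : Type*} [Fintype m] (δ : Derivation ℝ K K) (A B : Matrix m m K) :
    (A * B).map δ = A.map δ * B + A * B.map δ := by
  ext i j
  simp only [Matrix.map_apply, Matrix.mul_apply, Matrix.add_apply, map_sum, Derivation.leibniz,
    smul_eq_mul, Finset.sum_add_distrib]
  rw [add_comm]
  congr 1
  exact Finset.sum_congr rfl fun _ _ => mul_comm _ _

variable {d Q Qi}

theorem two_mul_half : (algebraMap ℝ K (1 / 2)) + algebraMap ℝ K (1 / 2) = 1 := by
  rw [← map_add]; norm_num

/-- K contains 1/2, so 2 can be cancelled although K may have zero divisors. -/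
theorem eq_zero_of_add_self {V : Type*} [AddCommGroup V] [Module K V] {x : V} (h : x + x = 0) :
    x = 0 := by
  have h1 : (algebraMap ℝ K (1 / 2)) • (x + x) = x := by
    rw [smul_add, ← add_smul, two_mul_half, one_smul]
  rw [← h1, h, smul_zero]

theorem chr_symm (hQ : ∀ i j, Q i j = Q j i) (k i j : Fin 4) :
    chr d Q Qi k i j = chr d Q Qi k j i := by
  simp only [chr]
  congr 1
  refine Finset.sum_congr rfl fun l _ => ?_
  rw [hQ i j]; ring

/-- Lowering the upper index removes the inverse metric and leaves Koszul's formula. -/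
theorem chr_lower (hQi : Q * Qi = 1) (m i j : Fin 4) :
    ∑ k, Q m k * chr d Q Qi k i j
      = algebraMap ℝ K (1 / 2) * (d i (Q j m) + d j (Q i m) - d m (Q i j)) := by
  have h1 : ∀ l, ∑ k, Q m k * Qi k l = if m = l then 1 else 0 := by
    intro l
    have := congrFun (congrFun hQi m) l
    rwa [Matrix.mul_apply, Matrix.one_apply] at this
  calc _ = algebraMap ℝ K (1 / 2) * ∑ l, (∑ k, Q m k * Qi k l) *
        (d i (Q j l) + d j (Q i l) - d l (Q i j)) := by
        simp only [chr, Finset.mul_sum, Finset.sum_mul]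
        rw [Finset.sum_comm]
        refine Finset.sum_congr rfl fun _ _ => Finset.sum_congr rfl fun _ _ => ?_
        ring
    _ = _ := by simp [h1]

/-- The metric is parallel. -/
theorem map_metric (hQ : ∀ i j, Q i j = Q j i) (hQi : Q * Qi = 1) (k : Fin 4) :
    Q.map (d k) = (chrMat d Q Qi k).transpose * Q + Q * chrMat d Q Qi k := by
  ext i j
  have h1 := chr_lower (d := d) hQi i k j
  have h2 := chr_lower (d := d) hQi j k i
  simp only [Matrix.map_apply, Matrix.add_apply, Matrix.mul_apply, Matrix.transpose_apply, chrMat,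
    Matrix.of_apply]
  rw [h1]
  have h3 : ∑ l, chr d Q Qi l k i * Q l j = ∑ l, Q j l * chr d Q Qi l k i :=
    Finset.sum_congr rfl fun l _ => by rw [hQ l j, mul_comm]
  rw [h3, h2, ← mul_add, hQ k j, hQ k i, hQ j i]
  linear_combination (-(d k (Q i j))) * (two_mul_half (K := K))

theorem map_inv_metric (hQ : ∀ i j, Q i j = Q j i) (hQi : Q * Qi = 1) (k : Fin 4) :
    Qi.map (d k) = -(chrMat d Q Qi k * Qi + Qi * (chrMat d Q Qi k).transpose) := by
  have hQi' : Qi * Q = 1 := mul_eq_one_comm.mp hQi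
  -- The derivative of Q⁻¹ is found by differentiating Q Q⁻¹ = 1.
  have h1 := congrArg (fun M : Matrix (Fin 4) (Fin 4) K => Qi * M.map (d k)) hQi
  simp only [map_mul_derivation] at h1
  have h0 : (1 : Matrix (Fin 4) (Fin 4) K).map (d k) = 0 := by
    ext i j
    by_cases h : i = j
    · subst h; simp
    · simp [Matrix.one_apply_ne h]
  rw [h0, Matrix.mul_zero, Matrix.mul_add, ← Matrix.mul_assoc Qi Q, hQi', Matrix.one_mul,
    map_metric hQ hQi] at h1
  rw [eq_neg_of_add_eq_zero_right h1]
  congr 1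
  rw [Matrix.add_mul, Matrix.mul_add, Matrix.mul_assoc _ Q Qi, hQi, Matrix.mul_one,
    Matrix.mul_assoc Q, ← Matrix.mul_assoc Qi Q, hQi', Matrix.one_mul, add_comm]

/-! #### Symmetries of the curvature tensor -/

theorem map_map_comm {m : Type*} (hd : ∀ i j f, d i (d j f) = d j (d i f)) (i j : Fin 4)
    (X : Matrix m m K) : (X.map (d i)).map (d j) = (X.map (d j)).map (d i) := by
  ext a b; exact hd j i _

theorem map_add_derivation {m : Type*} (δ : Derivation ℝ K K) (A B : Matrix m m K) :
    (A + B).map δ = A.map δ + B.map δ := by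
  ext i j; simp

theorem map_sub_derivation {m : Type*} (δ : Derivation ℝ K K) (A B : Matrix m m K) :
    (A - B).map δ = A.map δ - B.map δ := by
  ext i j; simp

/-- Differentiating ∂Q = ΓᵀQ + QΓ once more and using ∂_k∂_l Q = ∂_l∂_k Q leaves exactly the
statement that curvature is skew for Q. -/
theorem metric_mul_curvMat (hd : ∀ i j f, d i (d j f) = d j (d i f))
    (hQ : ∀ i j, Q i j = Q j i) (hQi : Q * Qi = 1) (k l : Fin 4) :
    (curvMat d Q Qi k l).transpose * Q = -(Q * curvMat d Q Qi k l) := by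
  have h := map_map_comm hd k l Q
  have hm := map_metric (d := d) hQ hQi
  have ht : ∀ i, ((chrMat d Q Qi i).transpose).map (d k) = ((chrMat d Q Qi i).map (d k)).transpose :=
    fun i => rfl
  have ht' : ∀ i, ((chrMat d Q Qi i).transpose).map (d l) = ((chrMat d Q Qi i).map (d l)).transpose :=
    fun i => rfl
  rw [hm k, hm l, map_add_derivation, map_add_derivation, map_mul_derivation, map_mul_derivation,
    map_mul_derivation, map_mul_derivation, hm k, hm l, ht, ht'] at h
  rw [← sub_eq_zero] at h
  rw [eq_neg_iff_add_eq_zero, ← neg_eq_zero, ← h, curvMat]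
  simp only [Matrix.transpose_add, Matrix.transpose_sub, Matrix.transpose_mul]
  noncomm_ring

/-- Absence of torsion: with Γ symmetric in its lower indices, all terms of the cyclic sum cancel in
pairs. -/
theorem curvMat_bianchi (hQ : ∀ i j, Q i j = Q j i) (i j k l : Fin 4) :
    curvMat d Q Qi k l i j + curvMat d Q Qi l j i k + curvMat d Q Qi j k i l = 0 := by
  simp only [curvMat, chrMat, Matrix.add_apply, Matrix.sub_apply, Matrix.map_apply,
    Matrix.mul_apply, Matrix.of_apply]
  rw [chr_symm hQ i k j, chr_symm hQ i l j, chr_symm hQ i l k]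
  simp only [chr_symm hQ _ k j, chr_symm hQ _ l j, chr_symm hQ _ l k]
  ring

/-- The lowered curvature tensor has the algebraic symmetries of a curvature tensor. -/
theorem curvature_symmetries (hd : ∀ i j f, d i (d j f) = d j (d i f))
    (hQ : ∀ i j, Q i j = Q j i) (hQi : Q * Qi = 1) :
    let R : Fin 4 → Fin 4 → Fin 4 → Fin 4 → K := fun i j k l => (Q * curvMat d Q Qi k l) i j
    (∀ i j k l, R i j k l = -R j i k l) ∧ (∀ i j k l, R i j k l = -R i j l k) ∧
    (∀ i j k l, R i j k l = R k l i j) ∧ ∀ i j k l, R i j k l + R i k l j + R i l j k = 0 := by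
  intro R
  have a1 : ∀ i j k l, R i j k l = -R j i k l := by
    intro i j k l
    have h := congrFun (congrFun (metric_mul_curvMat hd hQ hQi k l) j) i
    have h2 : ((curvMat d Q Qi k l).transpose * Q) j i = R i j k l := by
      simp only [R, Matrix.mul_apply, Matrix.transpose_apply]
      exact Finset.sum_congr rfl fun m _ => by rw [hQ m i, mul_comm]
    rw [h2] at h
    exact h
  have a2 : ∀ i j k l, R i j k l = -R i j l k := by
    intro i j k l
    have : curvMat d Q Qi k l = -curvMat d Q Qi l k := by rw [curvMat, curvMat]; abel
    simp only [R]
    rw [this, Matrix.mul_neg, Matrix.neg_apply]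
  have a3 : ∀ i j k l, R i j k l + R i k l j + R i l j k = 0 := by
    intro i j k l
    simp only [R, Matrix.mul_apply, ← Finset.sum_add_distrib, ← mul_add]
    refine Finset.sum_eq_zero fun m _ => ?_
    rw [curvMat_bianchi hQ, mul_zero]
  refine ⟨a1, a2, ?_, a3⟩
  intro i j k l
  have e1 := a3 i j k l
  have e2 := a3 j k l i
  have e3 := a3 k l i j
  have e4 := a3 l i j k
  -- Pair symmetry is the signed sum of four cyclic identities, simplified by the two
  -- antisymmetries; it appears multiplied by 2.
  have h : (R i j k l - R k l i j) + (R i j k l - R k l i j) = 0 := by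
    linear_combination e1 - e2 - e3 + e4 - a2 i k l j + a2 j k l i + a1 j i k l + a1 k i j l
      + a1 k j l i - a2 j k l i - a1 l i j k - a1 l j k i + a2 j l k i - a1 l k i j
  exact sub_eq_zero.mp (eq_zero_of_add_self (K := K) h)

end Calculus

/-! ### Covariant derivatives of two-forms with values in a module -/

section Covariant

variable {K : Type*} [CommRing K] [Algebra ℝ K] {d : Fin 4 → Derivation ℝ K K}
  {Q Qi : Matrix (Fin 4) (Fin 4) K} {V : Type*} [AddCommGroup V] [Module K V]

/-- The covariant derivative of a 2-tensor with values in a module with covariant derivative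
`D`. -/
def cov (D : Fin 4 → V →+ V) (G : Fin 4 → Matrix (Fin 4) (Fin 4) K) (k : Fin 4)
    (X : Fin 4 → Fin 4 → V) (i j : Fin 4) : V :=
  D k (X i j) - ∑ l, G k l i • X l j - ∑ l, G k l j • X i l

/-- The covariant derivative of a 3-tensor. -/
def cov₃ (D : Fin 4 → V →+ V) (G : Fin 4 → Matrix (Fin 4) (Fin 4) K) (m : Fin 4)
    (S : Fin 4 → Fin 4 → Fin 4 → V) (k i j : Fin 4) : V :=
  cov D G m (S k) i j - ∑ l, G m l k • S l i j

variable {D : Fin 4 → V →+ V} {G : Fin 4 → Matrix (Fin 4) (Fin 4) K}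

/-- The Ricci identity. -/
theorem cov_comm (hD : ∀ k (f : K) X, D k (f • X) = d k f • X + f • D k X)
    (X : Fin 4 → Fin 4 → V) (m k i j : Fin 4) :
    cov D G m (cov D G k X) i j - cov D G k (cov D G m X) i j
      = (D m (D k (X i j)) - D k (D m (X i j)))
        - ∑ p, ((G k).map (d m) - (G m).map (d k) + (G m * G k - G k * G m)) p i • X p j
        - ∑ p, ((G k).map (d m) - (G m).map (d k) + (G m * G k - G k * G m)) p j • X i p := by
  simp only [cov, map_sub, map_add, hD, Matrix.add_apply, Matrix.sub_apply, Matrix.map_apply,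
    Matrix.mul_apply, Fin.sum_univ_four]
  module

theorem cov_add (X Y : Fin 4 → Fin 4 → V) (k : Fin 4) :
    cov D G k (X + Y) = cov D G k X + cov D G k Y := by
  ext i j
  simp only [cov, Pi.add_apply, map_add, smul_add, Finset.sum_add_distrib]
  abel

theorem cov_antisymm {X : Fin 4 → Fin 4 → V} (hX : ∀ i j, X j i = -X i j) (k i j : Fin 4) :
    cov D G k X j i = -cov D G k X i j := by
  simp only [cov, hX i, hX _ j, map_neg, smul_neg, Finset.sum_neg_distrib, hX i j]
  abel

/-- Contraction with the inverse metric commutes with covariant differentiation. -/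
theorem map_contract (hD : ∀ k (f : K) X, D k (f • X) = d k f • X + f • D k X)
    (hQi : ∀ k, Qi.map (d k) = -(G k * Qi + Qi * (G k).transpose)) (m : Fin 4)
    (c : Fin 4 → Fin 4 → V) :
    D m (∑ i, ∑ k, Qi i k • c i k) = ∑ i, ∑ k, Qi i k •
      (D m (c i k) - ∑ p, G m p i • c p k - ∑ p, G m p k • c i p) := by
  have h : ∀ i k, d m (Qi i k) = -(∑ p, G m i p * Qi p k + ∑ p, Qi i p * G m k p) := fun i k => by
    have := congrFun (congrFun (hQi m) i) k
    simpa [Matrix.mul_apply] using this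
  have h1 : ∑ i, ∑ k, (∑ p, G m i p * Qi p k) • c i k = ∑ i, ∑ k, Qi i k • ∑ p, G m p i • c p k := by
    simp only [Finset.sum_smul, Finset.smul_sum, smul_smul]
    rw [Finset.sum_congr rfl fun _ _ => Finset.sum_comm, Finset.sum_comm]
    refine Finset.sum_congr rfl fun _ _ => ?_
    rw [Finset.sum_comm]
    refine Finset.sum_congr rfl fun _ _ => Finset.sum_congr rfl fun _ _ => ?_
    rw [mul_comm]
  have h2 : ∑ i, ∑ k, (∑ p, Qi i p * G m k p) • c i k = ∑ i, ∑ k, Qi i k • ∑ p, G m p k • c i p := by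
    simp only [Finset.sum_smul, Finset.smul_sum, smul_smul]
    refine Finset.sum_congr rfl fun _ _ => Finset.sum_comm
  simp only [map_sum, hD, h, neg_smul, add_smul, smul_sub, Finset.sum_add_distrib,
    Finset.sum_sub_distrib, Finset.sum_neg_distrib, h1, h2]
  abel

/-- The divergence of a contracted covariant derivative. -/
theorem sum_cov₃_eq_zero (hD : ∀ k (f : K) X, D k (f • X) = d k f • X + f • D k X)
    (hQi : ∀ k, Qi.map (d k) = -(G k * Qi + Qi * (G k).transpose))
    (S : Fin 4 → Fin 4 → Fin 4 → V) (hS : ∀ j, ∑ m, ∑ k, Qi m k • S m j k = 0) (i j : Fin 4) :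
    ∑ m, ∑ k, Qi m k • cov₃ D G i S m j k = 0 := by
  have h1 := map_contract hD hQi i fun m k => S m j k
  rw [hS, map_zero] at h1
  have h2 : ∑ m, ∑ k, Qi m k • ∑ l, G i l j • S m l k = 0 := by
    have : ∑ m, ∑ k, Qi m k • ∑ l, G i l j • S m l k
        = ∑ l, G i l j • ∑ m, ∑ k, Qi m k • S m l k := by
      simp only [Finset.smul_sum]
      rw [Finset.sum_congr rfl fun _ _ => Finset.sum_comm, Finset.sum_comm]
      refine Finset.sum_congr rfl fun _ _ => Finset.sum_congr rfl fun _ _ =>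
        Finset.sum_congr rfl fun _ _ => smul_comm _ _ _
    rw [this]; simp [hS]
  have e : ∀ m k, cov₃ D G i S m j k = (D i (S m j k) - ∑ p, G i p m • S p j k
      - ∑ p, G i p k • S m j p) - ∑ l, G i l j • S m l k := by
    intro m k; simp only [cov₃, cov]; abel
  have e2 : ∑ m, ∑ k, Qi m k • cov₃ D G i S m j k
      = ∑ m, ∑ k, Qi m k • (D i (S m j k) - ∑ p, G i p m • S p j k - ∑ p, G i p k • S m j p)
        - ∑ m, ∑ k, Qi m k • ∑ l, G i l j • S m l k := by
    rw [← Finset.sum_sub_distrib]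
    refine Finset.sum_congr rfl fun m _ => ?_
    rw [← Finset.sum_sub_distrib]
    refine Finset.sum_congr rfl fun k _ => ?_
    rw [e, smul_sub]
  rw [e2, ← h1, h2, sub_zero]

/-- For each of the three indices, the Christoffel terms that correct it form a cyclic sum of S
again. -/
theorem cov₃_cyclic (S : Fin 4 → Fin 4 → Fin 4 → V)
    (hS : ∀ k i j, S k i j + S i j k + S j k i = 0) (m k i j : Fin 4) :
    cov₃ D G m S k i j + cov₃ D G m S i j k + cov₃ D G m S j k i = 0 := by
  have h1 : D m (S k i j) + D m (S i j k) + D m (S j k i) = 0 := by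
    rw [← map_add, ← map_add, hS, map_zero]
  have h2 : ∀ a b c, ∑ l, G m l a • S l b c + ∑ l, G m l a • S b c l + ∑ l, G m l a • S c l b = 0 := by
    intro a b c
    rw [← Finset.sum_add_distrib, ← Finset.sum_add_distrib]
    refine Finset.sum_eq_zero fun l _ => ?_
    rw [← smul_add, ← smul_add, hS, smul_zero]
  have e1 := h2 k i j
  have e2 := h2 i j k
  have e3 := h2 j k i
  simp only [cov₃, cov]
  calc _ = (D m (S k i j) + D m (S i j k) + D m (S j k i))
        - (∑ l, G m l k • S l i j + ∑ l, G m l k • S i j l + ∑ l, G m l k • S j l i)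
        - (∑ l, G m l i • S l j k + ∑ l, G m l i • S j k l + ∑ l, G m l i • S k l j)
        - (∑ l, G m l j • S l k i + ∑ l, G m l j • S k i l + ∑ l, G m l j • S i l k) := by abel
    _ = 0 := by rw [h1, e1, e2, e3]; simp

/-- The contracted commutator of covariant derivatives. -/
def commTerm (D : Fin 4 → V →+ V) (G : Fin 4 → Matrix (Fin 4) (Fin 4) K)
    (Qi : Matrix (Fin 4) (Fin 4) K) (T : Fin 4 → Fin 4 → V) (i j : Fin 4) : V :=
  ∑ m, ∑ k, Qi m k • (cov D G m (cov D G i T) j k - cov D G i (cov D G m T) j k)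

/-- The rough Laplacian of a closed and coclosed two-form. -/
theorem rough_laplacian (hD : ∀ k (f : K) X, D k (f • X) = d k f • X + f • D k X)
    (hQi : ∀ k, Qi.map (d k) = -(G k * Qi + Qi * (G k).transpose))
    (hG : ∀ l i j, G i l j = G j l i) {T : Fin 4 → Fin 4 → V} (hT : ∀ i j, T j i = -T i j)
    (hcl : ∀ k i j, cov D G k T i j + cov D G i T j k + cov D G j T k i = 0)
    (hdiv : ∀ j, ∑ m, ∑ k, Qi m k • cov D G m T j k = 0) (i j : Fin 4) :
    ∑ m, ∑ k, Qi m k • cov₃ D G m (fun k => cov D G k T) k i j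
      = commTerm D G Qi T j i - commTerm D G Qi T i j := by
  set S : Fin 4 → Fin 4 → Fin 4 → V := fun k => cov D G k T with hS
  have hSa : ∀ k i j, S k j i = -S k i j := fun k => cov_antisymm hT k
  have hz := sum_cov₃_eq_zero hD hQi S hdiv
  -- Subtracting the contraction of ∇_i∇_m T costs nothing, because that contraction is the
  -- derivative of a vanishing divergence. Symmetry of Γ cancels the corrections of the derivative
  -- index.
  have hcomm : ∀ i j, ∑ m, ∑ k, Qi m k • cov₃ D G m S i j k = commTerm D G Qi T i j := by
    intro i j
    rw [← sub_zero (∑ m, ∑ k, Qi m k • cov₃ D G m S i j k), ← hz i j, commTerm,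
      ← Finset.sum_sub_distrib]
    refine Finset.sum_congr rfl fun m _ => ?_
    rw [← Finset.sum_sub_distrib]
    refine Finset.sum_congr rfl fun k _ => ?_
    rw [← smul_sub, cov₃, cov₃]
    congr 1
    have : ∑ l, G m l i • S l j k = ∑ l, G i l m • S l j k :=
      Finset.sum_congr rfl fun l _ => by rw [hG l m i]
    rw [this]; simp only [hS]; abel
  have hanti : ∀ m k i j, cov₃ D G m S k j i = -cov₃ D G m S k i j := by
    intro m k i j
    have : ∑ l, G m l k • S l j i = -∑ l, G m l k • S l i j := by
      rw [← Finset.sum_neg_distrib]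
      exact Finset.sum_congr rfl fun l _ => by rw [hSa l i j, smul_neg]
    rw [cov₃, cov₃, cov_antisymm (hSa k), this]
    abel
  rw [← hcomm i j, ← hcomm j i, ← Finset.sum_sub_distrib]
  refine Finset.sum_congr rfl fun m _ => ?_
  rw [← Finset.sum_sub_distrib]
  refine Finset.sum_congr rfl fun k _ => ?_
  rw [← smul_sub]
  congr 1
  have := cov₃_cyclic (D := D) (G := G) S hcl m k i j
  rw [hanti m j i k] at this
  rw [← sub_eq_zero, ← this]; abel

/-! #### Inner products -/

/-- The full contraction of two 2-tensors. -/
def innerForm (b : V →ₗ[K] V →ₗ[K] K) (Qi : Matrix (Fin 4) (Fin 4) K)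
    (X Y : Fin 4 → Fin 4 → V) : K :=
  ∑ i, ∑ k, Qi i k • ∑ j, ∑ l, Qi j l • b (X i j) (Y k l)

theorem map_innerForm {b : V →ₗ[K] V →ₗ[K] K}
    (hb : ∀ m X Y, d m (b X Y) = b (D m X) Y + b X (D m Y))
    (hQi : ∀ k, Qi.map (d k) = -(G k * Qi + Qi * (G k).transpose)) (m : Fin 4)
    (X Y : Fin 4 → Fin 4 → V) :
    d m (innerForm b Qi X Y) = innerForm b Qi (cov D G m X) Y + innerForm b Qi X (cov D G m Y) := by
  have hd : ∀ k (f : K) (x : K), (fun k => (d k : K →+ K)) k (f • x)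
      = d k f • x + f • (fun k => (d k : K →+ K)) k x := by
    intro k f x
    simp [Derivation.leibniz, mul_comm, add_comm]
  have hc := fun c => map_contract hd hQi m c
  have hc' : ∀ c : Fin 4 → Fin 4 → K, d m (∑ i, ∑ k, Qi i k • c i k) = ∑ i, ∑ k, Qi i k •
      (d m (c i k) - ∑ p, G m p i • c p k - ∑ p, G m p k • c i p) := hc
  rw [innerForm, hc', innerForm, innerForm, ← Finset.sum_add_distrib]
  refine Finset.sum_congr rfl fun i _ => ?_
  rw [← Finset.sum_add_distrib]
  refine Finset.sum_congr rfl fun k _ => ?_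
  rw [← smul_add]
  congr 1
  rw [hc']
  have e1 : ∀ (g : Fin 4 → K) (c : Fin 4 → Fin 4 → Fin 4 → K),
      ∑ p, g p • ∑ j, ∑ l, Qi j l • c p j l = ∑ j, ∑ l, Qi j l • ∑ p, g p • c p j l := by
    intro g c
    simp only [Finset.smul_sum]
    rw [Finset.sum_comm]
    refine Finset.sum_congr rfl fun _ _ => ?_
    rw [Finset.sum_comm]
    refine Finset.sum_congr rfl fun _ _ => Finset.sum_congr rfl fun _ _ => smul_comm _ _ _
  rw [e1 (fun p => G m p i) fun p j l => b (X p j) (Y k l),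
    e1 (fun p => G m p k) fun p j l => b (X i j) (Y p l), ← Finset.sum_sub_distrib,
    ← Finset.sum_sub_distrib, ← Finset.sum_add_distrib]
  refine Finset.sum_congr rfl fun j _ => ?_
  rw [← Finset.sum_sub_distrib, ← Finset.sum_sub_distrib, ← Finset.sum_add_distrib]
  refine Finset.sum_congr rfl fun l _ => ?_
  rw [← smul_sub, ← smul_sub, ← smul_add]
  congr 1
  simp only [cov, hb, map_sub, map_sum, map_smul, LinearMap.sub_apply, LinearMap.sum_apply,
    LinearMap.smul_apply]
  abel

/-! #### The Hodge star -/

/-- The Hodge star with respect to the volume density `ρ` and the inverse metric `Qi`. -/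
def starForm (ρ : K) (Qi : Matrix (Fin 4) (Fin 4) K) (X : Fin 4 → Fin 4 → V) (i j : Fin 4) : V :=
  ∑ k, ∑ l, (algebraMap ℝ K (1 / 2 * leviCivita k l i j) * ρ) • ∑ p, ∑ q, (Qi k p * Qi l q) • X p q

/-- Raising indices commutes with ∇, since Q⁻¹ is parallel; upper indices carry Christoffel terms of
the opposite sign. -/
theorem map_raised (hD : ∀ k (f : K) X, D k (f • X) = d k f • X + f • D k X)
    (hQi : ∀ k, Qi.map (d k) = -(G k * Qi + Qi * (G k).transpose)) (m k l : Fin 4)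
    (X : Fin 4 → Fin 4 → V) :
    D m (∑ p, ∑ q, (Qi k p * Qi l q) • X p q)
      = ∑ p, ∑ q, (Qi k p * Qi l q) • cov D G m X p q
        - ∑ n, G m k n • ∑ p, ∑ q, (Qi n p * Qi l q) • X p q
        - ∑ n, G m l n • ∑ p, ∑ q, (Qi k p * Qi n q) • X p q := by
  have h : ∀ i k, d m (Qi i k) = -(∑ p, G m i p * Qi p k + ∑ p, Qi i p * G m k p) := fun i k => by
    have := congrFun (congrFun (hQi m) i) k
    simpa [Matrix.mul_apply] using this
  simp only [cov, map_sum, hD, Derivation.leibniz, h, smul_eq_mul]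
  have e1 : ∑ p, ∑ q, (Qi k p * Qi l q) • ∑ r, G m r p • X r q
      = ∑ p, ∑ q, (Qi l q * ∑ r, Qi k r * G m p r) • X p q := by
    simp only [Finset.smul_sum, Finset.mul_sum, Finset.sum_smul, smul_smul]
    rw [Finset.sum_congr rfl fun _ _ => Finset.sum_comm, Finset.sum_comm]
    refine Finset.sum_congr rfl fun _ _ => ?_
    rw [Finset.sum_comm]
    refine Finset.sum_congr rfl fun _ _ => Finset.sum_congr rfl fun _ _ => ?_
    congr 1; ring
  have e2 : ∑ p, ∑ q, (Qi k p * Qi l q) • ∑ r, G m r q • X p r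
      = ∑ p, ∑ q, (Qi k p * ∑ r, Qi l r * G m q r) • X p q := by
    simp only [Finset.smul_sum, Finset.mul_sum, Finset.sum_smul, smul_smul]
    refine Finset.sum_congr rfl fun _ _ => ?_
    rw [Finset.sum_comm]
    refine Finset.sum_congr rfl fun _ _ => Finset.sum_congr rfl fun _ _ => ?_
    congr 1; ring
  have e3 : ∑ n, G m k n • ∑ p, ∑ q, (Qi n p * Qi l q) • X p q
      = ∑ p, ∑ q, (Qi l q * ∑ r, G m k r * Qi r p) • X p q := by
    simp only [Finset.smul_sum, Finset.mul_sum, Finset.sum_smul, smul_smul]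
    rw [Finset.sum_comm]
    refine Finset.sum_congr rfl fun _ _ => ?_
    rw [Finset.sum_comm]
    refine Finset.sum_congr rfl fun _ _ => Finset.sum_congr rfl fun _ _ => ?_
    congr 1; ring
  have e4 : ∑ n, G m l n • ∑ p, ∑ q, (Qi k p * Qi n q) • X p q
      = ∑ p, ∑ q, (Qi k p * ∑ r, G m l r * Qi r q) • X p q := by
    simp only [Finset.smul_sum, Finset.mul_sum, Finset.sum_smul, smul_smul]
    rw [Finset.sum_comm]
    refine Finset.sum_congr rfl fun _ _ => ?_
    rw [Finset.sum_comm]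
    refine Finset.sum_congr rfl fun _ _ => Finset.sum_congr rfl fun _ _ => ?_
    congr 1; ring
  have e5 : ∑ p, ∑ q, (Qi k p * Qi l q) • (D m (X p q) - ∑ r, G m r p • X r q - ∑ r, G m r q • X p r)
      = ∑ p, ∑ q, (Qi k p * Qi l q) • D m (X p q)
        - ∑ p, ∑ q, (Qi k p * Qi l q) • ∑ r, G m r p • X r q
        - ∑ p, ∑ q, (Qi k p * Qi l q) • ∑ r, G m r q • X p r := by
    simp only [smul_sub, Finset.sum_sub_distrib]
  rw [e5, e1, e2, e3, e4]
  simp only [← Finset.sum_sub_distrib]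
  refine Finset.sum_congr rfl fun p _ => Finset.sum_congr rfl fun q _ => ?_
  module

/-- An endomorphism acts on forms of top degree by its trace. -/
theorem leviCivita_trace (G : Matrix (Fin 4) (Fin 4) K) (k l i j : Fin 4) :
    algebraMap ℝ K (leviCivita k l i j) * G.trace
      = ∑ n, algebraMap ℝ K (leviCivita n l i j) * G n k
        + ∑ n, algebraMap ℝ K (leviCivita k n i j) * G n l
        + ∑ n, algebraMap ℝ K (leviCivita k l n j) * G n i
        + ∑ n, algebraMap ℝ K (leviCivita k l i n) * G n j := by
  have h : ∀ a b, (if a = b then algebraMap ℝ K (leviCivita k l i j) else 0) * G a b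
      = (if b = k then algebraMap ℝ K (leviCivita a l i j) * G a b else 0)
      + (if b = l then algebraMap ℝ K (leviCivita k a i j) * G a b else 0)
      + (if b = i then algebraMap ℝ K (leviCivita k l a j) * G a b else 0)
      + (if b = j then algebraMap ℝ K (leviCivita k l i a) * G a b else 0) := by
    intro a b
    have := congrArg (algebraMap ℝ K) (sum_leviCivita_deriv k l i j a b)
    simp only [map_add, apply_ite (algebraMap ℝ K), map_zero] at this
    rw [this]
    simp only [add_mul, ite_mul, zero_mul]
  have h2 := Finset.sum_congr (rfl : (Finset.univ : Finset (Fin 4)) = Finset.univ) fun a _ =>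
    Finset.sum_congr (rfl : (Finset.univ : Finset (Fin 4)) = Finset.univ) fun b _ => h a b
  simp only [ite_mul, zero_mul, Finset.sum_add_distrib, Finset.sum_ite_eq, Finset.sum_ite_eq',
    Finset.mem_univ, if_true] at h2
  rw [← h2, Matrix.trace, Finset.mul_sum]
  rfl

/-- The star is parallel: the Christoffel terms on the four indices of the Levi-Civita symbol sum to
a trace by `leviCivita_trace`, and the derivative of the density ρ cancels that trace. -/
theorem cov_starForm (hD : ∀ k (f : K) X, D k (f • X) = d k f • X + f • D k X)
    (hQi : ∀ k, Qi.map (d k) = -(G k * Qi + Qi * (G k).transpose)) {ρ : K}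
    (hρ : ∀ k, d k ρ = (G k).trace * ρ) (m : Fin 4) (X : Fin 4 → Fin 4 → V) :
    cov D G m (starForm ρ Qi X) = starForm ρ Qi (cov D G m X) := by
  ext i j
  set c : Fin 4 → Fin 4 → Fin 4 → Fin 4 → K :=
    fun k l i j => algebraMap ℝ K (1 / 2 * leviCivita k l i j) * ρ with hc
  have hdc : ∀ k l i j, d m (c k l i j) = (G m).trace * c k l i j := by
    intro k l i j
    simp only [hc, Derivation.leibniz, Derivation.map_algebraMap, hρ, smul_eq_mul]
    ring
  have htr : ∀ k l i j, (G m).trace * c k l i j = ∑ n, c n l i j * G m n k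
      + ∑ n, c k n i j * G m n l + ∑ n, c k l n j * G m n i + ∑ n, c k l i n * G m n j := by
    intro k l i j
    have h := congrArg (fun x => algebraMap ℝ K (1 / 2) * ρ * x) (leviCivita_trace (G m) k l i j)
    simp only [mul_add, Finset.mul_sum] at h
    simp only [hc, map_mul]
    refine Eq.trans (by ring) (h.trans ?_)
    congr 1
    · congr 1
      · congr 1
        · exact Finset.sum_congr rfl fun _ _ => by ring
        · exact Finset.sum_congr rfl fun _ _ => by ring
      · exact Finset.sum_congr rfl fun _ _ => by ring
    · exact Finset.sum_congr rfl fun _ _ => by ring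
  set h : Fin 4 → Fin 4 → V := fun k l => ∑ p, ∑ q, (Qi k p * Qi l q) • X p q with hh
  have hs : ∀ i j, starForm ρ Qi X i j = ∑ k, ∑ l, c k l i j • h k l := fun i j => rfl
  have hs' : starForm ρ Qi (cov D G m X) i j
      = ∑ k, ∑ l, c k l i j • ∑ p, ∑ q, (Qi k p * Qi l q) • cov D G m X p q := rfl
  rw [hs', cov]
  simp only [hs, map_sum, hD, hdc]
  have hr : ∀ k l, D m (h k l) = ∑ p, ∑ q, (Qi k p * Qi l q) • cov D G m X p q
      - ∑ n, G m k n • h n l - ∑ n, G m l n • h k n := fun k l => map_raised hD hQi m k l X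
  simp only [hr]
  have e1 : ∑ k, ∑ l, c k l i j • ∑ n, G m k n • h n l
      = ∑ k, ∑ l, (∑ n, c n l i j * G m n k) • h k l := by
    simp only [Finset.smul_sum, Finset.sum_smul, smul_smul]
    rw [Finset.sum_congr rfl fun _ _ => Finset.sum_comm, Finset.sum_comm]
    refine Finset.sum_congr rfl fun _ _ => Finset.sum_comm
  have e2 : ∑ k, ∑ l, c k l i j • ∑ n, G m l n • h k n
      = ∑ k, ∑ l, (∑ n, c k n i j * G m n l) • h k l := by
    simp only [Finset.smul_sum, Finset.sum_smul, smul_smul]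
    refine Finset.sum_congr rfl fun _ _ => Finset.sum_comm
  have e3 : ∑ n, G m n i • ∑ k, ∑ l, c k l n j • h k l
      = ∑ k, ∑ l, (∑ n, c k l n j * G m n i) • h k l := by
    simp only [Finset.smul_sum, Finset.sum_smul, smul_smul]
    rw [Finset.sum_comm]
    refine Finset.sum_congr rfl fun _ _ => ?_
    rw [Finset.sum_comm]
    refine Finset.sum_congr rfl fun _ _ => Finset.sum_congr rfl fun _ _ => ?_
    rw [mul_comm]
  have e4 : ∑ n, G m n j • ∑ k, ∑ l, c k l i n • h k l
      = ∑ k, ∑ l, (∑ n, c k l i n * G m n j) • h k l := by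
    simp only [Finset.smul_sum, Finset.sum_smul, smul_smul]
    rw [Finset.sum_comm]
    refine Finset.sum_congr rfl fun _ _ => ?_
    rw [Finset.sum_comm]
    refine Finset.sum_congr rfl fun _ _ => Finset.sum_congr rfl fun _ _ => ?_
    rw [mul_comm]
  rw [e3, e4]
  have e5 : ∀ f : Fin 4 → Fin 4 → V, ∑ k, ∑ l, ((c k l i j) • (f k l - ∑ n, G m k n • h n l
      - ∑ n, G m l n • h k n)) = ∑ k, ∑ l, c k l i j • f k l
        - ∑ k, ∑ l, c k l i j • ∑ n, G m k n • h n l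
        - ∑ k, ∑ l, c k l i j • ∑ n, G m l n • h k n := by
    intro f; simp only [smul_sub, Finset.sum_sub_distrib]
  have e6 : ∑ k, ∑ l, ((G m).trace * c k l i j) • h k l
      = ∑ k, ∑ l, (∑ n, c n l i j * G m n k) • h k l
        + ∑ k, ∑ l, (∑ n, c k n i j * G m n l) • h k l
        + ∑ k, ∑ l, (∑ n, c k l n j * G m n i) • h k l
        + ∑ k, ∑ l, (∑ n, c k l i n * G m n j) • h k l := by
    simp only [htr, add_smul, Finset.sum_add_distrib]
  rw [Finset.sum_congr rfl fun _ _ => Finset.sum_add_distrib, Finset.sum_add_distrib, e6, e5, e1, e2]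
  abel

end Covariant

/-! ### The volume density -/

section Density

variable {K : Type*} [CommRing K] [Algebra ℝ K]

/-- The Jacobi formula. -/
theorem map_det_four (δ : Derivation ℝ K K) (Q : Matrix (Fin 4) (Fin 4) K) :
    δ Q.det = (Q.adjugate * Q.map δ).trace := by
  have h : ∀ i j, Q.adjugate i j * Q.map δ j i = Q.adjugate i j * δ (Q j i) := fun _ _ => rfl
  simp only [Matrix.trace, Matrix.diag_apply, Matrix.mul_apply, h, Matrix.adjugate_fin_succ_eq_det_submatrix,
    Matrix.det_fin_three, Matrix.submatrix_apply, Fin.sum_univ_four, Matrix.of_apply]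
  rw [Matrix.det_succ_row_zero]
  simp [Fin.sum_univ_succ, Matrix.det_fin_three, Fin.succAbove, Derivation.leibniz]
  ring

theorem map_det_of_map (δ : Derivation ℝ K K) {Q G : Matrix (Fin 4) (Fin 4) K}
    (h : Q.map δ = G.transpose * Q + Q * G) : δ Q.det = (G.trace + G.trace) * Q.det := by
  have e1 : (Q.adjugate * (G.transpose * Q)).trace = G.trace * Q.det := by
    rw [Matrix.trace_mul_comm, Matrix.mul_assoc, Matrix.mul_adjugate, Matrix.mul_smul,
      Matrix.mul_one, Matrix.trace_smul, Matrix.trace_transpose, smul_eq_mul, mul_comm]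
  have e2 : (Q.adjugate * (Q * G)).trace = G.trace * Q.det := by
    rw [← Matrix.mul_assoc, Matrix.adjugate_mul, Matrix.smul_mul, Matrix.one_mul,
      Matrix.trace_smul, smul_eq_mul, mul_comm]
  rw [map_det_four, h, Matrix.mul_add, Matrix.trace_add, e1, e2, add_mul]

/-- Differentiating ρ² = det Q gives twice the claim multiplied by ρ, and both 2 and ρ are
invertible. -/
theorem map_density (δ : Derivation ℝ K K) {Q G : Matrix (Fin 4) (Fin 4) K}
    (h : Q.map δ = G.transpose * Q + Q * G) {ρ : K} (hρ : ρ * ρ = Q.det) (hu : IsUnit ρ) :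
    δ ρ = G.trace * ρ := by
  have h1 := map_det_of_map δ h
  rw [← hρ, Derivation.leibniz, smul_eq_mul] at h1
  have h2 : ρ * (δ ρ - G.trace * ρ) + ρ * (δ ρ - G.trace * ρ) = 0 := by
    linear_combination h1
  have h3 := eq_zero_of_add_self (K := K) h2
  have h4 := (hu.mul_right_eq_zero).mp h3
  exact sub_eq_zero.mp h4

end Density

/-! ### Gauge covariant derivatives of matrices -/

section GaugeDerivative

variable {K : Type*} [CommRing K] [Algebra ℝ K] (d : Fin 4 → Derivation ℝ K K) {n : ℕ}
  (A : Fin 4 → Matrix (Fin n) (Fin n) K)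

/-- The covariant derivative `∂_k X + [A_k, X]`. -/
def gaugeD (k : Fin 4) : Matrix (Fin n) (Fin n) K →+ Matrix (Fin n) (Fin n) K where
  toFun X := X.map (d k) + (A k * X - X * A k)
  map_zero' := by ext; simp
  map_add' X Y := by
    rw [map_add_derivation, Matrix.mul_add, Matrix.add_mul]; abel

/-- The curvature `F_{ij} = ∂_i A_j - ∂_j A_i + [A_i, A_j]`. -/
def gaugeF (i j : Fin 4) : Matrix (Fin n) (Fin n) K :=
  (A j).map (d i) - (A i).map (d j) + (A i * A j - A j * A i)

variable {d A}

theorem gaugeD_apply (k : Fin 4) (X : Matrix (Fin n) (Fin n) K) :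
    gaugeD d A k X = X.map (d k) + (A k * X - X * A k) := rfl

theorem gaugeF_antisymm (i j : Fin 4) : gaugeF d A j i = -gaugeF d A i j := by
  rw [gaugeF, gaugeF]; abel

theorem gaugeD_smul (k : Fin 4) (f : K) (X : Matrix (Fin n) (Fin n) K) :
    gaugeD d A k (f • X) = d k f • X + f • gaugeD d A k X := by
  have : (f • X).map (d k) = d k f • X + f • X.map (d k) := by
    ext i j
    simp [Derivation.leibniz]; ring
  rw [gaugeD_apply, gaugeD_apply, this, Matrix.mul_smul, Matrix.smul_mul, smul_add, smul_sub]
  abel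

theorem gaugeD_comm (hd : ∀ i j f, d i (d j f) = d j (d i f)) (m k : Fin 4)
    (X : Matrix (Fin n) (Fin n) K) :
    gaugeD d A m (gaugeD d A k X) - gaugeD d A k (gaugeD d A m X)
      = gaugeF d A m k * X - X * gaugeF d A m k := by
  simp only [gaugeD_apply, gaugeF, map_add_derivation, map_sub_derivation, map_mul_derivation,
    map_map_comm hd k m X]
  noncomm_ring

theorem gaugeF_bianchi (hd : ∀ i j f, d i (d j f) = d j (d i f)) (k i j : Fin 4) :
    gaugeD d A k (gaugeF d A i j) + gaugeD d A i (gaugeF d A j k)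
      + gaugeD d A j (gaugeF d A k i) = 0 := by
  simp only [gaugeD_apply, gaugeF, map_add_derivation, map_sub_derivation, map_mul_derivation]
  rw [map_map_comm hd k i, map_map_comm hd k j, map_map_comm hd i j]
  noncomm_ring

/-- Symmetry of Γ cancels all Christoffel terms in the cyclic sum, so the Bianchi identity for
`gaugeD` carries over to the full covariant derivative. -/
theorem cov_gaugeF_cyclic (hd : ∀ i j f, d i (d j f) = d j (d i f))
    {G : Fin 4 → Matrix (Fin 4) (Fin 4) K} (hG : ∀ l i j, G i l j = G j l i) (k i j : Fin 4) :
    cov (gaugeD d A) G k (gaugeF d A) i j + cov (gaugeD d A) G i (gaugeF d A) j k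
      + cov (gaugeD d A) G j (gaugeF d A) k i = 0 := by
  have e1 : ∀ a b c, ∑ l, G a l b • gaugeF d A l c = -∑ l, G b l a • gaugeF d A c l := by
    intro a b c
    rw [← Finset.sum_neg_distrib]
    exact Finset.sum_congr rfl fun l _ => by rw [hG l a b, gaugeF_antisymm c l, smul_neg]
  rw [← gaugeF_bianchi (A := A) hd k i j]
  simp only [cov]
  rw [e1 k i j, e1 i j k, e1 j k i]
  abel

variable (K n) in
/-- The bilinear form `c ∑ X_{rs} Y_{rs}` on matrices. -/
def traceForm (c : K) : Matrix (Fin n) (Fin n) K →ₗ[K] Matrix (Fin n) (Fin n) K →ₗ[K] K :=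
  LinearMap.mk₂ K (fun X Y => c * ∑ r, ∑ s, X r s * Y r s)
    (fun X X' Y => by simp only [Matrix.add_apply, add_mul, Finset.sum_add_distrib, mul_add])
    (fun a X Y => by
      simp only [Matrix.smul_apply, smul_eq_mul, Finset.mul_sum]
      exact Finset.sum_congr rfl fun _ _ => Finset.sum_congr rfl fun _ _ => by ring)
    (fun X Y Y' => by simp only [Matrix.add_apply, mul_add, Finset.sum_add_distrib])
    (fun a X Y => by
      simp only [Matrix.smul_apply, smul_eq_mul, Finset.mul_sum]
      exact Finset.sum_congr rfl fun _ _ => Finset.sum_congr rfl fun _ _ => by ring)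

theorem traceForm_apply (c : K) (X Y : Matrix (Fin n) (Fin n) K) :
    traceForm K n c X Y = c * (X.transpose * Y).trace := by
  rw [traceForm, LinearMap.mk₂_apply, Matrix.trace]
  simp only [Matrix.diag_apply, Matrix.mul_apply, Matrix.transpose_apply]
  rw [Finset.sum_comm]

theorem traceForm_comm (c : K) (X Y : Matrix (Fin n) (Fin n) K) :
    traceForm K n c X Y = traceForm K n c Y X := by
  simp only [traceForm, LinearMap.mk₂_apply, mul_comm]

/-- The trace form is invariant under brackets with skew matrices, so the connection terms cancel.
-/
theorem map_traceForm (c : ℝ) (hA : ∀ k, (A k).transpose = -A k) (k : Fin 4)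
    (X Y : Matrix (Fin n) (Fin n) K) :
    d k (traceForm K n (algebraMap ℝ K c) X Y)
      = traceForm K n (algebraMap ℝ K c) (gaugeD d A k X) Y
        + traceForm K n (algebraMap ℝ K c) X (gaugeD d A k Y) := by
  have h1 : ∀ Z : Matrix (Fin n) (Fin n) K, d k Z.trace = (Z.map (d k)).trace := by
    intro Z; simp [Matrix.trace]
  have h2 : (X.map (d k)).transpose = X.transpose.map (d k) := rfl
  simp only [traceForm_apply, gaugeD_apply, Derivation.leibniz, Derivation.map_algebraMap,
    smul_zero, add_zero, smul_eq_mul, h1, map_mul_derivation, ← mul_add, Matrix.transpose_add,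
    Matrix.transpose_sub, Matrix.transpose_mul, hA, h2, Matrix.add_mul, Matrix.mul_add,
    Matrix.sub_mul, Matrix.mul_sub, Matrix.trace_add, Matrix.trace_sub, Matrix.mul_neg,
    Matrix.neg_mul, Matrix.trace_neg]
  have e : (A k * X.transpose * Y).trace = (X.transpose * (Y * A k)).trace := by
    rw [Matrix.mul_assoc, Matrix.trace_mul_comm, Matrix.mul_assoc]
  rw [e, Matrix.mul_assoc X.transpose (A k) Y]
  congr 1; ring

end GaugeDerivative

/-! ### The Laplacian of the squared norm -/

section Bochner

variable {K : Type*} [CommRing K] [Algebra ℝ K] {d : Fin 4 → Derivation ℝ K K}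
  {Qi : Matrix (Fin 4) (Fin 4) K} {V : Type*} [AddCommGroup V] [Module K V]
  {D : Fin 4 → V →+ V} {G : Fin 4 → Matrix (Fin 4) (Fin 4) K} {b : V →ₗ[K] V →ₗ[K] K}

theorem innerForm_comm (hbs : ∀ X Y, b X Y = b Y X) (hQis : ∀ i j, Qi i j = Qi j i)
    (X Y : Fin 4 → Fin 4 → V) : innerForm b Qi X Y = innerForm b Qi Y X := by
  rw [innerForm, innerForm, Finset.sum_comm]
  refine Finset.sum_congr rfl fun i _ => Finset.sum_congr rfl fun j _ => ?_
  rw [hQis, Finset.sum_comm]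
  congr 1
  refine Finset.sum_congr rfl fun i _ => Finset.sum_congr rfl fun j _ => ?_
  rw [hQis, hbs]

theorem innerForm_add_left (X X' Y : Fin 4 → Fin 4 → V) :
    innerForm b Qi (fun i j => X i j + X' i j) Y = innerForm b Qi X Y + innerForm b Qi X' Y := by
  simp only [innerForm, map_add, LinearMap.add_apply, smul_add, Finset.sum_add_distrib]

theorem innerForm_smul_left (c : K) (X Y : Fin 4 → Fin 4 → V) :
    innerForm b Qi (fun i j => c • X i j) Y = c * innerForm b Qi X Y := by
  simp only [innerForm, map_smul, LinearMap.smul_apply, smul_comm _ c, ← Finset.smul_sum]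
  rfl

theorem innerForm_sum_left (c : Fin 4 → K) (X : Fin 4 → Fin 4 → Fin 4 → V)
    (Y : Fin 4 → Fin 4 → V) :
    innerForm b Qi (fun i j => ∑ l, c l • X l i j) Y = ∑ l, c l * innerForm b Qi (X l) Y := by
  simp only [Fin.sum_univ_four, innerForm_add_left, innerForm_smul_left]

theorem innerForm_sub_left (X X' Y : Fin 4 → Fin 4 → V) :
    innerForm b Qi (fun i j => X i j - X' i j) Y = innerForm b Qi X Y - innerForm b Qi X' Y := by
  simp only [innerForm, map_sub, LinearMap.sub_apply, smul_sub, Finset.sum_sub_distrib]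

/-- Exchanging the slots of both arguments does not change the contraction, and for Y the exchange
is a sign. -/
theorem innerForm_swap {Y : Fin 4 → Fin 4 → V} (hY : ∀ i j, Y j i = -Y i j)
    (X : Fin 4 → Fin 4 → V) :
    innerForm b Qi (fun i j => X j i) Y = -innerForm b Qi X Y := by
  have e : ∀ i k, Qi i k • ∑ j, ∑ l, Qi j l • b (X j i) (Y k l)
      = ∑ j, ∑ l, -(Qi j l • Qi i k • b (X j i) (Y l k)) := by
    intro i k
    simp only [Finset.smul_sum]
    refine Finset.sum_congr rfl fun j _ => Finset.sum_congr rfl fun l _ => ?_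
    rw [hY l k, map_neg, smul_comm]; simp
  simp only [innerForm, e, Finset.sum_neg_distrib, neg_inj]
  simp only [Finset.smul_sum]
  simp only [Fin.sum_univ_four]
  abel

/-- The Laplacian of the squared norm of a closed and coclosed two-form. -/
theorem laplacian_innerForm (hD : ∀ k (f : K) X, D k (f • X) = d k f • X + f • D k X)
    (hQi : ∀ k, Qi.map (d k) = -(G k * Qi + Qi * (G k).transpose))
    (hQis : ∀ i j, Qi i j = Qi j i)
    (hb : ∀ m X Y, d m (b X Y) = b (D m X) Y + b X (D m Y)) (hbs : ∀ X Y, b X Y = b Y X)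
    (hG : ∀ l i j, G i l j = G j l i) {T : Fin 4 → Fin 4 → V} (hT : ∀ i j, T j i = -T i j)
    (hcl : ∀ k i j, cov D G k T i j + cov D G i T j k + cov D G j T k i = 0)
    (hdiv : ∀ j, ∑ m, ∑ k, Qi m k • cov D G m T j k = 0) :
    ∑ m, ∑ k, Qi m k * (d m (d k (innerForm b Qi T T))
        - ∑ l, G m l k * d l (innerForm b Qi T T))
      = (∑ m, ∑ k, Qi m k * innerForm b Qi (cov D G k T) (cov D G m T)
          + ∑ m, ∑ k, Qi m k * innerForm b Qi (cov D G k T) (cov D G m T))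
        - 4 * innerForm b Qi (commTerm D G Qi T) T := by
  have h1 : ∀ k, d k (innerForm b Qi T T) = 2 * innerForm b Qi (cov D G k T) T := by
    intro k
    rw [map_innerForm hb hQi, innerForm_comm hbs hQis T, two_mul]
  have h2 : ∀ m k, d m (2 * innerForm b Qi (cov D G k T) T)
      = 2 * innerForm b Qi (cov D G m (cov D G k T)) T
        + 2 * innerForm b Qi (cov D G k T) (cov D G m T) := by
    intro m k
    rw [two_mul, map_add, map_innerForm hb hQi]; ring
  have h3 : ∀ m k, innerForm b Qi (cov₃ D G m (fun k => cov D G k T) k) T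
      = innerForm b Qi (cov D G m (cov D G k T)) T
        - ∑ l, G m l k * innerForm b Qi (cov D G l T) T := by
    intro m k
    rw [← innerForm_sum_left, ← innerForm_sub_left]
    rfl
  -- The two commutator terms of `rough_laplacian` contribute equally against the antisymmetric T.
  -- With the 2 from the product rule this accounts for the factor 4.
  have h4 : ∑ m, ∑ k, Qi m k * innerForm b Qi (cov₃ D G m (fun k => cov D G k T) k) T
      = -(innerForm b Qi (commTerm D G Qi T) T + innerForm b Qi (commTerm D G Qi T) T) := by
    have : ∀ m, ∑ k, Qi m k * innerForm b Qi (cov₃ D G m (fun k => cov D G k T) k) T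
        = 1 * innerForm b Qi
          (fun i j => ∑ k, Qi m k • cov₃ D G m (fun k => cov D G k T) k i j) T := by
      intro m; rw [one_mul, innerForm_sum_left]
    simp only [this]
    rw [← innerForm_sum_left (fun _ => 1) fun m i j =>
      ∑ k, Qi m k • cov₃ D G m (fun k => cov D G k T) k i j]
    simp only [one_smul]
    have e : (fun i j => ∑ m, ∑ k, Qi m k • cov₃ D G m (fun k => cov D G k T) k i j)
        = fun i j => commTerm D G Qi T j i - commTerm D G Qi T i j := by
      ext i j; exact rough_laplacian hD hQi hG hT hcl hdiv i j
    rw [e, innerForm_sub_left, innerForm_swap hT]; ring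
  calc _ = ∑ m, ∑ k, (2 * (Qi m k * innerForm b Qi (cov₃ D G m (fun k => cov D G k T) k) T)
        + 2 * (Qi m k * innerForm b Qi (cov D G k T) (cov D G m T))) := by
        refine Finset.sum_congr rfl fun m _ => Finset.sum_congr rfl fun k _ => ?_
        have e : ∑ l, G m l k * d l (innerForm b Qi T T)
            = 2 * ∑ l, G m l k * innerForm b Qi (cov D G l T) T := by
          rw [Finset.mul_sum]
          exact Finset.sum_congr rfl fun l _ => by rw [h1]; ring
        rw [e, h1, h2, h3]; ring
    _ = _ := by
        simp only [Finset.sum_add_distrib, ← Finset.mul_sum]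
        rw [h4]; ring

end Bochner

/-! ### Self-dual parts of closed and coclosed tensors -/

theorem hodgeStar_add (Q X Y : Mat4) :
    Matrix.of (hodgeStar Q (X + Y : Mat4)) = Matrix.of (hodgeStar Q X) + Matrix.of (hodgeStar Q Y) := by
  ext i j
  simp only [Matrix.add_apply, Matrix.of_apply, hodgeStar, smul_add, Finset.sum_add_distrib]

theorem hodgeStar_smul (Q X : Mat4) (c : ℝ) :
    Matrix.of (hodgeStar Q (c • X : Mat4)) = c • Matrix.of (hodgeStar Q X) := by
  ext i j
  simp only [Matrix.smul_apply, Matrix.of_apply, hodgeStar, Finset.smul_sum, smul_comm _ c]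

/-- The pullback of a 3-tensor. -/
def tensorPull (P : Mat4) (S : Fin 4 → Mat4) (c : Fin 4) : Mat4 :=
  P.transpose * (∑ k, P k c • S k) * P

theorem tensorPull_apply (P : Mat4) (S : Fin 4 → Mat4) (c a b : Fin 4) :
    tensorPull P S c a b = ∑ k, ∑ i, ∑ j, P k c * P i a * P j b * S k i j := by
  have : tensorPull P S c a b = ∑ k, P k c * (P.transpose * S k * P) a b := by
    simp only [tensorPull, Finset.mul_sum, Finset.sum_mul, Matrix.mul_smul, Matrix.smul_mul,
      Matrix.sum_apply, Matrix.smul_apply, smul_eq_mul]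
  rw [this]
  refine Finset.sum_congr rfl fun k _ => ?_
  simp only [Matrix.mul_apply, Matrix.transpose_apply, Finset.mul_sum, Finset.sum_mul]
  rw [Finset.sum_comm]
  exact Finset.sum_congr rfl fun _ _ => Finset.sum_congr rfl fun _ _ => by ring

theorem tensorPull_tensorPull (P R : Mat4) (S : Fin 4 → Mat4) :
    tensorPull P (tensorPull R S) = tensorPull (R * P) S := by
  ext1 c
  have h0 : ∀ (f : Fin 4 → ℝ) (Z : Fin 4 → Mat4), ∑ k, f k • (R.transpose * Z k * R)
      = R.transpose * (∑ k, f k • Z k) * R := by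
    intro f Z
    rw [Finset.mul_sum, Finset.sum_mul]
    exact Finset.sum_congr rfl fun _ _ => by rw [Matrix.mul_smul, Matrix.smul_mul]
  simp only [tensorPull]
  rw [h0]
  have : ∑ k, P k c • ∑ j, R j k • S j = ∑ j, (R * P) j c • S j := by
    simp only [Finset.smul_sum, Matrix.mul_apply, Finset.sum_smul, smul_smul]
    rw [Finset.sum_comm]
    exact Finset.sum_congr rfl fun _ _ => Finset.sum_congr rfl fun _ _ => by rw [mul_comm]
  rw [this, Matrix.transpose_mul]
  simp only [Matrix.mul_assoc]

theorem tensorPull_one (S : Fin 4 → Mat4) : tensorPull 1 S = S := by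
  ext1 c
  simp [tensorPull, Matrix.one_apply]

theorem tensorPull_cyclic {P : Mat4} {S : Fin 4 → Mat4}
    (hS : ∀ k i j, S k i j + S i j k + S j k i = 0) (c a b : Fin 4) :
    tensorPull P S c a b + tensorPull P S a b c + tensorPull P S b c a = 0 := by
  have e1 : tensorPull P S a b c = ∑ k, ∑ i, ∑ j, P k c * P i a * P j b * S i j k := by
    rw [tensorPull_apply, Finset.sum_congr rfl fun _ _ => Finset.sum_comm, Finset.sum_comm]
    refine Finset.sum_congr rfl fun _ _ => ?_
    exact Finset.sum_congr rfl fun _ _ => Finset.sum_congr rfl fun _ _ => by ring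
  have e2 : tensorPull P S b c a = ∑ k, ∑ i, ∑ j, P k c * P i a * P j b * S j k i := by
    rw [tensorPull_apply, Finset.sum_comm]
    refine Finset.sum_congr rfl fun _ _ => ?_
    rw [Finset.sum_comm]
    exact Finset.sum_congr rfl fun _ _ => Finset.sum_congr rfl fun _ _ => by ring
  rw [tensorPull_apply, e1, e2]
  simp only [← Finset.sum_add_distrib, ← mul_add, hS, mul_zero, Finset.sum_const_zero]

/-- For an orthonormal frame P Pᵀ = Q⁻¹, so the plain trace in the frame computes the metric
divergence. -/
theorem sum_tensorPull (P : Mat4) (S : Fin 4 → Mat4) (b : Fin 4) :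
    ∑ c, tensorPull P S c c b = ∑ j, P j b * ∑ k, ∑ i, (P * P.transpose) k i * S k i j := by
  simp only [tensorPull_apply, Matrix.mul_apply, Matrix.transpose_apply, Finset.mul_sum,
    Finset.sum_mul]
  rw [sum_four fun c k i j => P k c * P i c * P j b * S k i j,
    sum_four fun j k i c => P j b * (P k c * P i c * S k i j)]
  refine Fintype.sum_equiv ⟨fun ⟨c, k, i, j⟩ => ⟨j, k, i, c⟩,
    fun ⟨j, k, i, c⟩ => ⟨c, k, i, j⟩, fun _ => rfl, fun _ => rfl⟩ _ _ fun _ => ?_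
  simp only [Equiv.coe_fn_mk]
  ring

theorem eq_of_antisymm {X : Mat4} (hX : X.transpose = -X) :
    X = !![0, X 0 1, X 0 2, X 0 3; -X 0 1, 0, X 1 2, X 1 3;
      -X 0 2, -X 1 2, 0, X 2 3; -X 0 3, -X 1 3, -X 2 3, 0] := by
  have h : ∀ i j, X j i = -X i j := fun i j => congrFun (congrFun hX i) j
  ext i j
  fin_cases i <;> fin_cases j <;> simp
  all_goals first
    | exact h _ _
    | (have := h 0 0; linarith)
    | (have := h 1 1; linarith)
    | (have := h 2 2; linarith)
    | (have := h 3 3; linarith)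

/-- In an orthonormal frame the cyclic sums of S are, up to sign, the divergence of ∗S, and
conversely. If both vanish for S, they vanish for ∗S and hence for the self-dual part. -/
theorem selfDualPart_one_closed {S : Fin 4 → Mat4} (hS : ∀ k, (S k).transpose = -S k)
    (hcl : ∀ k i j, S k i j + S i j k + S j k i = 0) (hdiv : ∀ b, ∑ c, S c c b = 0) :
    (∀ k i j, selfDualPart 1 (S k) i j + selfDualPart 1 (S i) j k + selfDualPart 1 (S j) k i = 0) ∧
    ∀ b, ∑ c, selfDualPart 1 (S c) c b = 0 := by
  have hd0 := hdiv 0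
  have hd1 := hdiv 1
  have hd2 := hdiv 2
  have hd3 := hdiv 3
  have c012 := hcl 0 1 2
  have c013 := hcl 0 1 3
  have c023 := hcl 0 2 3
  have c123 := hcl 1 2 3
  simp only [selfDualPart, smul_eq_mul]
  have hst := fun k => hodgeStar_one_eq (S k) (hS k)
  simp only [hst]
  rw [Fin.sum_univ_four, eq_of_antisymm (hS 0), eq_of_antisymm (hS 1), eq_of_antisymm (hS 2),
    eq_of_antisymm (hS 3)] at hd0 hd1 hd2 hd3
  rw [eq_of_antisymm (hS 0), eq_of_antisymm (hS 1), eq_of_antisymm (hS 2)] at c012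
  rw [eq_of_antisymm (hS 0), eq_of_antisymm (hS 1), eq_of_antisymm (hS 3)] at c013
  rw [eq_of_antisymm (hS 0), eq_of_antisymm (hS 2), eq_of_antisymm (hS 3)] at c023
  rw [eq_of_antisymm (hS 1), eq_of_antisymm (hS 2), eq_of_antisymm (hS 3)] at c123
  simp at hd0 hd1 hd2 hd3 c012 c013 c023 c123
  have hk : ∀ k, S k = !![0, S k 0 1, S k 0 2, S k 0 3; -S k 0 1, 0, S k 1 2, S k 1 3;
      -S k 0 2, -S k 1 2, 0, S k 2 3; -S k 0 3, -S k 1 3, -S k 2 3, 0] :=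
    fun k => eq_of_antisymm (hS k)
  -- The six independent components become functions of the derivative index, so that they are atoms
  -- for `linarith` once S is replaced by its matrix.
  generalize hs : (fun k => S k 0 1) = s01 at *
  have h01 : ∀ k, S k 0 1 = s01 k := fun k => congrFun hs k
  generalize hs2 : (fun k => S k 0 2) = s02 at *
  have h02 : ∀ k, S k 0 2 = s02 k := fun k => congrFun hs2 k
  generalize hs3 : (fun k => S k 0 3) = s03 at *
  have h03 : ∀ k, S k 0 3 = s03 k := fun k => congrFun hs3 k
  generalize hs4 : (fun k => S k 1 2) = s12 at *
  have h12 : ∀ k, S k 1 2 = s12 k := fun k => congrFun hs4 k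
  generalize hs5 : (fun k => S k 1 3) = s13 at *
  have h13 : ∀ k, S k 1 3 = s13 k := fun k => congrFun hs5 k
  generalize hs6 : (fun k => S k 2 3) = s23 at *
  have h23 : ∀ k, S k 2 3 = s23 k := fun k => congrFun hs6 k
  simp only [h01, h02, h03, h12, h13, h23] at *
  constructor
  · intro k i j
    rw [hk k, hk i, hk j]
    fin_cases k <;> fin_cases i <;> fin_cases j <;> simp <;> linarith
  · intro b
    rw [Fin.sum_univ_four, hk 0, hk 1, hk 2, hk 3]
    fin_cases b <;> simp <;> linarith

/-- The self-dual part of a closed and coclosed tensor is closed and coclosed. -/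
theorem selfDualPart_closed {Q : Mat4} (hQ : Q.PosDef) {S : Fin 4 → Mat4}
    (hS : ∀ k, (S k).transpose = -S k)
    (hcl : ∀ k i j, S k i j + S i j k + S j k i = 0)
    (hdiv : ∀ j, ∑ k, ∑ i, Q⁻¹ k i * S k i j = 0) :
    (∀ k i j, selfDualPart Q (S k) i j + selfDualPart Q (S i) j k + selfDualPart Q (S j) k i = 0) ∧
    ∀ j, ∑ k, ∑ i, Q⁻¹ k i * selfDualPart Q (S k) i j = 0 := by
  obtain ⟨P, hP, hd⟩ := exists_frame Q hQ
  have hi := inv_eq_frame hP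
  have hu : IsUnit P.det := isUnit_iff_ne_zero.mpr hd.ne'
  have hPi : P * P⁻¹ = 1 := Matrix.mul_nonsing_inv P hu
  set T : Fin 4 → Mat4 := fun k => Matrix.of (selfDualPart Q (S k)) with hT
  have hTP : ∀ c, tensorPull P T c = Matrix.of (selfDualPart 1 (tensorPull P S c)) := by
    intro c
    have h : ∀ Q X : Mat4, Matrix.of (selfDualPart Q X) =
      (1 / 2 : ℝ) • (X + Matrix.of (hodgeStar Q X)) := fun Q X => rfl
    have h2 : ∑ k, P k c • T k = Matrix.of (selfDualPart Q (∑ k, P k c • S k : Mat4)) := by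
      simp only [hT, h, Fin.sum_univ_four, hodgeStar_add, hodgeStar_smul]
      module
    rw [tensorPull, h2, ← selfDualPart_conj Q P _ hd, hP]; rfl
  have hSP : ∀ c, (tensorPull P S c).transpose = -tensorPull P S c := by
    intro c
    simp only [tensorPull, Matrix.transpose_mul, Matrix.transpose_transpose, Matrix.transpose_sum,
      Matrix.transpose_smul, hS, smul_neg, Finset.sum_neg_distrib, Matrix.neg_mul, Matrix.mul_neg,
      Matrix.mul_assoc]
  have hdivP : ∀ b, ∑ c, tensorPull P S c c b = 0 := by
    intro b
    rw [sum_tensorPull]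
    simp only [← hi, hdiv, mul_zero, Finset.sum_const_zero]
  obtain ⟨h1, h2⟩ := selfDualPart_one_closed hSP (tensorPull_cyclic hcl) hdivP
  have h1' : ∀ k i j, tensorPull P T k i j + tensorPull P T i j k + tensorPull P T j k i = 0 := by
    intro k i j; rw [hTP, hTP, hTP]; exact h1 k i j
  -- Closedness is tensorial, so it returns from the frame by pulling back along P⁻¹.
  have hTT : T = tensorPull P⁻¹ (tensorPull P T) := by
    rw [tensorPull_tensorPull, hPi, tensorPull_one]
  refine ⟨fun k i j => ?_, fun j => ?_⟩
  · have h3 := tensorPull_cyclic (P := P⁻¹) h1' k i j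
    rw [← hTT] at h3
    exact h3
  · have h4 : ∀ b, ∑ j, P j b * ∑ k, ∑ i, Q⁻¹ k i * T k i j = 0 := by
      intro b
      rw [hi, ← sum_tensorPull]
      simp only [hTP]
      exact h2 b
    -- In the frame the divergence is multiplied by P, which is invertible.
    have h5 : Matrix.vecMul (fun j => ∑ k, ∑ i, Q⁻¹ k i * T k i j) P = 0 := by
      ext b
      refine Eq.trans ?_ (h4 b)
      simp only [Matrix.vecMul, dotProduct]
      exact Finset.sum_congr rfl fun _ _ => mul_comm _ _
    have h6 := congrArg (fun v => Matrix.vecMul v P⁻¹) h5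
    simp only [Matrix.vecMul_vecMul, hPi, Matrix.vecMul_one, Matrix.zero_vecMul] at h6
    exact congrFun h6 j

/-- In a frame ∗∗ = 1 on two-forms, so ∗ fixes X + ∗X; naturality of the star transports this back.
-/
theorem isSelfDual_selfDualPart {Q : Mat4} (hQ : Q.PosDef) {X : Mat4} (hX : X.transpose = -X) :
    IsSelfDual Q (Matrix.of (selfDualPart Q X)) := by
  obtain ⟨P, hP, hd⟩ := exists_frame Q hQ
  have hu : IsUnit P.det := isUnit_iff_ne_zero.mpr hd.ne'
  have h1 : P * P⁻¹ = 1 := Matrix.mul_nonsing_inv P hu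
  have h2 : (P⁻¹).transpose * P.transpose = 1 := by
    rw [← Matrix.transpose_mul, h1, Matrix.transpose_one]
  have hcancel : ∀ Y Z : Mat4, P.transpose * Y * P = P.transpose * Z * P → Y = Z := by
    intro Y Z h
    have h3 := congrArg (fun W : Mat4 => (P⁻¹).transpose * W * P⁻¹) h
    have h4 : ∀ W : Mat4, (P⁻¹).transpose * (P.transpose * W * P) * P⁻¹ = W := by
      intro W
      calc _ = ((P⁻¹).transpose * P.transpose) * W * (P * P⁻¹) := by simp only [Matrix.mul_assoc]
        _ = W := by rw [h1, h2]; simp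
    simpa only [h4] using h3
  set Y : Mat4 := P.transpose * X * P with hYdef
  have hY : Y.transpose = -Y := by
    simp only [hYdef, Matrix.transpose_mul, Matrix.transpose_transpose, hX, Matrix.mul_neg,
      Matrix.neg_mul, Matrix.mul_assoc]
  have hs : P.transpose * Matrix.of (selfDualPart Q X) * P = Matrix.of (selfDualPart 1 Y) := by
    rw [← selfDualPart_conj Q P X hd, hP]
  have he : Matrix.of (selfDualPart 1 Y) = (1 / 2 : ℝ) • (Y + Matrix.of (hodgeStar 1 Y) : Mat4) := rfl
  have hm : ∀ Y : Mat4, Y.transpose = -Y → Matrix.of (hodgeStar 1 Y) =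
      !![0, Y 2 3, -Y 1 3, Y 1 2; -Y 2 3, 0, Y 0 3, -Y 0 2;
        Y 1 3, -Y 0 3, 0, Y 0 1; -Y 1 2, Y 0 2, -Y 0 1, 0] := hodgeStar_one_eq
  have hst : Matrix.transpose (Matrix.of (hodgeStar 1 Y)) = -(Matrix.of (hodgeStar 1 Y)) := by
    rw [hm Y hY]
    ext i j
    fin_cases i <;> fin_cases j <;> simp
  have ha : Matrix.transpose (Matrix.of (selfDualPart 1 Y)) = -Matrix.of (selfDualPart 1 Y) := by
    rw [he, Matrix.transpose_smul, Matrix.transpose_add, hY, hst, ← neg_add, smul_neg]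
  have hss : Matrix.of (hodgeStar 1 (Matrix.of (hodgeStar 1 Y))) = Y := by
    rw [hm (Matrix.of (hodgeStar 1 Y)) hst, hm Y hY]
    conv_rhs => rw [eq_of_antisymm hY]
    ext i j
    fin_cases i <;> fin_cases j <;> simp
  constructor
  · refine hcancel _ _ ?_
    rw [Matrix.mul_neg, Matrix.neg_mul, hs, ← ha, ← hs]
    simp only [Matrix.transpose_mul, Matrix.transpose_transpose, Matrix.mul_assoc]
  · refine hcancel (hodgeStar Q _) _ ?_
    refine (hodgeStar_frame hP hd (Matrix.of (selfDualPart Q X))).symm.trans ?_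
    rw [hs, he]
    refine (hodgeStar_smul 1 (Y + Matrix.of (hodgeStar 1 Y) : Mat4) (1 / 2)).trans ?_
    rw [hodgeStar_add 1 Y (Matrix.of (hodgeStar 1 Y)), hss, add_comm]

/-! ### The differential ring of smooth functions on an open set -/

theorem pd_congr {i : Fin 4} {f f' : E4 → ℝ} {y : E4} (h : f =ᶠ[𝓝 y] f') : pd i f y = pd i f' y := by
  rw [pd, pd, h.fderiv_eq]

theorem contDiffOn_pd {U : Set E4} (hU : IsOpen U) {f : E4 → ℝ} (hf : ContDiffOn ℝ ∞ f U)
    (i : Fin 4) : ContDiffOn ℝ ∞ (pd i f) U :=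
  (hf.fderiv_of_isOpen hU (m := ∞) (by simp)).clm_apply contDiffOn_const

theorem pd_pd {f : E4 → ℝ} {y : E4} (hf : ContDiffAt ℝ 2 f y) (i j : Fin 4) :
    pd i (pd j f) y = fderiv ℝ (fderiv ℝ f) y (EuclideanSpace.single i 1)
      (EuclideanSpace.single j 1) := by
  have h : DifferentiableAt ℝ (fderiv ℝ f) y :=
    (hf.fderiv_right (m := 1) (by norm_num)).differentiableAt (by norm_num)
  have : pd j f = fun z => fderiv ℝ f z (EuclideanSpace.single j 1) := rfl
  rw [pd, this, fderiv_clm_apply h (differentiableAt_const _)]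
  simp

theorem pd_pd_comm {f : E4 → ℝ} {y : E4} (hf : ContDiffAt ℝ 2 f y) (i j : Fin 4) :
    pd i (pd j f) y = pd j (pd i f) y := by
  rw [pd_pd hf, pd_pd hf]
  exact hf.isSymmSndFDerivAt (by simp) _ _

/-- The ring of smooth functions on an open set. -/
def smoothRing (U : TopologicalSpace.Opens E4) : Subalgebra ℝ (U → ℝ) where
  carrier := {f | ∃ F : E4 → ℝ, ContDiffOn ℝ ∞ F U ∧ ∀ y : U, f y = F y}
  mul_mem' := by
    rintro f f' ⟨F, hF, h⟩ ⟨F', hF', h'⟩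
    exact ⟨fun y => F y * F' y, hF.mul hF', fun y => by simp [h, h']⟩
  add_mem' := by
    rintro f f' ⟨F, hF, h⟩ ⟨F', hF', h'⟩
    exact ⟨fun y => F y + F' y, hF.add hF', fun y => by simp [h, h']⟩
  algebraMap_mem' c := ⟨fun _ => c, contDiffOn_const, fun y => rfl⟩

/-- The type of smooth functions on an open set. -/
def SmoothFun (U : TopologicalSpace.Opens E4) : Type := smoothRing U

instance (U : TopologicalSpace.Opens E4) : CommRing (SmoothFun U) :=
  inferInstanceAs (CommRing (smoothRing U))

instance (U : TopologicalSpace.Opens E4) : Algebra ℝ (SmoothFun U) :=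
  inferInstanceAs (Algebra ℝ (smoothRing U))

variable {U : TopologicalSpace.Opens E4}

/-- Evaluation at a point. -/
def evalAt (y : U) : SmoothFun U →ₐ[ℝ] ℝ := (Pi.evalAlgHom ℝ (fun _ : U => ℝ) y).comp (smoothRing U).val

theorem evalAt_ext {f f' : SmoothFun U} (h : ∀ y, evalAt y f = evalAt y f') : f = f' :=
  Subtype.ext (funext h)

/-- A function smooth on `U`, as an element of the ring. -/
def toSmooth (F : E4 → ℝ) (hF : ContDiffOn ℝ ∞ F U) : SmoothFun U :=
  ⟨fun y => F y, F, hF, fun _ => rfl⟩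

theorem evalAt_toSmooth (F : E4 → ℝ) (hF : ContDiffOn ℝ ∞ F U) (y : U) :
    evalAt y (toSmooth F hF) = F y := rfl

theorem contDiffOn_of_evalAt {f : SmoothFun U} {F : E4 → ℝ} (h : ∀ y, evalAt y f = F y) :
    ContDiffOn ℝ ∞ F U := by
  obtain ⟨F', hF', h'⟩ := f.2
  exact hF'.congr fun y hy => (h ⟨y, hy⟩).symm.trans (h' ⟨y, hy⟩)

/-- Extension of an element of the ring by zero. -/
def extendZero (f : SmoothFun U) (y : E4) : ℝ :=
  open Classical in if h : y ∈ U then evalAt ⟨y, h⟩ f else 0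

theorem evalAt_eq_extendZero (f : SmoothFun U) (y : U) : evalAt y f = extendZero f y := by
  simp [extendZero]

theorem contDiffOn_extendZero (f : SmoothFun U) : ContDiffOn ℝ ∞ (extendZero f) U :=
  contDiffOn_of_evalAt fun y => evalAt_eq_extendZero f y

theorem extendZero_eventuallyEq {f : SmoothFun U} {F : E4 → ℝ} (h : ∀ y, evalAt y f = F y) (y : U) :
    extendZero f =ᶠ[𝓝 (y : E4)] F := by
  filter_upwards [U.isOpen.mem_nhds y.2] with z hz
  rw [← evalAt_eq_extendZero f ⟨z, hz⟩, h]

theorem differentiableAt_extendZero (f : SmoothFun U) (y : U) :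
    DifferentiableAt ℝ (extendZero f) y :=
  ((contDiffOn_extendZero f).contDiffAt (U.isOpen.mem_nhds y.2)).differentiableAt (by simp)

/-- The partial derivative as a derivation of the ring of smooth functions. -/
def pdDerivation (i : Fin 4) : Derivation ℝ (SmoothFun U) (SmoothFun U) :=
  Derivation.mk' {
    toFun := fun f => toSmooth (pd i (extendZero f))
      (contDiffOn_pd U.isOpen (contDiffOn_extendZero f) i)
    map_add' := fun f f' => evalAt_ext fun y => by
      have h : extendZero (f + f') =ᶠ[𝓝 (y : E4)] extendZero f + extendZero f' :=
        extendZero_eventuallyEq (fun z => by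
          simp only [map_add, evalAt_eq_extendZero, Pi.add_apply]) y
      simp only [map_add, evalAt_toSmooth, pd]
      rw [h.fderiv_eq, fderiv_add (differentiableAt_extendZero f y)
        (differentiableAt_extendZero f' y)]
      rfl
    map_smul' := fun c f => evalAt_ext fun y => by
      have h : extendZero (c • f) =ᶠ[𝓝 (y : E4)] c • extendZero f :=
        extendZero_eventuallyEq (fun z => by
          simp only [map_smul, evalAt_eq_extendZero, Pi.smul_apply]) y
      simp only [RingHom.id_apply, map_smul, evalAt_toSmooth, pd]
      rw [h.fderiv_eq, fderiv_const_smul (differentiableAt_extendZero f y)]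
      rfl }
    fun f f' => evalAt_ext fun y => by
      have h : extendZero (f * f') =ᶠ[𝓝 (y : E4)] extendZero f * extendZero f' :=
        extendZero_eventuallyEq (fun z => by
          simp only [map_mul, evalAt_eq_extendZero, Pi.mul_apply]) y
      simp only [LinearMap.coe_mk, AddHom.coe_mk, map_add, smul_eq_mul, map_mul, evalAt_toSmooth, pd]
      rw [h.fderiv_eq, fderiv_mul (differentiableAt_extendZero f y)
        (differentiableAt_extendZero f' y)]
      simp [evalAt_eq_extendZero]

/-- U is open and derivatives depend only on germs, so any representative F can be used. This is how
ring identities become statements about coordinate expressions. -/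
theorem evalAt_pdDerivation {f : SmoothFun U} {F : E4 → ℝ} (h : ∀ y, evalAt y f = F y) (i : Fin 4)
    (y : U) : evalAt y (pdDerivation i f) = pd i F y :=
  pd_congr (extendZero_eventuallyEq h y)

theorem pdDerivation_comm (i j : Fin 4) (f : SmoothFun U) :
    pdDerivation i (pdDerivation j f) = pdDerivation j (pdDerivation i f) := by
  have h : ∀ i (y : U), evalAt y (pdDerivation i f) = pd i (extendZero f) y :=
    evalAt_pdDerivation (evalAt_eq_extendZero f)
  refine evalAt_ext fun y => ?_
  rw [evalAt_pdDerivation (h j), evalAt_pdDerivation (h i)]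
  exact pd_pd_comm (((contDiffOn_extendZero f).contDiffAt (U.isOpen.mem_nhds y.2)).of_le
    (WithTop.coe_le_coe.mpr (le_top : (2 : ℕ∞) ≤ ⊤))) i j

theorem isUnit_of_evalAt_ne_zero {f : SmoothFun U} (h : ∀ y, evalAt y f ≠ 0) : IsUnit f := by
  have hF : ContDiffOn ℝ ∞ (fun y => (extendZero f y)⁻¹) U :=
    (contDiffOn_extendZero f).inv fun y hy => by
      rw [← evalAt_eq_extendZero f ⟨y, hy⟩]; exact h _
  refine IsUnit.of_mul_eq_one (toSmooth _ hF) (evalAt_ext fun y => ?_)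
  rw [map_mul, evalAt_toSmooth, ← evalAt_eq_extendZero, map_one]
  exact mul_inv_cancel₀ (h y)

/-- The square root of a positive function. -/
theorem exists_sqrt {f : SmoothFun U} (h : ∀ y, 0 < evalAt y f) :
    ∃ ρ : SmoothFun U, ρ * ρ = f ∧ ∀ y, evalAt y ρ = √(evalAt y f) := by
  have hF : ContDiffOn ℝ ∞ (fun y => √(extendZero f y)) U :=
    (contDiffOn_extendZero f).sqrt fun y hy => by
      rw [← evalAt_eq_extendZero f ⟨y, hy⟩]; exact (h _).ne'
  have e : ∀ y, evalAt y (toSmooth _ hF) = √(evalAt y f) := fun y => by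
    rw [evalAt_toSmooth, evalAt_eq_extendZero]
  refine ⟨toSmooth _ hF, evalAt_ext fun y => ?_, e⟩
  rw [map_mul, e, Real.mul_self_sqrt (h y).le]

/-- Entrywise evaluation of matrices of smooth functions. -/
def evalMat {ι : Type*} (y : U) (X : Matrix ι ι (SmoothFun U)) : Matrix ι ι ℝ := X.map (evalAt y)

section evalMat

variable {ι : Type*} (y : U) (X Y : Matrix ι ι (SmoothFun U))

theorem evalMat_apply (i j : ι) : evalMat y X i j = evalAt y (X i j) := rfl

theorem evalMat_ext {X Y : Matrix ι ι (SmoothFun U)} (h : ∀ y, evalMat y X = evalMat y Y) : X = Y := by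
  ext1 i j
  exact evalAt_ext fun y => congrFun (congrFun (h y) i) j

theorem evalMat_zero : evalMat y (0 : Matrix ι ι (SmoothFun U)) = 0 := by
  ext i j; simp [evalMat]

theorem evalMat_add : evalMat y (X + Y) = evalMat y X + evalMat y Y := by
  ext i j; simp [evalMat]

theorem evalMat_sub : evalMat y (X - Y) = evalMat y X - evalMat y Y := by
  ext i j; simp [evalMat]

theorem evalMat_smul (c : SmoothFun U) : evalMat y (c • X) = evalAt y c • evalMat y X := by
  ext i j; simp [evalMat]

theorem evalMat_sum {κ : Type*} (s : Finset κ) (f : κ → Matrix ι ι (SmoothFun U)) :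
    evalMat y (∑ k ∈ s, f k) = ∑ k ∈ s, evalMat y (f k) := by
  ext i j; simp [evalMat, Matrix.sum_apply]

theorem evalMat_mul [Fintype ι] : evalMat y (X * Y) = evalMat y X * evalMat y Y := by
  ext i j; simp [evalMat, Matrix.mul_apply]

theorem evalMat_map_pdDerivation {n : ℕ} {X : Matrix (Fin n) (Fin n) (SmoothFun U)} {f : E4 → Mat n}
    (h : ∀ y, evalMat y X = f y) (i : Fin 4) : evalMat y (X.map (pdDerivation i)) = pdMat i f y := by
  ext r s
  exact evalAt_pdDerivation (fun z => congrFun (congrFun (h z) r) s) i y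

theorem evalMat_inv {n : ℕ} {X : Matrix (Fin n) (Fin n) (SmoothFun U)} (h : IsUnit X.det) :
    evalMat y X⁻¹ = (evalMat y X)⁻¹ := by
  refine (Matrix.inv_eq_left_inv ?_).symm
  rw [← evalMat_mul, Matrix.nonsing_inv_mul _ h]
  ext i j
  by_cases hij : i = j
  · subst hij; simp [evalMat]
  · simp [evalMat, Matrix.one_apply_ne hij]

theorem evalAt_det {n : ℕ} (X : Matrix (Fin n) (Fin n) (SmoothFun U)) :
    evalAt y X.det = (evalMat y X).det :=
  (evalAt y).map_det X

end evalMat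

/-! ### The curvature terms in the Weitzenböck formula -/

section Pointwise

variable {n : ℕ}

theorem formInner_add_left (α : ℝ) (Q : Mat4) (X X' Y : Fin 4 → Fin 4 → Mat n) :
    formInner α Q (fun i j => X i j + X' i j) Y = formInner α Q X Y + formInner α Q X' Y := by
  simp only [formInner, matInner, Matrix.add_apply, add_mul, mul_add, Finset.sum_add_distrib]

theorem formInner_smul_left (α c : ℝ) (Q : Mat4) (X Y : Fin 4 → Fin 4 → Mat n) :
    formInner α Q (fun i j => c • X i j) Y = c * formInner α Q X Y := by
  simp only [formInner, matInner, Matrix.smul_apply, smul_eq_mul, mul_assoc, mul_left_comm _ c,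
    ← Finset.mul_sum]

theorem formInner_self_nonneg {α : ℝ} (hα : 0 < α) {Q : Mat4} (hQ : Q.PosDef)
    (X : Fin 4 → Fin 4 → Mat n) : 0 ≤ formInner α Q X X := by
  obtain ⟨P, hP, hd⟩ := exists_frame Q hQ
  rw [formInner_frame hP hd]
  refine mul_nonneg (by norm_num) (Finset.sum_nonneg fun _ _ => Finset.sum_nonneg fun _ _ => ?_)
  rw [matInner_self]
  exact mul_nonneg hα.le (frobSq_nonneg _)

theorem isSelfDual_entryForm {Q : Mat4} (hQ : Q.PosDef) {F : Fin 4 → Fin 4 → Mat n}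
    (hF : ∀ i j, F j i = -F i j) (r s : Fin n) : IsSelfDual Q (entryForm (selfDualPart Q F) r s) := by
  rw [entryForm_selfDualPart]
  refine isSelfDual_selfDualPart hQ ?_
  ext i j
  simp [entryForm, hF i j]

/-- The Riemannian curvature term acting on a matrix-valued form. -/
def riemannTerm (Q : Mat4) (Rup : Fin 4 → Fin 4 → Fin 4 → Fin 4 → ℝ) (T : Fin 4 → Fin 4 → Mat n)
    (i j : Fin 4) : Mat n :=
  ∑ m, ∑ k, Q⁻¹ m k • ∑ p, (Rup p j m i • T p k + Rup p k m i • T j p)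

/-- The algebraic half of the Weitzenböck estimate: the bracket part is bounded by the cube of the
norm, the Riemannian part entry by entry through `IsSelfDual.riemann_term` and the eigenvalue bound.
-/
theorem weitzenboeck_term_le {α : ℝ} (hα : 0 < α) {Q : Mat4} (hQ : Q.PosDef)
    {R Rup : Fin 4 → Fin 4 → Fin 4 → Fin 4 → ℝ} (hR : IsCurvatureTensor R)
    (hRup : ∀ i j k l, R i j k l = ∑ m, Q i m * Rup m j k l)
    (F : Fin 4 → Fin 4 → Mat n) (hF : ∀ i j, F j i = -F i j)
    (hFs : ∀ i j, (F i j).transpose = -F i j) :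
    2 * formInner α Q (fun i j => gaugeTerm Q F (selfDualPart Q F) i j
        - riemannTerm Q Rup (selfDualPart Q F) i j) (selfDualPart Q F)
      ≤ aG n α * formNorm α Q (selfDualPart Q F) ^ 3
        - (scalarOf R Q / 3 - 2 * sSup (sdEigenvalues (weylOf R Q) Q))
          * formInner α Q (selfDualPart Q F) (selfDualPart Q F) := by
  have h1 := (le_abs_self _).trans (abs_gaugeTerm_le hα hQ F hF hFs)
  set T := selfDualPart Q F with hT
  have hsd : ∀ r s, IsSelfDual Q (entryForm T r s) := isSelfDual_entryForm hQ hF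
  have h2 : (scalarOf R Q / 3 - 2 * sSup (sdEigenvalues (weylOf R Q) Q)) * formInner α Q T T
      ≤ 2 * formInner α Q (riemannTerm Q Rup T) T := by
    have e : ∀ r s, entryForm (riemannTerm Q Rup T) r s = Matrix.of fun i j => ∑ m, ∑ k, Q⁻¹ m k *
        ∑ p, (Rup p j m i * entryForm T r s p k + Rup p k m i * entryForm T r s j p) := by
      intro r s
      ext i j
      simp [entryForm, riemannTerm, Matrix.sum_apply]
    rw [formInner_eq_sum, formInner_eq_sum]
    simp only [Finset.mul_sum]
    refine Finset.sum_le_sum fun r _ => Finset.sum_le_sum fun s _ => ?_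
    have h3 := (hsd r s).riemann_term hQ hR Rup hRup
    have h4 := formDot_tensorOp_le (weylOf R Q) (weylOf_pair hQ hR)
      (fun i j k l => weylOf_antisymm i j k l hR) hQ (hsd r s)
    rw [e]
    have h5 : (scalarOf R Q / 3 - 2 * sSup (sdEigenvalues (weylOf R Q) Q))
        * formDot Q (entryForm T r s) (entryForm T r s) ≤
        2 * formDot Q (Matrix.of fun i j => ∑ m, ∑ k, Q⁻¹ m k *
        ∑ p, (Rup p j m i * entryForm T r s p k + Rup p k m i * entryForm T r s j p))
          (entryForm T r s) := by
      rw [h3]; linarith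
    have h6 := mul_le_mul_of_nonneg_left h5 hα.le
    linarith
  have h7 : formInner α Q (fun i j => gaugeTerm Q F T i j - riemannTerm Q Rup T i j) T
      = formInner α Q (gaugeTerm Q F T) T - formInner α Q (riemannTerm Q Rup T) T := by
    have : (fun i j => gaugeTerm Q F T i j - riemannTerm Q Rup T i j)
        = fun i j => gaugeTerm Q F T i j + (-1 : ℝ) • riemannTerm Q Rup T i j := by
      ext1 i; ext1 j; module
    rw [this, formInner_add_left, formInner_smul_left _ _ _ (riemannTerm Q Rup T)]
    ring
  rw [h7]; linarith

end Pointwise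

/-! ### Geometric quantities in the ring of smooth functions -/

section Local

variable {U : TopologicalSpace.Opens E4}
  {M : Type*} [TopologicalSpace M] [ChartedSpace E4 M] [IsManifold (𝓡 4) ∞ M]
  {g : Metric M} {e : OpenPartialHomeomorph M E4}
  {Qm : Matrix (Fin 4) (Fin 4) (SmoothFun U)}

theorem isUnit_det (hQm : ∀ y : U, evalMat y Qm = metricMat g e y)
    (hQ : ∀ y : U, (metricMat g e y).PosDef) : IsUnit Qm.det :=
  isUnit_of_evalAt_ne_zero fun y => by rw [evalAt_det, hQm]; exact (hQ y).det_pos.ne'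

theorem evalMat_metric_inv (hQm : ∀ y : U, evalMat y Qm = metricMat g e y)
    (hQ : ∀ y : U, (metricMat g e y).PosDef) (y : U) :
    evalMat y Qm⁻¹ = (metricMat g e y)⁻¹ := by
  rw [evalMat_inv y (isUnit_det hQm hQ), hQm]

theorem metric_symm (hQm : ∀ y : U, evalMat y Qm = metricMat g e y)
    (hQ : ∀ y : U, (metricMat g e y).PosDef) (i j : Fin 4) : Qm i j = Qm j i :=
  evalAt_ext fun y => by
    rw [← evalMat_apply, ← evalMat_apply, hQm]; exact posDef_symm (hQ y) i j

theorem metric_inv_symm (hQm : ∀ y : U, evalMat y Qm = metricMat g e y)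
    (hQ : ∀ y : U, (metricMat g e y).PosDef) (i j : Fin 4) : Qm⁻¹ i j = Qm⁻¹ j i :=
  evalAt_ext fun y => by
    rw [← evalMat_apply, ← evalMat_apply, evalMat_metric_inv hQm hQ]; exact inv_symm (hQ y) i j

theorem evalAt_chr (hQm : ∀ y : U, evalMat y Qm = metricMat g e y)
    (hQ : ∀ y : U, (metricMat g e y).PosDef) (k i j : Fin 4) (y : U) :
    evalAt y (chr pdDerivation Qm Qm⁻¹ k i j) = christoffel g e k i j y := by
  have h : ∀ i j (y : U), evalAt y (Qm i j) = metricMat g e y i j :=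
    fun i j y => congrFun (congrFun (hQm y) i) j
  have hi : ∀ i j (y : U), evalAt y (Qm⁻¹ i j) = (metricMat g e y)⁻¹ i j :=
    fun i j y => congrFun (congrFun (evalMat_metric_inv hQm hQ y) i) j
  have hd : ∀ l i j, evalAt y (pdDerivation l (Qm i j)) = pd l (fun z => metricMat g e z i j) y :=
    fun l i j => evalAt_pdDerivation (h i j) l y
  simp only [chr, christoffel, map_mul, map_sum, map_add, map_sub, hi, hd, AlgHom.commutes]
  rfl

theorem evalMat_chrMat (hQm : ∀ y : U, evalMat y Qm = metricMat g e y)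
    (hQ : ∀ y : U, (metricMat g e y).PosDef) (i : Fin 4) (y : U) :
    evalMat y (chrMat pdDerivation Qm Qm⁻¹ i) = Matrix.of fun k j => christoffel g e k i j y := by
  ext k j; exact evalAt_chr hQm hQ k i j y

theorem evalAt_curvMat (hQm : ∀ y : U, evalMat y Qm = metricMat g e y)
    (hQ : ∀ y : U, (metricMat g e y).PosDef) (i j k l : Fin 4) (y : U) :
    evalAt y (curvMat pdDerivation Qm Qm⁻¹ k l i j) = riemannUp g e i j k l y := by
  rw [← evalMat_apply, curvMat]
  simp only [evalMat_add, evalMat_sub, evalMat_mul, evalMat_chrMat hQm hQ]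
  rw [evalMat_map_pdDerivation y
      (f := fun z => Matrix.of fun i j => christoffel g e i l j z) (evalMat_chrMat hQm hQ l),
    evalMat_map_pdDerivation y
      (f := fun z => Matrix.of fun i j => christoffel g e i k j z) (evalMat_chrMat hQm hQ k)]
  simp only [Matrix.add_apply, Matrix.sub_apply, Matrix.mul_apply, Matrix.of_apply, pdMat, riemannUp,
    Finset.sum_sub_distrib]

theorem isCurvatureTensor_riemann (hQm : ∀ y : U, evalMat y Qm = metricMat g e y)
    (hQ : ∀ y : U, (metricMat g e y).PosDef) (y : U) :
    IsCurvatureTensor fun i j k l => riemann g e i j k l y := by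
  have h1 : ∀ i j k l, evalAt y ((Qm * curvMat pdDerivation Qm Qm⁻¹ k l) i j)
      = riemann g e i j k l y := by
    intro i j k l
    rw [Matrix.mul_apply, map_sum]
    refine Finset.sum_congr rfl fun m _ => ?_
    rw [map_mul, evalAt_curvMat hQm hQ, ← evalMat_apply, hQm]
  have hu : Qm * Qm⁻¹ = 1 := Matrix.mul_nonsing_inv Qm (isUnit_det hQm hQ)
  obtain ⟨a1, a2, a3, a4⟩ := curvature_symmetries pdDerivation_comm (metric_symm hQm hQ) hu
  constructor
  · intro i j k l
    have := congrArg (evalAt y) (a1 i j k l)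
    simpa only [map_neg, h1] using this
  · intro i j k l
    have := congrArg (evalAt y) (a2 i j k l)
    simpa only [map_neg, h1] using this
  · intro i j k l
    have := congrArg (evalAt y) (a3 i j k l)
    simpa only [map_neg, h1] using this
  · intro i j k l
    have := congrArg (evalAt y) (a4 i j k l)
    simpa only [map_add, map_zero, h1] using this

variable {n : ℕ}

theorem evalMat_starForm {ρ : SmoothFun U} (hQm : ∀ y : U, evalMat y Qm = metricMat g e y)
    (hQ : ∀ y : U, (metricMat g e y).PosDef) (hρ : ∀ y, evalAt y ρ = √(metricMat g e y).det)
    {X : Fin 4 → Fin 4 → Matrix (Fin n) (Fin n) (SmoothFun U)} (y : U)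
    {η : Fin 4 → Fin 4 → Mat n} (hX : ∀ i j, evalMat y (X i j) = η i j) (i j : Fin 4) :
    evalMat y (starForm ρ Qm⁻¹ X i j) = hodgeStar (metricMat g e y) η i j := by
  have hi : ∀ i j, evalAt y (Qm⁻¹ i j) = (metricMat g e y)⁻¹ i j :=
    fun i j => congrFun (congrFun (evalMat_metric_inv hQm hQ y) i) j
  simp only [starForm, hodgeStar, evalMat_sum, evalMat_smul, map_mul, hi, hρ, hX,
    Finset.smul_sum, smul_smul, AlgHom.commutes]
  refine Finset.sum_congr rfl fun _ _ => Finset.sum_congr rfl fun _ _ =>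
    Finset.sum_congr rfl fun _ _ => Finset.sum_congr rfl fun _ _ => ?_
  congr 1
  simp only [Algebra.algebraMap_self, RingHom.id_apply]
  ring

/-- The factor 2 appears because `innerForm` contracts over all ordered index pairs, while
`formInner` halves that sum. -/
theorem evalAt_innerForm (α : ℝ) (hQm : ∀ y : U, evalMat y Qm = metricMat g e y)
    (hQ : ∀ y : U, (metricMat g e y).PosDef)
    (X Y : Fin 4 → Fin 4 → Matrix (Fin n) (Fin n) (SmoothFun U)) (y : U) :
    evalAt y (innerForm (traceForm (SmoothFun U) n (algebraMap ℝ _ α)) Qm⁻¹ X Y)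
      = 2 * formInner α (metricMat g e y) (fun i j => evalMat y (X i j))
        (fun i j => evalMat y (Y i j)) := by
  have hi : ∀ i j, evalAt y (Qm⁻¹ i j) = (metricMat g e y)⁻¹ i j :=
    fun i j => congrFun (congrFun (evalMat_metric_inv hQm hQ y) i) j
  simp only [innerForm, formInner, traceForm, LinearMap.mk₂_apply, smul_eq_mul, map_sum, map_mul, hi,
    matInner, evalMat_apply, AlgHom.commutes]
  rw [← mul_assoc, show (2 : ℝ) * (1 / 2) = 1 by norm_num, one_mul]
  simp only [Finset.mul_sum]
  rw [Finset.sum_congr rfl fun _ _ => Finset.sum_comm]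
  refine Finset.sum_congr rfl fun _ _ => Finset.sum_congr rfl fun _ _ =>
    Finset.sum_congr rfl fun _ _ => Finset.sum_congr rfl fun _ _ =>
    Finset.sum_congr rfl fun _ _ => Finset.sum_congr rfl fun _ _ => ?_
  rw [Algebra.algebraMap_self, RingHom.id_apply]
  ring

variable {ι : Type*} {Gr : Subgroup (Matrix.orthogonalGroup (Fin n) ℝ)}
  {Z : VectorBundleCore ℝ M (Fin n → ℝ) ι} {A : Connection Gr Z} {a : ι}
  {Am : Fin 4 → Matrix (Fin n) (Fin n) (SmoothFun U)}

theorem evalMat_gaugeF (hAm : ∀ i (y : U), evalMat y (Am i) = formCoeff (A.form a) e i y) (y : U)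
    (i j : Fin 4) : evalMat y (gaugeF pdDerivation Am i j) = A.curv a e y i j := by
  rw [gaugeF, evalMat_add, evalMat_sub, evalMat_sub, evalMat_mul, evalMat_mul,
    evalMat_map_pdDerivation y (hAm j), evalMat_map_pdDerivation y (hAm i), hAm, hAm]
  rfl

theorem evalMat_cov_gaugeF (hQm : ∀ y : U, evalMat y Qm = metricMat g e y)
    (hQ : ∀ y : U, (metricMat g e y).PosDef)
    (hAm : ∀ i (y : U), evalMat y (Am i) = formCoeff (A.form a) e i y) (y : U) (k i j : Fin 4) :
    evalMat y (cov (gaugeD pdDerivation Am) (chrMat pdDerivation Qm Qm⁻¹) k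
      (gaugeF pdDerivation Am) i j) = A.covDerivCurv g a e y k i j := by
  have hc : ∀ l i, evalAt y (chrMat pdDerivation Qm Qm⁻¹ k l i) = christoffel g e l k i y :=
    fun l i => evalAt_chr hQm hQ l k i y
  have hm : evalMat y ((gaugeF pdDerivation Am i j).map (pdDerivation k))
      = pdMat k (fun z => A.curv a e z i j) y :=
    evalMat_map_pdDerivation y (fun z => evalMat_gaugeF hAm z i j) k
  simp only [cov, gaugeD_apply, evalMat_sub, evalMat_add, evalMat_mul, evalMat_sum, evalMat_smul, hc,
    evalMat_gaugeF hAm, hAm, hm]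
  rw [Connection.covDerivCurv]
  abel

end Local

/-! ### The Bochner inequality in a chart -/

section Bochner

variable {U : TopologicalSpace.Opens E4}
  {M : Type*} [TopologicalSpace M] [ChartedSpace E4 M] [IsManifold (𝓡 4) ∞ M]
  {g : Metric M} {e : OpenPartialHomeomorph M E4}
  {n : ℕ} {ι : Type*} {Gr : Subgroup (Matrix.orthogonalGroup (Fin n) ℝ)}
  {Z : VectorBundleCore ℝ M (Fin n → ℝ) ι} {A : Connection Gr Z} {a : ι}
  {Qm : Matrix (Fin 4) (Fin 4) (SmoothFun U)}
  {Am : Fin 4 → Matrix (Fin n) (Fin n) (SmoothFun U)}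

/-- The squared norm of the self-dual part of the curvature, in a chart and a trivialization. -/
def normSqLoc (A : Connection Gr Z) (g : Metric M) (α : ℝ) (a : ι)
    (e : OpenPartialHomeomorph M E4) (y : E4) : ℝ :=
  formInner α (metricMat g e y) (selfDualPart (metricMat g e y) (A.curv a e y))
    (selfDualPart (metricMat g e y) (A.curv a e y))

theorem curv_antisymm (A : Connection Gr Z) (a : ι) (e : OpenPartialHomeomorph M E4) (y : E4)
    (i j : Fin 4) : A.curv a e y j i = -A.curv a e y i j := by
  rw [Connection.curv, Connection.curv]; abel

/-- The self-dual part of the curvature, over the ring of smooth functions. -/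
def plusForm (ρ : SmoothFun U) (Qm : Matrix (Fin 4) (Fin 4) (SmoothFun U))
    (F : Fin 4 → Fin 4 → Matrix (Fin n) (Fin n) (SmoothFun U)) (i j : Fin 4) :
    Matrix (Fin n) (Fin n) (SmoothFun U) :=
  algebraMap ℝ (SmoothFun U) (1 / 2) • (F i j + starForm ρ Qm⁻¹ F i j)

theorem evalMat_plusForm {ρ : SmoothFun U} (hQm : ∀ y : U, evalMat y Qm = metricMat g e y)
    (hQ : ∀ y : U, (metricMat g e y).PosDef) (hρ : ∀ y, evalAt y ρ = √(metricMat g e y).det)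
    {X : Fin 4 → Fin 4 → Matrix (Fin n) (Fin n) (SmoothFun U)} (y : U)
    {η : Fin 4 → Fin 4 → Mat n} (hX : ∀ i j, evalMat y (X i j) = η i j) (i j : Fin 4) :
    evalMat y (plusForm ρ Qm X i j) = selfDualPart (metricMat g e y) η i j := by
  rw [plusForm, evalMat_smul, evalMat_add, hX, evalMat_starForm hQm hQ hρ y hX, AlgHom.commutes]
  rfl

theorem cov_plusForm {D : Fin 4 → Matrix (Fin n) (Fin n) (SmoothFun U) →+
      Matrix (Fin n) (Fin n) (SmoothFun U)} {G : Fin 4 → Matrix (Fin 4) (Fin 4) (SmoothFun U)}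
    (hD : ∀ k (f : SmoothFun U) X, D k (f • X) = pdDerivation k f • X + f • D k X)
    (hQi : ∀ k, Qm⁻¹.map (pdDerivation k) = -(G k * Qm⁻¹ + Qm⁻¹ * (G k).transpose))
    {ρ : SmoothFun U} (hρ : ∀ k, pdDerivation k ρ = (G k).trace * ρ) (m : Fin 4)
    (X : Fin 4 → Fin 4 → Matrix (Fin n) (Fin n) (SmoothFun U)) :
    cov D G m (plusForm ρ Qm X) = plusForm ρ Qm (cov D G m X) := by
  have h1 : plusForm ρ Qm (cov D G m X)
      = fun i j => algebraMap ℝ (SmoothFun U) (1 / 2) • cov D G m (X + starForm ρ Qm⁻¹ X) i j := by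
    ext1 i; ext1 j
    rw [cov_add, cov_starForm hD hQi hρ]; rfl
  rw [h1]
  ext1 i; ext1 j
  simp only [cov, plusForm, Pi.add_apply, hD, Derivation.map_algebraMap, zero_smul, zero_add, smul_sub,
    Finset.smul_sum, smul_comm (algebraMap ℝ (SmoothFun U) (1 / 2))]

/-- The Weitzenböck identity is obtained in the ring over U and evaluated at y; then `refined_kato`
and `weitzenboeck_term_le` are inserted. Everything is multiplied by N, so no division is needed and
zeros of F⁺ are included. -/
theorem bochner_loc (hQm : ∀ y : U, evalMat y Qm = metricMat g e y)
    (hQ : ∀ y : U, (metricMat g e y).PosDef)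
    (hAm : ∀ i (y : U), evalMat y (Am i) = formCoeff (A.form a) e i y)
    (hAs : ∀ i (y : U), (formCoeff (A.form a) e i y).transpose = -formCoeff (A.form a) e i y)
    (hYM : ∀ y : U, ∀ j,
      ∑ k, ∑ i, (metricMat g e y)⁻¹ k i • A.covDerivCurv g a e y k i j = 0)
    {α : ℝ} (hα : 0 < α) :
    ContDiffOn ℝ ∞ (normSqLoc A g α a e) U ∧ ∀ y : U,
      3 / 8 * ∑ i, ∑ j, (metricMat g e y)⁻¹ i j * pd i (normSqLoc A g α a e) y *
          pd j (normSqLoc A g α a e) y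
        + (scalarLoc g e y / 3 - 2 * sSup (weylPlusEigenvalues g e y))
          * normSqLoc A g α a e y ^ 2
        - aG n α * √(normSqLoc A g α a e y) ^ 3 * normSqLoc A g α a e y
      ≤ normSqLoc A g α a e y * (1 / 2 * ∑ i, ∑ j, (metricMat g e y)⁻¹ i j *
        (pd i (pd j (normSqLoc A g α a e)) y
          - ∑ k, christoffel g e k i j y * pd k (normSqLoc A g α a e) y)) := by
  have hu := isUnit_det hQm hQ
  have hQQ : Qm * Qm⁻¹ = 1 := Matrix.mul_nonsing_inv Qm hu
  have hsym := metric_symm hQm hQ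
  have hisym := metric_inv_symm hQm hQ
  set d : Fin 4 → Derivation ℝ (SmoothFun U) (SmoothFun U) := pdDerivation with hd
  set G := chrMat d Qm Qm⁻¹ with hG
  have hQi : ∀ k, Qm⁻¹.map (d k) = -(G k * Qm⁻¹ + Qm⁻¹ * (G k).transpose) :=
    map_inv_metric hsym hQQ
  -- The volume density √det g has to be a ring element in order to be differentiated.
  obtain ⟨ρ, hρρ, hρ'⟩ := exists_sqrt (f := Qm.det) fun y => by
    rw [evalAt_det, hQm]; exact (hQ y).det_pos
  have hρ : ∀ y, evalAt y ρ = √(metricMat g e y).det := fun y => by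
    rw [hρ', evalAt_det, hQm]
  have hρu : IsUnit ρ := isUnit_of_mul_isUnit_left (y := ρ) (by rw [hρρ]; exact hu)
  have hρd : ∀ k, d k ρ = (G k).trace * ρ := fun k =>
    map_density (d k) (map_metric hsym hQQ k) hρρ hρu
  have hcomm : ∀ i j f, d i (d j f) = d j (d i f) := pdDerivation_comm
  have hGs : ∀ l i j, G i l j = G j l i := fun l i j => chr_symm hsym l i j
  have hAmS : ∀ i, (Am i).transpose = -Am i := fun i => evalMat_ext fun y => by
    have h1 : evalMat y (Am i).transpose = (evalMat y (Am i)).transpose := rfl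
    have h2 : evalMat y (-Am i) = -evalMat y (Am i) := by ext; simp [evalMat]
    rw [h1, h2, hAm, hAs]
  set F := gaugeF d Am with hF
  have hFe : ∀ (y : U) i j, evalMat y (F i j) = A.curv a e y i j := evalMat_gaugeF hAm
  set D := gaugeD d Am with hDdef
  have hD : ∀ k (f : SmoothFun U) X, D k (f • X) = d k f • X + f • D k X :=
    fun k f X => gaugeD_smul k f X
  have hcF : ∀ (y : U) k i j, evalMat y (cov D G k F i j) = A.covDerivCurv g a e y k i j :=
    evalMat_cov_gaugeF hQm hQ hAm
  have hFa : ∀ i j, F j i = -F i j := gaugeF_antisymm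
  set T := plusForm ρ Qm F with hT
  have hTe : ∀ (y : U) i j, evalMat y (T i j)
      = selfDualPart (metricMat g e y) (A.curv a e y) i j := fun y =>
    evalMat_plusForm hQm hQ hρ y (hFe y)
  have hcT : ∀ (y : U) k i j, evalMat y (cov D G k T i j)
      = selfDualPart (metricMat g e y) (A.covDerivCurv g a e y k) i j := fun y k i j => by
    rw [hT, cov_plusForm hD hQi hρd]
    exact evalMat_plusForm hQm hQ hρ y (hcF y k) i j
  have hsd : ∀ (y : U) r s,
      IsSelfDual (metricMat g e y)
        (entryForm (selfDualPart (metricMat g e y) (A.curv a e y)) r s) :=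
    fun y => isSelfDual_entryForm (hQ y) (curv_antisymm A a e y)
  have hTa : ∀ i j, T j i = -T i j := fun i j => evalMat_ext fun y => by
    have h2 : evalMat y (-T i j) = -evalMat y (T i j) := by ext; simp [evalMat]
    rw [h2, hTe, hTe]
    ext r s
    exact congrFun (congrFun (hsd y r s).antisymm i) j
  have hcFa : ∀ (y : U) k i j, A.covDerivCurv g a e y k j i = -A.covDerivCurv g a e y k i j := by
    intro y k i j
    have h2 : evalMat y (-cov D G k F i j) = -evalMat y (cov D G k F i j) := by ext; simp [evalMat]
    rw [← hcF, ← hcF, cov_antisymm hFa, h2]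
  -- Applied to each matrix entry of ∇F: the cyclic condition is the Bianchi identity, the
  -- divergence condition is the Yang-Mills equation.
  have hclosed := fun (y : U) (r s : Fin n) => selfDualPart_closed (hQ y)
    (S := fun k => entryForm (A.covDerivCurv g a e y k) r s)
    (fun k => by ext i j; simp [entryForm, hcFa y k i j])
    (fun k i j => by
      have h1 := congrArg (evalMat y) (cov_gaugeF_cyclic (A := Am) hcomm hGs k i j)
      rw [evalMat_add, evalMat_add, evalMat_zero, hcF, hcF, hcF] at h1
      exact congrFun (congrFun h1 r) s)
    (fun j => by
      have := congrFun (congrFun (hYM y j) r) s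
      simpa [Matrix.sum_apply, entryForm] using this)
  have hcl : ∀ k i j, cov D G k T i j + cov D G i T j k + cov D G j T k i = 0 := fun k i j =>
    evalMat_ext fun y => by
      rw [evalMat_add, evalMat_add, evalMat_zero, hcT, hcT, hcT]
      ext r s
      simp only [Matrix.add_apply, selfDualPart_entry]
      exact (hclosed y r s).1 k i j
  have hdivy : ∀ (y : U) j, ∑ k, ∑ i, (metricMat g e y)⁻¹ k i •
      selfDualPart (metricMat g e y) (A.covDerivCurv g a e y k) i j = 0 := fun y j => by
    ext r s
    simp only [Matrix.sum_apply, Matrix.smul_apply, selfDualPart_entry, smul_eq_mul]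
    exact (hclosed y r s).2 j
  have hie : ∀ (y : U) i j, evalAt y (Qm⁻¹ i j) = (metricMat g e y)⁻¹ i j :=
    fun y i j => congrFun (congrFun (evalMat_metric_inv hQm hQ y) i) j
  have hdiv : ∀ j, ∑ m, ∑ k, Qm⁻¹ m k • cov D G m T j k = 0 := fun j => evalMat_ext fun y => by
    simp only [evalMat_sum, evalMat_smul, hie, hcT, evalMat_zero]
    have h1 : ∀ k i, selfDualPart (metricMat g e y) (A.covDerivCurv g a e y k) j i
        = -selfDualPart (metricMat g e y) (A.covDerivCurv g a e y k) i j := by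
      intro k i
      have h2 : evalMat y (-cov D G k T i j) = -evalMat y (cov D G k T i j) := by ext; simp [evalMat]
      rw [← hcT, ← hcT, cov_antisymm hTa, h2]
    simp only [h1, smul_neg, Finset.sum_neg_distrib, hdivy, neg_zero]
  set b := traceForm (SmoothFun U) n (algebraMap ℝ _ α) with hb
  have hbd : ∀ m X Y, d m (b X Y) = b (D m X) Y + b X (D m Y) := fun m X Y =>
    map_traceForm α hAmS m X Y
  have hbs : ∀ X Y, b X Y = b Y X := traceForm_comm _
  have hmain := laplacian_innerForm hD hQi hisym hbd hbs hGs hTa hcl hdiv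
  have hinner : ∀ (y : U) X Y, evalAt y (innerForm b Qm⁻¹ X Y) = 2 * formInner α (metricMat g e y)
      (fun i j => evalMat y (X i j)) (fun i j => evalMat y (Y i j)) := fun y X Y =>
    evalAt_innerForm α hQm hQ X Y y
  set N := normSqLoc A g α a e with hN
  set Nk := algebraMap ℝ (SmoothFun U) (1 / 2) * innerForm b Qm⁻¹ T T with hNk
  have hNe : ∀ y : U, evalAt y Nk = N y := by
    intro y
    rw [hNk, map_mul, AlgHom.commutes, hinner]
    simp only [hTe]
    rw [hN, normSqLoc, Algebra.algebraMap_self, RingHom.id_apply]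
    ring
  have hTT : innerForm b Qm⁻¹ T T = Nk + Nk := by
    rw [hNk, ← add_mul, two_mul_half, one_mul]
  refine ⟨contDiffOn_of_evalAt hNe, fun y => ?_⟩
  set Q := metricMat g e y with hQdef
  set Ty := selfDualPart Q (A.curv a e y) with hTy
  set S := fun k => selfDualPart Q (A.covDerivCurv g a e y k) with hS
  have hd1 : ∀ (y : U) i, evalAt y (d i Nk) = pd i N y := fun y i => evalAt_pdDerivation hNe i y
  have hd2 : ∀ i j, evalAt y (d i (d j Nk)) = pd i (pd j N) y := fun i j =>
    evalAt_pdDerivation (fun z => hd1 z j) i y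
  have hgrad : ∀ i, pd i N y = 2 * formInner α Q (S i) Ty := by
    intro i
    have h1 := congrArg (evalAt y) (map_innerForm hbd hQi i T T)
    rw [innerForm_comm hbs hisym T (cov D G i T), hTT, map_add, map_add, map_add, hd1, hinner] at h1
    simp only [hcT, hTe] at h1
    have h2 : pd i N y + pd i N y = 2 * formInner α Q (S i) Ty + 2 * formInner α Q (S i) Ty := h1
    linarith
  -- The Ricci identity splits the commutator into the bracket with F and the action of the Riemann
  -- tensor on the two form indices.
  have hC : ∀ i j, evalMat y (commTerm D G Qm⁻¹ T i j)
      = gaugeTerm Q (A.curv a e y) Ty i j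
        - riemannTerm Q (fun i j k l => riemannUp g e i j k l y) Ty i j := by
    intro i j
    have hR : ∀ m i p j, evalAt y (((G i).map (d m) - (G m).map (d i) + (G m * G i - G i * G m)) p j)
        = riemannUp g e p j m i y := fun m i p j => evalAt_curvMat hQm hQ p j m i y
    rw [commTerm, gaugeTerm, riemannTerm, ← Finset.sum_sub_distrib, evalMat_sum]
    refine Finset.sum_congr rfl fun m _ => ?_
    rw [← Finset.sum_sub_distrib, evalMat_sum]
    refine Finset.sum_congr rfl fun k _ => ?_
    rw [cov_comm hD, hDdef, gaugeD_comm hcomm, evalMat_smul, ← smul_sub, hie]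
    simp only [evalMat_sub, evalMat_mul, evalMat_sum, evalMat_smul, hR, hTe]
    rw [← hF, hFe, Finset.sum_add_distrib]
    congr 1
    abel
  have hlap := congrArg (evalAt y) hmain
  rw [hTT] at hlap
  have hGe : ∀ m l k, evalAt y (G m l k) = christoffel g e l m k y := fun m l k =>
    evalAt_chr hQm hQ l m k y
  simp only [map_sum, map_mul, map_sub, map_add, hd1, hd2, hie, hGe, hinner, hcT, hC, hTe,
    map_ofNat] at hlap
  have hwe := weitzenboeck_term_le hα (hQ y) (isCurvatureTensor_riemann hQm hQ y)
    (Rup := fun i j k l => riemannUp g e i j k l y) (fun _ _ _ _ => rfl) (A.curv a e y)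
    (curv_antisymm A a e y) (fun i j => ?_)
  · have hk := refined_kato (α := α) (hQ y) Ty S (hsd y)
      (fun k => isSelfDual_entryForm (hQ y) (hcFa y k)) (hdivy y)
    have hN0 : N y = formInner α Q Ty Ty := rfl
    have hNn : 0 ≤ N y := formInner_self_nonneg hα (hQ y) Ty
    set L := ∑ i, ∑ j, Q⁻¹ i j * (pd i (pd j N) y - ∑ k, christoffel g e k i j y * pd k N y) with hL
    set σ := ∑ m, ∑ k, Q⁻¹ m k * formInner α Q (S m) (S k) with hσ
    set C := formInner α Q (fun i j => gaugeTerm Q (A.curv a e y) Ty i j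
        - riemannTerm Q (fun i j k l => riemannUp g e i j k l y) Ty i j) Ty with hCdef
    have e1 : ∑ m, ∑ k, Q⁻¹ m k * (pd m (pd k N) y + pd m (pd k N) y
        - ∑ l, christoffel g e l m k y * (pd l N y + pd l N y)) = L + L := by
      rw [hL, ← Finset.sum_add_distrib]
      refine Finset.sum_congr rfl fun m _ => ?_
      rw [← Finset.sum_add_distrib]
      refine Finset.sum_congr rfl fun k _ => ?_
      simp only [mul_add, Finset.sum_add_distrib]
      ring
    have e2 : ∑ m, ∑ k, Q⁻¹ m k * (2 * formInner α Q (S k) (S m)) = 2 * σ := by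
      rw [hσ, Finset.sum_comm]
      simp only [Finset.mul_sum]
      refine Finset.sum_congr rfl fun m _ => Finset.sum_congr rfl fun k _ => ?_
      rw [inv_symm (hQ y) k m]; ring
    have e3 : L + L = 2 * σ + 2 * σ - 4 * (2 * C) := by
      rw [← e1, ← e2]; exact hlap
    have e4 : ∑ i, ∑ j, Q⁻¹ i j * pd i N y * pd j N y
        = 4 * ∑ m, ∑ k, Q⁻¹ m k * (formInner α Q (S m) Ty * formInner α Q (S k) Ty) := by
      simp only [Finset.mul_sum]
      refine Finset.sum_congr rfl fun m _ => Finset.sum_congr rfl fun k _ => ?_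
      rw [hgrad, hgrad]; ring
    have e5 : 2 * C ≤ aG n α * √(N y) ^ 3
        - (scalarLoc g e y / 3 - 2 * sSup (weylPlusEigenvalues g e y)) * N y := hwe
    rw [e4]
    -- Here ½L = σ − 2C is the Weitzenböck formula. Kato bounds Nσ below by (3/8)|∇N|²: the factor
    -- is 3/2 divided by the 4 in `e4`.
    have e6 : N y * (1 / 2 * L) = N y * σ - N y * (2 * C) := by
      have : L = 2 * σ - 2 * (2 * C) := by linarith
      rw [this]; ring
    rw [e6]
    have e7 := mul_le_mul_of_nonneg_left e5 hNn
    rw [← hN0] at hk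
    linarith
  -- The remaining goal is skewness of the curvature, inherited from the connection matrices.
  · have hFt : (F i j).transpose = -F i j := by
      have ht : ∀ k l, ((Am l).map (d k)).transpose = -(Am l).map (d k) := by
        intro k l
        have h1 : ((Am l).map (d k)).transpose = (Am l).transpose.map (d k) := rfl
        rw [h1, hAmS]; ext r s; simp
      rw [hF, gaugeF, Matrix.transpose_add, Matrix.transpose_sub, Matrix.transpose_sub,
        Matrix.transpose_mul, Matrix.transpose_mul, ht, ht, hAmS, hAmS]
      noncomm_ring
    have h1 := congrArg (evalMat y) hFt
    have h2 : evalMat y (-F i j) = -evalMat y (F i j) := by ext; simp [evalMat]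
    rw [h2, hFe] at h1
    rw [← h1, ← hFe]; rfl

end Bochner

/-! ### Lie algebras of orthogonal groups -/

/-- The derivative at t = 0 of a constant product is both 0 and y + x. -/
theorem add_eq_zero_of_exp_mul_exp {𝔸 : Type*} [NormedRing 𝔸] [NormedAlgebra ℝ 𝔸] [CompleteSpace 𝔸]
    {x y : 𝔸} (h : ∀ t : ℝ, NormedSpace.exp (t • y) * NormedSpace.exp (t • x) = 1) : y + x = 0 := by
  have h2 : HasDerivAt (fun t : ℝ => NormedSpace.exp (t • y) * NormedSpace.exp (t • x))
      (y + x) 0 := by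
    have := (hasDerivAt_exp_smul_const (𝕂 := ℝ) y (0 : ℝ)).fun_mul
      (hasDerivAt_exp_smul_const (𝕂 := ℝ) x (0 : ℝ))
    simpa using this
  have h3 : HasDerivAt (fun t : ℝ => NormedSpace.exp (t • y) * NormedSpace.exp (t • x)) 0 0 := by
    simp only [h]; exact hasDerivAt_const _ _
  exact h2.unique h3

/-- The elements of the Lie algebra of a subgroup of the orthogonal group are skew-symmetric. -/
theorem transpose_of_mem_lieAlg {n : ℕ} {G : Subgroup (Matrix.orthogonalGroup (Fin n) ℝ)} {X : Mat n}
    (hX : X ∈ lieAlg G) : X.transpose = -X := by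
  have h1 : ∀ t : ℝ, NormedSpace.exp (t • X.transpose) * NormedSpace.exp (t • X) = 1 := by
    intro t
    obtain ⟨h, -, hh⟩ := hX t
    have h2 := (Matrix.mem_orthogonalGroup_iff' (Fin n) ℝ).mp h.2
    rw [← Matrix.transpose_smul, Matrix.exp_transpose, ← hh]
    exact h2
  -- A norm is chosen only in order to differentiate the exponential.
  letI : NormedRing (Mat n) := Matrix.linftyOpNormedRing
  letI : NormedAlgebra ℝ (Mat n) := Matrix.linftyOpNormedAlgebra
  exact eq_neg_of_add_eq_zero_left (add_eq_zero_of_exp_mul_exp h1)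

/-! ### Coordinate vector fields and the metric in a chart -/

section Metric

variable {M : Type*} [TopologicalSpace M] [ChartedSpace E4 M] [IsManifold (𝓡 4) ∞ M]
  {e : OpenPartialHomeomorph M E4}

theorem contMDiffOn_symm (he : e ∈ atlas E4 M) : ContMDiffOn (𝓡 4) (𝓡 4) ∞ e.symm e.target :=
  contMDiffOn_symm_of_mem_maximalAtlas (IsManifold.subset_maximalAtlas he)

theorem contMDiff_constVec (i : Fin 4) : ContMDiff (𝓡 4) (𝓡 4).tangent ∞
    (fun y : E4 => (⟨y, EuclideanSpace.single i 1⟩ : TangentBundle (𝓡 4) E4)) := fun _ =>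
  contMDiffAt_vectorSpace_iff_contDiffAt.mpr contDiffAt_const

theorem contMDiffOn_tangentMap_symm (he : e ∈ atlas E4 M) :
    ContMDiffOn (𝓡 4).tangent (𝓡 4).tangent ∞ (tangentMapWithin (𝓡 4) (𝓡 4) e.symm e.target)
      (Bundle.TotalSpace.proj ⁻¹' e.target) :=
  (contMDiffOn_symm he).contMDiffOn_tangentMapWithin (m := ∞) (by simp)
    e.open_target.uniqueMDiffOn

theorem tangentMapWithin_symm (e : OpenPartialHomeomorph M E4) {y : E4} (hy : y ∈ e.target)
    (v : E4) :
    tangentMapWithin (𝓡 4) (𝓡 4) e.symm e.target (⟨y, v⟩ : TangentBundle (𝓡 4) E4)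
      = ⟨e.symm y, mfderiv (𝓡 4) (𝓡 4) e.symm y v⟩ := by
  rw [tangentMapWithin, mfderivWithin_of_isOpen e.open_target hy]

/-- The coordinate field is the tangent map of `e.symm` applied to a constant vector field. -/
theorem contMDiffOn_coordVec (he : e ∈ atlas E4 M) (i : Fin 4) :
    ContMDiffOn (𝓡 4) (𝓡 4).tangent ∞
      (fun y => (⟨e.symm y, coordVec e i y⟩ : TangentBundle (𝓡 4) M)) e.target := by
  have h := (contMDiffOn_tangentMap_symm he).comp (contMDiff_constVec i).contMDiffOn
    (s := e.target) (fun y hy => hy)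
  exact h.congr fun y hy => (tangentMapWithin_symm e hy _).symm

theorem contDiffOn_metricMat (g : Metric M) (he : e ∈ atlas E4 M) (i j : Fin 4) :
    ContDiffOn ℝ ∞ (fun y => metricMat g e y i j) e.target := by
  rw [← contMDiffOn_iff_contDiffOn]
  have h1 : ContMDiffOn (𝓡 4) ((𝓡 4).prod 𝓘(ℝ, ℝ)) ∞
      (fun y => Bundle.TotalSpace.mk' ℝ (E := Bundle.Trivial M ℝ) (e.symm y)
        (g.inner (e.symm y) (coordVec e i y) (coordVec e j y))) e.target := by
    apply ContMDiffOn.clm_bundle_apply₂ (F₁ := E4) (F₂ := E4)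
    · exact g.contMDiff.comp_contMDiffOn (contMDiffOn_symm he)
    · exact contMDiffOn_coordVec he i
    · exact contMDiffOn_coordVec he j
  intro y hy
  have h2 := h1 y hy
  simp only [Bundle.contMDiffWithinAt_totalSpace] at h2
  exact h2.2

theorem mfderiv_symm_injective (he : e ∈ atlas E4 M) {y : E4} (hy : y ∈ e.target) :
    Function.Injective (mfderiv (𝓡 4) (𝓡 4) e.symm y) :=
  ((mdifferentiable_of_mem_atlas (I := 𝓡 4) he).symm.mfderiv_bijective hy).injective

theorem mfderiv_symm_apply (y : E4) (v : Fin 4 → ℝ) :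
    mfderiv (𝓡 4) (𝓡 4) e.symm y (WithLp.toLp 2 v : E4) = ∑ i, v i • coordVec e i y := by
  have h : (WithLp.toLp 2 v : E4) = ∑ i, v i • (EuclideanSpace.single i 1 : E4) := by
    ext j
    simp [Finset.sum_apply, Pi.single_apply]
  have h2 : ∀ L : E4 →L[ℝ] E4, L (WithLp.toLp 2 v : E4)
      = ∑ i, v i • L (EuclideanSpace.single i 1) := by
    intro L
    rw [h, map_sum]
    exact Finset.sum_congr rfl fun i _ => map_smul _ _ _
  exact h2 (mfderiv (𝓡 4) (𝓡 4) e.symm y)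

theorem posDef_metricMat (g : Metric M) (he : e ∈ atlas E4 M) {y : E4} (hy : y ∈ e.target) :
    (metricMat g e y).PosDef := by
  refine Matrix.PosDef.of_dotProduct_mulVec_pos ?_ fun v hv => ?_
  · ext i j
    simp only [Matrix.conjTranspose_apply, metricMat, Matrix.of_apply, star_trivial]
    exact g.symm _ _ _
  · have h1 : ∑ i, v i • coordVec e i y ≠ 0 := by
      rw [← mfderiv_symm_apply]
      intro h
      have h2 := mfderiv_symm_injective he hy (h.trans (map_zero _).symm)
      exact hv (congrArg (WithLp.ofLp : E4 → Fin 4 → ℝ) h2)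
    have h3 := g.pos _ _ h1
    simp only [map_sum, map_smul, ContinuousLinearMap.sum_apply, ContinuousLinearMap.smul_apply,
      smul_eq_mul] at h3
    refine h3.trans_eq ?_
    simp only [dotProduct, Matrix.mulVec, star_trivial, metricMat, Matrix.of_apply, Finset.mul_sum]
    rw [Finset.sum_comm]
    exact Finset.sum_congr rfl fun i _ => Finset.sum_congr rfl fun j _ => by rw [g.symm]; ring

end Metric

/-! ### Change of trivialization -/

section GaugeChange

variable {M : Type*} [TopologicalSpace M] [ChartedSpace E4 M] [IsManifold (𝓡 4) ∞ M]
  {e : OpenPartialHomeomorph M E4} {n : ℕ} {ι : Type*}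
  {G : Subgroup (Matrix.orthogonalGroup (Fin n) ℝ)} {Z : VectorBundleCore ℝ M (Fin n → ℝ) ι}

/-- The domain of the coordinate expressions in a chart and over an open subset of `M`. -/
def chartDomain (e : OpenPartialHomeomorph M E4) {s : Set M} (hs : IsOpen s) :
    TopologicalSpace.Opens E4 :=
  ⟨e.target ∩ e.symm ⁻¹' s, e.isOpen_inter_preimage_symm hs⟩

theorem contMDiffOn_transMat [Z.IsContMDiff (𝓡 4) ∞] (a b : ι) (r s : Fin n) :
    ContMDiffOn (𝓡 4) 𝓘(ℝ, ℝ) ∞ (fun x => transMat Z a b x r s) (Z.baseSet a ∩ Z.baseSet b) := by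
  have h1 := VectorBundleCore.IsContMDiff.contMDiffOn_coordChange (IB := 𝓡 4) (n := ∞) (Z := Z) a b
  have h2 : ContDiff ℝ ∞ (fun L : (Fin n → ℝ) →L[ℝ] (Fin n → ℝ) => L (Pi.single s 1) r) := by
    have h3 : ContDiff ℝ ∞ (fun L : (Fin n → ℝ) →L[ℝ] (Fin n → ℝ) => L (Pi.single s 1)) :=
      contDiff_id.clm_apply contDiff_const
    exact contDiff_pi.mp h3 r
  refine (h2.contMDiff.comp_contMDiffOn h1).congr fun x _ => ?_
  simp [transMat, LinearMap.toMatrix'_apply]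

/-- Differentiate B_j t + ∂_j t = t A_j along i and antisymmetrize: the second derivatives of t
cancel, and its first derivatives are eliminated by the same law. -/
theorem gaugeF_of_gauge {K : Type*} [CommRing K] [Algebra ℝ K] {d : Fin 4 → Derivation ℝ K K}
    (hd : ∀ i j f, d i (d j f) = d j (d i f)) {A B : Fin 4 → Matrix (Fin n) (Fin n) K}
    {t : Matrix (Fin n) (Fin n) K} (h : ∀ i, B i * t + t.map (d i) = t * A i) (i j : Fin 4) :
    gaugeF d B i j * t = t * gaugeF d A i j := by
  have h1 : ∀ i j, (B j).map (d i) * t + B j * t.map (d i) + (t.map (d j)).map (d i)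
      = t.map (d i) * A j + t * (A j).map (d i) := by
    intro i j
    rw [← map_mul_derivation, ← map_mul_derivation, ← map_add_derivation, h]
  have h2 : ∀ i, t.map (d i) = t * A i - B i * t := fun i => eq_sub_of_add_eq' (h i)
  have h3 : ∀ i j, (B j).map (d i) * t = t.map (d i) * A j + t * (A j).map (d i)
      - B j * t.map (d i) - (t.map (d j)).map (d i) := fun i j => by rw [← h1]; abel
  simp only [gaugeF, add_mul, sub_mul, mul_add, mul_sub]
  rw [h3, h3, map_map_comm hd i j, h2, h2]
  noncomm_ring

theorem pd_transMat [Z.IsContMDiff (𝓡 4) ∞] (he : e ∈ atlas E4 M) (a b : ι) {y : E4}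
    (hy : y ∈ e.target) (hya : e.symm y ∈ Z.baseSet a) (hyb : e.symm y ∈ Z.baseSet b) (i : Fin 4)
    (r s : Fin n) :
    (mfderiv (𝓡 4) 𝓘(ℝ, ℝ) (fun z => transMat Z a b z r s) (e.symm y) (coordVec e i y) : ℝ)
      = pd i (fun z => transMat Z a b (e.symm z) r s) y := by
  have h1 : MDifferentiableAt (𝓡 4) 𝓘(ℝ, ℝ) (fun x => transMat Z a b x r s) (e.symm y) :=
    ((contMDiffOn_transMat a b r s).contMDiffAt (((Z.isOpen_baseSet a).inter
      (Z.isOpen_baseSet b)).mem_nhds ⟨hya, hyb⟩)).mdifferentiableAt (by simp)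
  have h2 : MDifferentiableAt (𝓡 4) (𝓡 4) e.symm y :=
    ((contMDiffOn_symm he).contMDiffAt (e.open_target.mem_nhds hy)).mdifferentiableAt (by simp)
  have h3 := mfderiv_comp y h1 h2
  rw [pd, ← mfderiv_eq_fderiv]
  exact (congrArg (fun L : E4 →L[ℝ] ℝ => L (EuclideanSpace.single i 1)) h3).symm

theorem curv_gauge [Z.IsContMDiff (𝓡 4) ∞] (A : Connection G Z) (he : e ∈ atlas E4 M) (a b : ι)
    {y : E4} (hy : y ∈ e.target) (hya : e.symm y ∈ Z.baseSet a) (hyb : e.symm y ∈ Z.baseSet b)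
    (i j : Fin 4) :
    A.curv b e y i j * transMat Z a b (e.symm y) = transMat Z a b (e.symm y) * A.curv a e y i j := by
  set U := chartDomain e ((Z.isOpen_baseSet a).inter (Z.isOpen_baseSet b)) with hU
  have hsm : ∀ c, (∀ x ∈ Z.baseSet a ∩ Z.baseSet b, x ∈ Z.baseSet c) → ∀ i r s,
      ContDiffOn ℝ ∞ (fun y => formCoeff (A.form c) e i y r s) U := fun c hc i r s =>
    (A.smooth c e he i r s).mono fun z hz => ⟨hz.1, hc _ hz.2⟩
  have ht : ∀ r s, ContDiffOn ℝ ∞ (fun y => transMat Z a b (e.symm y) r s) U := fun r s => by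
    rw [← contMDiffOn_iff_contDiffOn]
    exact (contMDiffOn_transMat a b r s).comp ((contMDiffOn_symm he).mono fun z hz => hz.1)
      fun z hz => hz.2
  let Aa : Fin 4 → Matrix (Fin n) (Fin n) (SmoothFun U) := fun i => Matrix.of fun r s =>
    toSmooth _ (hsm a (fun x hx => hx.1) i r s)
  let Ab : Fin 4 → Matrix (Fin n) (Fin n) (SmoothFun U) := fun i => Matrix.of fun r s =>
    toSmooth _ (hsm b (fun x hx => hx.2) i r s)
  let t : Matrix (Fin n) (Fin n) (SmoothFun U) := Matrix.of fun r s => toSmooth _ (ht r s)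
  have hAa : ∀ i (z : U), evalMat z (Aa i) = formCoeff (A.form a) e i z := fun _ _ => rfl
  have hAb : ∀ i (z : U), evalMat z (Ab i) = formCoeff (A.form b) e i z := fun _ _ => rfl
  have hte : ∀ z : U, evalMat z t = transMat Z a b (e.symm z) := fun _ => rfl
  have hcomp : ∀ i, Ab i * t + t.map (pdDerivation i) = t * Aa i := fun i => evalMat_ext fun z => by
    rw [evalMat_add, evalMat_mul, evalMat_mul,
      evalMat_map_pdDerivation z (f := fun z => transMat Z a b (e.symm z)) hte, hAa, hAb, hte]
    have hz := A.compat a b (e.symm z) z.2.2 (coordVec e i z)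
    rw [formCoeff, formCoeff, ← hz]
    congr 1
    ext r s
    exact (pd_transMat he a b z.2.1 z.2.2.1 z.2.2.2 i r s).symm
  have h := congrArg (evalMat (⟨y, hy, hya, hyb⟩ : U)) (gaugeF_of_gauge pdDerivation_comm hcomp i j)
  rw [evalMat_mul, evalMat_mul, evalMat_gaugeF hAa, evalMat_gaugeF hAb, hte] at h
  exact h

theorem transMat_orthogonal (hZ : IsGBundle G Z) {a b : ι} {x : M} (ha : x ∈ Z.baseSet a)
    (hb : x ∈ Z.baseSet b) :
    (transMat Z a b x).transpose * transMat Z a b x = 1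
      ∧ transMat Z a b x * (transMat Z a b x).transpose = 1 := by
  obtain ⟨h, -, hh⟩ := hZ a b x ⟨ha, hb⟩
  rw [← hh]
  exact ⟨(Matrix.mem_orthogonalGroup_iff' (Fin n) ℝ).mp h.2,
    (Matrix.mem_orthogonalGroup_iff (Fin n) ℝ).mp h.2⟩

theorem matInner_conj (α : ℝ) {t : Mat n} (ht : t.transpose * t = 1) (X Y : Mat n) :
    matInner α (t * X * t.transpose) (t * Y * t.transpose) = matInner α X Y := by
  rw [matInner_eq_trace, matInner_eq_trace]
  congr 1
  calc _ = (t * (X * (t.transpose * t) * Y.transpose * t.transpose)).trace := by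
        simp only [Matrix.transpose_mul, Matrix.transpose_transpose, Matrix.mul_assoc]
    _ = (X * (t.transpose * t) * Y.transpose * (t.transpose * t)).trace := by
        rw [Matrix.trace_mul_comm]; simp only [Matrix.mul_assoc]
    _ = _ := by rw [ht, Matrix.mul_one, Matrix.mul_one]

theorem selfDualPart_gauge (Q : Mat4) (t : Mat n) (η : Fin 4 → Fin 4 → Mat n) (i j : Fin 4) :
    selfDualPart Q (fun i j => t * η i j * t.transpose) i j
      = t * selfDualPart Q η i j * t.transpose := by
  simp only [selfDualPart, hodgeStar, Matrix.mul_smul, Matrix.smul_mul, Matrix.mul_add,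
    Matrix.add_mul, Finset.mul_sum, Finset.sum_mul]

/-- A change of trivialization conjugates F by an orthogonal matrix. The self-dual part commutes
with this conjugation, and the inner product is invariant under it. -/
theorem normSqLoc_gauge [Z.IsContMDiff (𝓡 4) ∞] (hZ : IsGBundle G Z) (A : Connection G Z)
    (g : Metric M) (α : ℝ) (he : e ∈ atlas E4 M) (a b : ι) {y : E4} (hy : y ∈ e.target)
    (hya : e.symm y ∈ Z.baseSet a) (hyb : e.symm y ∈ Z.baseSet b) :
    normSqLoc A g α b e y = normSqLoc A g α a e y := by
  obtain ⟨h1, h2⟩ := transMat_orthogonal hZ hya hyb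
  set t := transMat Z a b (e.symm y) with ht
  have h3 : A.curv b e y = fun i j => t * A.curv a e y i j * t.transpose := by
    ext1 i; ext1 j
    rw [← curv_gauge A he a b hy hya hyb, Matrix.mul_assoc, h2, Matrix.mul_one]
  simp only [normSqLoc, formInner, h3, selfDualPart_gauge, matInner_conj α h1]

end GaugeChange

/-! ### Change of chart -/

section ChartChange

variable {M : Type*} [TopologicalSpace M] [ChartedSpace E4 M]
  {e e' : OpenPartialHomeomorph M E4} {n : ℕ} {ι : Type*}
  {G : Subgroup (Matrix.orthogonalGroup (Fin n) ℝ)} {Z : VectorBundleCore ℝ M (Fin n → ℝ) ι}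

/-- The Jacobian matrix of a map of `ℝ⁴`. -/
def jac (φ : E4 → E4) (y : E4) : Mat4 := Matrix.of fun i j => pd j (fun z => φ z i) y

theorem fderiv_single {φ : E4 → E4} {y : E4} (hφ : DifferentiableAt ℝ φ y) (j : Fin 4) :
    fderiv ℝ φ y (EuclideanSpace.single j 1) = WithLp.toLp 2 (fun i => jac φ y i j) := by
  ext i
  have h1 : HasFDerivAt (fun z => φ z i) ((EuclideanSpace.proj i : E4 →L[ℝ] ℝ).comp (fderiv ℝ φ y)) y :=
    (EuclideanSpace.proj i : E4 →L[ℝ] ℝ).hasFDerivAt.comp y hφ.hasFDerivAt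
  simp only [jac, Matrix.of_apply, pd]
  rw [h1.fderiv]; rfl

theorem det_jac {φ : E4 → E4} {y : E4} (hφ : DifferentiableAt ℝ φ y) :
    (jac φ y).det = (fderiv ℝ φ y).det := by
  rw [ContinuousLinearMap.det, ← LinearMap.det_toMatrix (EuclideanSpace.basisFun (Fin 4) ℝ).toBasis]
  congr 1
  ext i j
  rw [LinearMap.toMatrix_apply]
  simp only [OrthonormalBasis.coe_toBasis, EuclideanSpace.basisFun_apply,
    ContinuousLinearMap.coe_coe, OrthonormalBasis.coe_toBasis_repr_apply,
    EuclideanSpace.basisFun_repr]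
  rw [fderiv_single hφ]

theorem pd_comp {f : E4 → ℝ} {φ : E4 → E4} {y : E4} (hf : DifferentiableAt ℝ f (φ y))
    (hφ : DifferentiableAt ℝ φ y) (k : Fin 4) :
    pd k (fun z => f (φ z)) y = ∑ l, pd l f (φ y) * jac φ y l k := by
  have h : fderiv ℝ (fun z => f (φ z)) y = (fderiv ℝ f (φ y)).comp (fderiv ℝ φ y) :=
    fderiv_comp y hf hφ
  have hs : (WithLp.toLp 2 (fun i => jac φ y i k) : E4)
      = ∑ l, jac φ y l k • (EuclideanSpace.single l 1 : E4) := by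
    ext j; simp [Finset.sum_apply, Pi.single_apply]
  rw [pd, h, ContinuousLinearMap.comp_apply, fderiv_single hφ, hs, map_sum]
  exact Finset.sum_congr rfl fun l _ => by rw [map_smul, smul_eq_mul, mul_comm, pd]

theorem pd_mul {f h : E4 → ℝ} {y : E4} (hf : DifferentiableAt ℝ f y) (hh : DifferentiableAt ℝ h y)
    (k : Fin 4) : pd k (fun z => f z * h z) y = pd k f y * h y + f y * pd k h y := by
  rw [pd, fderiv_fun_mul hf hh]
  simp [pd]; ring

theorem pd_sum {κ : Type*} {s : Finset κ} {f : κ → E4 → ℝ} {y : E4}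
    (hf : ∀ c ∈ s, DifferentiableAt ℝ (f c) y) (k : Fin 4) :
    pd k (fun z => ∑ c ∈ s, f c z) y = ∑ c ∈ s, pd k (f c) y := by
  rw [pd, fderiv_fun_sum hf]
  simp [pd]

/-- The exterior derivative commutes with pullbacks. -/
theorem pd_pullback {a : Fin 4 → E4 → ℝ} {φ : E4 → E4} {y : E4} (hφ : ContDiffAt ℝ 2 φ y)
    (ha : ∀ i, DifferentiableAt ℝ (a i) (φ y)) (k j : Fin 4) :
    pd k (fun z => ∑ i, jac φ z i j * a i (φ z)) y - pd j (fun z => ∑ i, jac φ z i k * a i (φ z)) y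
      = ∑ p, ∑ q, jac φ y p k * (pd p (a q) (φ y) - pd q (a p) (φ y)) * jac φ y q j := by
  have hφd : DifferentiableAt ℝ φ y := hφ.differentiableAt (by norm_num)
  have hφi : ∀ i, ContDiffAt ℝ 2 (fun z => φ z i) y := fun i => by
    exact (EuclideanSpace.proj i : E4 →L[ℝ] ℝ).contDiff.contDiffAt.comp y hφ
  have hj : ∀ i j, DifferentiableAt ℝ (fun z => jac φ z i j) y := fun i j => by
    have h1 : DifferentiableAt ℝ (fderiv ℝ (fun z => φ z i)) y :=
      ((hφi i).fderiv_right (m := 1) (by norm_num)).differentiableAt (by norm_num)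
    exact h1.clm_apply (differentiableAt_const _)
  have hac : ∀ i, DifferentiableAt ℝ (fun z => a i (φ z)) y := fun i => (ha i).comp y hφd
  have h2 : ∀ k j, pd k (fun z => ∑ i, jac φ z i j * a i (φ z)) y
      = ∑ i, pd k (fun z => jac φ z i j) y * a i (φ y)
        + ∑ i, ∑ l, jac φ y i j * (pd l (a i) (φ y) * jac φ y l k) := by
    intro k j
    rw [pd_sum (fun i _ => (hj i j).fun_mul (hac i)), ← Finset.sum_add_distrib]
    refine Finset.sum_congr rfl fun i _ => ?_
    rw [pd_mul (hj i j) (hac i), pd_comp (ha i) hφd, Finset.mul_sum]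
  have h3 : ∀ i, pd k (fun z => jac φ z i j) y = pd j (fun z => jac φ z i k) y := fun i =>
    pd_pd_comm (hφi i) k j
  have h4 : ∑ i, ∑ l, jac φ y i j * (pd l (a i) (φ y) * jac φ y l k)
      = ∑ p, ∑ q, jac φ y p k * pd p (a q) (φ y) * jac φ y q j := by
    rw [Finset.sum_comm]
    exact Finset.sum_congr rfl fun _ _ => Finset.sum_congr rfl fun _ _ => by ring
  have h5 : ∑ i, ∑ l, jac φ y i k * (pd l (a i) (φ y) * jac φ y l j)
      = ∑ p, ∑ q, jac φ y p k * pd q (a p) (φ y) * jac φ y q j :=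
    Finset.sum_congr rfl fun _ _ => Finset.sum_congr rfl fun _ _ => by ring
  rw [h2, h2, h4, h5]
  simp only [h3, mul_sub, sub_mul, Finset.sum_sub_distrib]
  ring

variable [IsManifold (𝓡 4) ∞ M]

/-- The coordinate change. -/
abbrev transition (e e' : OpenPartialHomeomorph M E4) : E4 → E4 := e' ∘ e.symm

theorem contDiffAt_transition (he : e ∈ atlas E4 M) (he' : e' ∈ atlas E4 M) {y : E4}
    (hy : y ∈ e.target) (hy' : e.symm y ∈ e'.source) : ContDiffAt ℝ ∞ (transition e e') y := by
  rw [← contMDiffAt_iff_contDiffAt]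
  exact (contMDiffAt_of_mem_maximalAtlas (IsManifold.subset_maximalAtlas he') hy').comp y
    ((contMDiffOn_symm he).contMDiffAt (e.open_target.mem_nhds hy))

theorem mfderiv_symm_transition (he : e ∈ atlas E4 M) (he' : e' ∈ atlas E4 M) {y : E4}
    (hy : y ∈ e.target) (hy' : e.symm y ∈ e'.source) :
    (mfderiv (𝓡 4) (𝓡 4) e.symm y : E4 →L[ℝ] E4)
      = (mfderiv (𝓡 4) (𝓡 4) e'.symm (transition e e' y) : E4 →L[ℝ] E4).comp
        (fderiv ℝ (transition e e') y) := by
  have h1 : e'.symm ∘ transition e e' =ᶠ[𝓝 y] e.symm := by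
    filter_upwards [(e.isOpen_inter_preimage_symm e'.open_source).mem_nhds ⟨hy, hy'⟩] with z hz
    exact e'.left_inv hz.2
  have hφ : MDifferentiableAt (𝓡 4) (𝓡 4) (transition e e') y :=
    ((contDiffAt_transition he he' hy hy').differentiableAt (by simp)).mdifferentiableAt
  have he2 : MDifferentiableAt (𝓡 4) (𝓡 4) e'.symm (transition e e' y) :=
    ((contMDiffOn_symm he').contMDiffAt (e'.open_target.mem_nhds
      (e'.map_source hy'))).mdifferentiableAt (by simp)
  have h2 := mfderiv_comp y he2 hφ
  rw [h1.mfderiv_eq, mfderiv_eq_fderiv] at h2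
  exact h2

theorem coordVec_transition (he : e ∈ atlas E4 M) (he' : e' ∈ atlas E4 M) {y : E4}
    (hy : y ∈ e.target) (hy' : e.symm y ∈ e'.source) (j : Fin 4) :
    (coordVec e j y : E4)
      = ∑ i, jac (transition e e') y i j • (coordVec e' i (transition e e' y) : E4) := by
  have h1 := congrArg (fun L : E4 →L[ℝ] E4 => L (EuclideanSpace.single j 1))
    (mfderiv_symm_transition he he' hy hy')
  refine h1.trans ?_
  have hφ := (contDiffAt_transition he he' hy hy').differentiableAt (by simp)
  exact (congrArg (mfderiv (𝓡 4) (𝓡 4) e'.symm (transition e e' y) : E4 →L[ℝ] E4)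
    (fderiv_single hφ j)).trans (mfderiv_symm_apply _ _)

theorem metricMat_transition (g : Metric M) (he : e ∈ atlas E4 M) (he' : e' ∈ atlas E4 M) {y : E4}
    (hy : y ∈ e.target) (hy' : e.symm y ∈ e'.source) :
    metricMat g e y = (jac (transition e e') y).transpose * metricMat g e' (transition e e' y)
      * jac (transition e e') y := by
  have hx : e'.symm (transition e e' y) = e.symm y := e'.left_inv hy'
  -- The two base points are only propositionally equal. All tangent spaces are copies of `E4`, so
  -- the base point is changed while the vectors stay fixed.
  have hg : ∀ (x : M) (h : e'.symm (transition e e' y) = x) (u v : E4),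
      g.inner x u v = g.inner (e'.symm (transition e e' y)) u v := by
    rintro x rfl u v; rfl
  have hL : ∀ (B : E4 →L[ℝ] E4 →L[ℝ] ℝ) (c d : Fin 4 → ℝ) (u : Fin 4 → E4),
      B (∑ i, c i • u i) (∑ i, d i • u i) = ∑ q, (∑ p, c p * B (u p) (u q)) * d q := by
    intro B c d u
    simp only [map_sum, map_smul, ContinuousLinearMap.sum_apply, ContinuousLinearMap.smul_apply,
      smul_eq_mul, Finset.sum_mul, Finset.mul_sum]
    exact Finset.sum_congr rfl fun _ _ => Finset.sum_congr rfl fun _ _ => by ring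
  ext i j
  have h1 : metricMat g e y i j = (g.inner (e'.symm (transition e e' y)) : E4 →L[ℝ] E4 →L[ℝ] ℝ)
      (coordVec e i y : E4) (coordVec e j y : E4) := hg _ hx _ _
  rw [h1, coordVec_transition he he' hy hy' i, coordVec_transition he he' hy hy' j]
  refine (hL _ _ _ _).trans ?_
  simp only [Matrix.mul_apply, Matrix.transpose_apply]
  rfl

theorem formCoeff_transition (θ : (x : M) → TangentSpace (𝓡 4) x →ₗ[ℝ] Mat n)
    (he : e ∈ atlas E4 M) (he' : e' ∈ atlas E4 M) {y : E4}
    (hy : y ∈ e.target) (hy' : e.symm y ∈ e'.source) (j : Fin 4) :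
    formCoeff θ e j y
      = ∑ i, jac (transition e e') y i j • formCoeff θ e' i (transition e e' y) := by
  have hx : e'.symm (transition e e' y) = e.symm y := e'.left_inv hy'
  have hg : ∀ (x : M) (h : e'.symm (transition e e' y) = x) (u : E4),
      (θ x u : Mat n) = θ (e'.symm (transition e e' y)) u := by
    rintro x rfl u; rfl
  have hL : ∀ (B : E4 →ₗ[ℝ] Mat n) (c : Fin 4 → ℝ) (u : Fin 4 → E4),
      B (∑ i, c i • u i) = ∑ i, c i • B (u i) := by
    intro B c u; simp only [map_sum, map_smul]
  have h1 : formCoeff θ e j y = (θ (e'.symm (transition e e' y)) : E4 →ₗ[ℝ] Mat n)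
      (coordVec e j y : E4) := hg _ hx _
  rw [h1, coordVec_transition he he' hy hy' j]
  exact hL _ _ _

/-- The derivative part of F is an exterior derivative and commutes with pullback (`pd_pullback`),
while the bracket part is bilinear at each point. -/
theorem curv_transition (A : Connection G Z) (a : ι) (he : e ∈ atlas E4 M) (he' : e' ∈ atlas E4 M)
    {y : E4} (hy : y ∈ e.target) (hy' : e.symm y ∈ e'.source) (hya : e.symm y ∈ Z.baseSet a)
    (r s : Fin n) :
    entryForm (A.curv a e y) r s = (jac (transition e e') y).transpose
      * entryForm (A.curv a e' (transition e e' y)) r s * jac (transition e e') y := by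
  set φ := transition e e' with hφ
  have hx : e'.symm (φ y) = e.symm y := e'.left_inv hy'
  have hφ2 : ContDiffAt ℝ 2 φ y := (contDiffAt_transition he he' hy hy').of_le
    (WithTop.coe_le_coe.mpr (le_top : (2 : ℕ∞) ≤ ⊤))
  have hnear : ∀ᶠ z in 𝓝 y, z ∈ e.target ∧ e.symm z ∈ e'.source :=
    (e.isOpen_inter_preimage_symm e'.open_source).mem_nhds ⟨hy, hy'⟩
  have hdiff : ∀ r s i, DifferentiableAt ℝ (fun z => formCoeff (A.form a) e' i z r s) (φ y) := by
    intro r s i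
    have hmem : φ y ∈ e'.target ∩ e'.symm ⁻¹' Z.baseSet a :=
      ⟨e'.map_source hy', by rw [Set.mem_preimage, hx]; exact hya⟩
    exact ((A.smooth a e' he' i r s).contDiffAt
      ((e'.isOpen_inter_preimage_symm (Z.isOpen_baseSet a)).mem_nhds hmem)).differentiableAt
      (by simp)
  have hpd : ∀ k j r s, pdMat k (formCoeff (A.form a) e j) y r s
      = pd k (fun z => ∑ i, jac φ z i j * formCoeff (A.form a) e' i (φ z) r s) y := by
    intro k j r s
    refine pd_congr ?_
    filter_upwards [hnear] with z hz
    rw [formCoeff_transition (A.form a) he he' hz.1 hz.2 j, Matrix.sum_apply]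
    rfl
  ext k j
  have h1 := pd_pullback hφ2 (a := fun i z => formCoeff (A.form a) e' i z r s) (hdiff r s) k j
  have h2 : (formCoeff (A.form a) e k y * formCoeff (A.form a) e j y
      - formCoeff (A.form a) e j y * formCoeff (A.form a) e k y) r s
      = ∑ p, ∑ q, jac φ y p k * ((formCoeff (A.form a) e' p (φ y) * formCoeff (A.form a) e' q (φ y)
      - formCoeff (A.form a) e' q (φ y) * formCoeff (A.form a) e' p (φ y)) r s) * jac φ y q j := by
    rw [formCoeff_transition (A.form a) he he' hy hy' k, formCoeff_transition (A.form a) he he' hy hy' j]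
    have h3 : ∀ (c d : Fin 4 → ℝ) (u : Fin 4 → Mat n), (∑ p, c p • u p) * (∑ q, d q • u q)
        - (∑ q, d q • u q) * (∑ p, c p • u p)
        = ∑ p, ∑ q, (c p * d q) • (u p * u q - u q * u p) := by
      intro c d u
      rw [Finset.sum_mul_sum, Finset.sum_mul_sum, Finset.sum_comm (γ := Fin 4) (α := Fin 4)
        (f := fun q p => d q • u q * c p • u p), ← Finset.sum_sub_distrib]
      refine Finset.sum_congr rfl fun p _ => ?_
      rw [← Finset.sum_sub_distrib]
      refine Finset.sum_congr rfl fun q _ => ?_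
      rw [Matrix.smul_mul, Matrix.mul_smul, Matrix.smul_mul, Matrix.mul_smul, smul_smul, smul_smul,
        mul_comm (d q), smul_sub]
    rw [h3]
    simp only [Matrix.sum_apply, Matrix.smul_apply, smul_eq_mul]
    exact Finset.sum_congr rfl fun _ _ => Finset.sum_congr rfl fun _ _ => by ring
  have h4 : entryForm (A.curv a e y) r s k j = (pdMat k (formCoeff (A.form a) e j) y r s
      - pdMat j (formCoeff (A.form a) e k) y r s)
      + (formCoeff (A.form a) e k y * formCoeff (A.form a) e j y
      - formCoeff (A.form a) e j y * formCoeff (A.form a) e k y) r s := rfl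
  rw [h4, hpd, hpd, h1, h2, ← Finset.sum_add_distrib]
  simp only [Matrix.mul_apply, Matrix.transpose_apply, Finset.sum_mul, ← Finset.sum_add_distrib]
  rw [Finset.sum_comm]
  refine Finset.sum_congr rfl fun q _ => Finset.sum_congr rfl fun p _ => ?_
  have h5 : entryForm (A.curv a e' (φ y)) r s p q
      = (pd p (fun z => formCoeff (A.form a) e' q z r s) (φ y)
      - pd q (fun z => formCoeff (A.form a) e' p z r s) (φ y))
      + (formCoeff (A.form a) e' p (φ y) * formCoeff (A.form a) e' q (φ y)
      - formCoeff (A.form a) e' q (φ y) * formCoeff (A.form a) e' p (φ y)) r s := rfl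
  rw [h5]; ring

/-- The orientation of the atlas makes the Jacobian determinant positive, as naturality of the
self-dual part requires. -/
theorem normSqLoc_transition (hor : OrientedAtlas M) (A : Connection G Z) (g : Metric M) (α : ℝ)
    (a : ι) (he : e ∈ atlas E4 M) (he' : e' ∈ atlas E4 M) {y : E4} (hy : y ∈ e.target)
    (hy' : e.symm y ∈ e'.source) (hya : e.symm y ∈ Z.baseSet a) :
    normSqLoc A g α a e y = normSqLoc A g α a e' (transition e e' y) := by
  have hφ := (contDiffAt_transition he he' hy hy').differentiableAt (by simp)
  have hJ : 0 < (jac (transition e e') y).det := by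
    rw [det_jac hφ]
    exact hor e he e' he' y ⟨hy, hy'⟩
  have hF := curv_transition A a he he' hy hy' hya
  have hQ := metricMat_transition g he he' hy hy'
  have hgen : ∀ (Q Q' J : Mat4) (η η' : Fin 4 → Fin 4 → Mat n), 0 < J.det →
      Q = J.transpose * Q' * J →
      (∀ r s, entryForm η r s = J.transpose * entryForm η' r s * J) →
      formInner α Q (selfDualPart Q η) (selfDualPart Q η)
        = formInner α Q' (selfDualPart Q' η') (selfDualPart Q' η') := by
    intro Q Q' J η η' hJ hQ hη
    rw [formInner_eq_sum, formInner_eq_sum]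
    congr 1
    refine Finset.sum_congr rfl fun r _ => Finset.sum_congr rfl fun s _ => ?_
    rw [entryForm_selfDualPart, entryForm_selfDualPart, hη, hQ, selfDualPart_conj _ _ _ hJ,
      formDot_conj _ _ _ _ hJ.ne']
  exact hgen _ _ _ _ _ hJ hQ hF

end ChartChange

/-! ### The norm of the self-dual curvature in a fixed chart and trivialization -/

theorem eq_zero_of_frobSq {n : ℕ} {X : Mat n} (h : frobSq X = 0) : X = 0 := by
  ext a b
  have h1 := (Finset.sum_eq_zero_iff_of_nonneg fun _ _ =>
    Finset.sum_nonneg fun _ _ => sq_nonneg _).mp h a (Finset.mem_univ a)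
  have h2 := (Finset.sum_eq_zero_iff_of_nonneg fun _ _ => sq_nonneg _).mp h1 b (Finset.mem_univ b)
  exact pow_eq_zero_iff two_ne_zero |>.mp h2

theorem eq_zero_of_formInner_self {n : ℕ} {α : ℝ} (hα : 0 < α) {Q : Mat4} (hQ : Q.PosDef)
    {X : Fin 4 → Fin 4 → Mat n} (h : formInner α Q X X = 0) : X = 0 := by
  obtain ⟨P, hP, hd⟩ := exists_frame Q hQ
  have hu : IsUnit P.det := isUnit_iff_ne_zero.mpr hd.ne'
  have h1 : P * P⁻¹ = 1 := Matrix.mul_nonsing_inv P hu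
  have h2 : (P⁻¹).transpose * P.transpose = 1 := by
    rw [← Matrix.transpose_mul, h1, Matrix.transpose_one]
  rw [formInner_frame hP hd] at h
  simp only [matInner_self, ← Finset.mul_sum] at h
  have h3 : ∑ a, ∑ b, frobSq (framePull P X a b) = 0 := by
    rcases mul_eq_zero.mp h with h | h
    · norm_num at h
    · exact (mul_eq_zero.mp h).resolve_left hα.ne'
  have h4 : ∀ a b, frobSq (framePull P X a b) = 0 := by
    intro a b
    rw [Finset.sum_eq_zero_iff_of_nonneg fun _ _ => Finset.sum_nonneg fun _ _ => frobSq_nonneg _] at h3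
    have h5 := h3 a (Finset.mem_univ a)
    rw [Finset.sum_eq_zero_iff_of_nonneg fun _ _ => frobSq_nonneg _] at h5
    exact h5 b (Finset.mem_univ b)
  have h6 : ∀ r s, P.transpose * entryForm X r s * P = 0 := by
    intro r s
    ext a b
    exact congrFun (congrFun (eq_zero_of_frobSq (h4 a b)) r) s
  have h9 : ∀ r s, entryForm X r s = 0 := by
    intro r s
    calc _ = ((P⁻¹).transpose * P.transpose) * entryForm X r s * (P * P⁻¹) := by
          rw [h1, h2]; simp
      _ = (P⁻¹).transpose * (P.transpose * entryForm X r s * P) * P⁻¹ := by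
          simp only [Matrix.mul_assoc]
      _ = 0 := by rw [h6]; simp
  ext i j r s
  exact congrFun (congrFun (h9 r s) i) j

section Global

variable {M : Type*} [TopologicalSpace M] [ChartedSpace E4 M] [IsManifold (𝓡 4) ∞ M]
  {n : ℕ} {ι : Type*}
  {G : Subgroup (Matrix.orthogonalGroup (Fin n) ℝ)} {Z : VectorBundleCore ℝ M (Fin n → ℝ) ι}

/-- `normCurvPlus` uses a chart and a trivialization that jump with the point. Invariance under both
kinds of change allows it to be computed, near a given point, in fixed ones. -/
theorem normCurvPlus_eq [Z.IsContMDiff (𝓡 4) ∞] (hor : OrientedAtlas M) (hZ : IsGBundle G Z)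
    (A : Connection G Z) (g : Metric M) (α : ℝ) {e : OpenPartialHomeomorph M E4}
    (he : e ∈ atlas E4 M) (a : ι) {x : M} (hx : x ∈ e.source) (hxa : x ∈ Z.baseSet a) :
    A.normCurvPlus g α x = √(normSqLoc A g α a e (e x)) := by
  set e' := chartAt E4 x with he'
  have hxe' : x ∈ e'.source := mem_chart_source E4 x
  have hsx : e.symm (e x) = x := e.left_inv hx
  have hsx' : e'.symm (e' x) = x := e'.left_inv hxe'
  have h1 := normSqLoc_transition hor A g α a he (chart_mem_atlas E4 x) (e.map_source hx)
    (by rw [hsx]; exact hxe') (by rw [hsx]; exact hxa)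
  have h2 := normSqLoc_gauge hZ A g α (chart_mem_atlas E4 x) a (Z.indexAt x)
    (e'.map_source hxe') (by rw [hsx']; exact hxa) (by rw [hsx']; exact Z.mem_baseSet_at x)
  have h3 : transition e e' (e x) = e' x := by rw [transition, Function.comp_apply, hsx]
  rw [h1, h3, ← h2]
  rfl

theorem bochner (A : Connection G Z) (g : Metric M) (hA : A.IsYangMills g) {α : ℝ} (hα : 0 < α)
    {e : OpenPartialHomeomorph M E4} (he : e ∈ atlas E4 M) (a : ι) :
    ContDiffOn ℝ ∞ (normSqLoc A g α a e) (e.target ∩ e.symm ⁻¹' Z.baseSet a) ∧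
    ∀ y ∈ e.target ∩ e.symm ⁻¹' Z.baseSet a,
      3 / 8 * ∑ i, ∑ j, (metricMat g e y)⁻¹ i j * pd i (normSqLoc A g α a e) y *
          pd j (normSqLoc A g α a e) y
        + (scalarLoc g e y / 3 - 2 * sSup (weylPlusEigenvalues g e y))
          * normSqLoc A g α a e y ^ 2
        - aG n α * √(normSqLoc A g α a e y) ^ 3 * normSqLoc A g α a e y
      ≤ normSqLoc A g α a e y * (1 / 2 * ∑ i, ∑ j, (metricMat g e y)⁻¹ i j *
        (pd i (pd j (normSqLoc A g α a e)) y
          - ∑ k, christoffel g e k i j y * pd k (normSqLoc A g α a e) y)) := by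
  set U := chartDomain e (Z.isOpen_baseSet a) with hU
  let Qm : Matrix (Fin 4) (Fin 4) (SmoothFun U) := Matrix.of fun i j =>
    toSmooth _ ((contDiffOn_metricMat g he i j).mono fun z hz => hz.1)
  let Am : Fin 4 → Matrix (Fin n) (Fin n) (SmoothFun U) := fun i => Matrix.of fun r s =>
    toSmooth _ (A.smooth a e he i r s)
  have hQm : ∀ y : U, evalMat y Qm = metricMat g e y := fun _ => rfl
  have hAm : ∀ i (y : U), evalMat y (Am i) = formCoeff (A.form a) e i y := fun _ _ => rfl
  obtain ⟨h1, h2⟩ := bochner_loc hQm (fun y => posDef_metricMat g he y.2.1) hAm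
    (fun i y => transpose_of_mem_lieAlg (A.mem_lieAlg a _ y.2.2 _)) (fun y => hA a e he y y.2) hα
  exact ⟨h1, fun y hy => h2 ⟨y, hy⟩⟩

/-! ### Powers -/

theorem pd_rpow {N : E4 → ℝ} {y : E4} (hN : DifferentiableAt ℝ N y) (hy : 0 < N y) (q : ℝ)
    (j : Fin 4) : pd j (fun z => N z ^ q) y = q * N y ^ (q - 1) * pd j N y := by
  rw [pd, (hN.hasFDerivAt.rpow_const (Or.inl hy.ne')).fderiv]
  simp [pd]

theorem pd_pd_rpow {N : E4 → ℝ} {y : E4} (hN : ContDiffAt ℝ 2 N y) (hy : 0 < N y) (q : ℝ)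
    (i j : Fin 4) : pd i (pd j fun z => N z ^ q) y
      = q * (q - 1) * N y ^ (q - 2) * (pd i N y * pd j N y) + q * N y ^ (q - 1) * pd i (pd j N) y := by
  have hd : DifferentiableAt ℝ N y := hN.differentiableAt (by norm_num)
  have hev : ∀ᶠ z in 𝓝 y, ContDiffAt ℝ 2 N z := hN.eventually (by simp)
  have h1 : (pd j fun z => N z ^ q) =ᶠ[𝓝 y] fun z => (q * N z ^ (q - 1)) * pd j N z := by
    filter_upwards [hev, hN.continuousAt.eventually (lt_mem_nhds hy)] with z hz hz'
    exact pd_rpow (hz.differentiableAt (by norm_num)) hz' q j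
  have h2 : DifferentiableAt ℝ (fun z => N z ^ (q - 1)) y := hd.rpow_const (Or.inl hy.ne')
  have h3 : DifferentiableAt ℝ (pd j N) y :=
    ((hN.fderiv_right (m := 1) (by norm_num)).differentiableAt (by norm_num)).clm_apply
      (differentiableAt_const _)
  have h4 : pd i (fun z => q * N z ^ (q - 1)) y = q * ((q - 1) * N y ^ (q - 2) * pd i N y) := by
    rw [pd_mul (differentiableAt_const q) h2, pd_rpow hd hy]
    have : pd i (fun _ : E4 => q) y = 0 := by simp [pd]
    rw [this, show q - 1 - 1 = q - 2 by ring]; ring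
  rw [pd_congr h1, pd_mul (h2.const_mul q) h3, h4]
  ring

theorem pd_congr_eventuallyEq {f f' : E4 → ℝ} {y : E4} (h : f =ᶠ[𝓝 y] f') (j : Fin 4) :
    pd j f =ᶠ[𝓝 y] pd j f' := by
  filter_upwards [h.eventuallyEq_nhds] with z hz
  exact pd_congr hz

theorem sqrt_rpow {t : ℝ} (ht : 0 ≤ t) (p : ℝ) : √t ^ p = t ^ (p / 2) := by
  rw [Real.sqrt_eq_rpow, ← Real.rpow_mul ht]
  congr 1; ring

end Global

end YangMills

end

/-! ### The inequality for powers of the norm -/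

theorem lemma3 {n : ℕ} (hn : 3 ≤ n)
    (G : Subgroup (Matrix.orthogonalGroup (Fin n) ℝ))
    (hG : IsCompact (G : Set (Matrix.orthogonalGroup (Fin n) ℝ)))
    {M : Type*} [TopologicalSpace M] [ChartedSpace YangMills.E4 M] [IsManifold (𝓡 4) ∞ M]
    (hor : YangMills.OrientedAtlas M)
    (g : YangMills.Metric M)
    {ι : Type*} (Z : VectorBundleCore ℝ M (Fin n → ℝ) ι) [Z.IsContMDiff (𝓡 4) ∞]
    (hZ : YangMills.IsGBundle G Z)
    (A : YangMills.Connection G Z) (hA : A.IsYangMills g)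
    (α : ℝ) (hα : 0 < α) (p : ℝ) (hp : 0 < p) (x : M) :
    (A.curvPlus g x ≠ 0 →
      ContMDiffAt (𝓡 4) 𝓘(ℝ, ℝ) ∞ (fun y => A.normCurvPlus g α y ^ p) x) ∧
    (ContMDiffAt (𝓡 4) 𝓘(ℝ, ℝ) 2 (fun y => A.normCurvPlus g α y ^ p) x →
      A.normCurvPlus g α x ^ p * YangMills.laplacian g (fun y => A.normCurvPlus g α y ^ p) x ≥
        (1 - 1 / (2 * p)) * YangMills.gradNormSq g (fun y => A.normCurvPlus g α y ^ p) x
        + p / 3 * YangMills.scalarCurv g x * A.normCurvPlus g α x ^ (2 * p)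
        - 2 * p * YangMills.lambdaMax g x * A.normCurvPlus g α x ^ (2 * p)
        - p * YangMills.aG n α * A.normCurvPlus g α x ^ (2 * p + 1)) := by
  open YangMills in
  set e := chartAt E4 x with he
  set a := Z.indexAt x with ha
  have hea : e ∈ atlas E4 M := chart_mem_atlas E4 x
  have hxe : x ∈ e.source := mem_chart_source E4 x
  have hxa : x ∈ Z.baseSet a := Z.mem_baseSet_at x
  have hsx : e.symm (e x) = x := e.left_inv hxe
  obtain ⟨hsm, hbo⟩ := bochner A g hA hα hea a
  set N := normSqLoc A g α a e with hN
  set y := e x with hy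
  have hyU : y ∈ e.target ∩ e.symm ⁻¹' Z.baseSet a :=
    ⟨e.map_source hxe, by rw [Set.mem_preimage, hsx]; exact hxa⟩
  have hUo : IsOpen (e.target ∩ e.symm ⁻¹' Z.baseSet a) :=
    e.isOpen_inter_preimage_symm (Z.isOpen_baseSet a)
  have hUn := hUo.mem_nhds hyU
  have hNsm : ContDiffAt ℝ ∞ N y := hsm.contDiffAt hUn
  have hQ : (metricMat g e y).PosDef := posDef_metricMat g hea hyU.1
  have hN0 : ∀ z ∈ e.target, 0 ≤ N z := fun z hz =>
    formInner_self_nonneg hα (posDef_metricMat g hea hz) _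
  have hnu : A.normCurvPlus g α x = √(N y) := normCurvPlus_eq hor hZ A g α hea a hxe hxa
  have hloc : (fun z => A.normCurvPlus g α z ^ p) ∘ e.symm =ᶠ[𝓝 y] fun z => N z ^ (p / 2) := by
    filter_upwards [hUn] with z hz
    simp only [Function.comp_apply]
    rw [normCurvPlus_eq hor hZ A g α hea a (e.map_target hz.1) hz.2, e.right_inv hz.1,
      sqrt_rpow (hN0 z hz.1)]
  constructor
  · intro hne
    have hpos : 0 < N y := (hN0 y hyU.1).lt_of_ne' fun h0 =>
      hne (eq_zero_of_formInner_self hα hQ h0)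
    have h1 : ContDiffAt ℝ ∞ (fun z => N z ^ (p / 2)) y := hNsm.rpow_const_of_ne hpos.ne'
    have h2 : ContMDiffAt (𝓡 4) 𝓘(ℝ, ℝ) ∞ (fun z => N (e z) ^ (p / 2)) x :=
      h1.contMDiffAt.comp x
        (contMDiffAt_of_mem_maximalAtlas (IsManifold.subset_maximalAtlas hea) hxe)
    refine h2.congr_of_eventuallyEq ?_
    filter_upwards [(e.open_source.inter (Z.isOpen_baseSet a)).mem_nhds ⟨hxe, hxa⟩] with z hz
    rw [normCurvPlus_eq hor hZ A g α hea a hz.1 hz.2, sqrt_rpow (hN0 _ (e.map_source hz.1))]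
  · intro _
    rcases (hN0 y hyU.1).eq_or_lt with h0 | hpos
    -- At a zero of F⁺ the nonnegative power takes its minimum 0, so every term of the inequality
    -- vanishes.
    · have hmin : IsLocalMin ((fun z => A.normCurvPlus g α z ^ p) ∘ e.symm) y := by
        refine Filter.Eventually.of_forall fun z => ?_
        simp only [Function.comp_apply, hsx, hnu, ← h0, Real.sqrt_zero, Real.zero_rpow hp.ne']
        exact Real.rpow_nonneg (Real.sqrt_nonneg _) _
      have hz : ∀ i, pd i ((fun z => A.normCurvPlus g α z ^ p) ∘ e.symm) y = 0 := fun i => by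
        rw [pd, hmin.fderiv_eq_zero]; rfl
      have hgz : gradNormSq g (fun z => A.normCurvPlus g α z ^ p) x = 0 := by
        simp only [gradNormSq]
        rw [← he, ← hy]
        simp only [hz, mul_zero, Finset.sum_const_zero]
      have h2p : 2 * p ≠ 0 := by positivity
      have h2p1 : 2 * p + 1 ≠ 0 := by positivity
      rw [hgz, hnu, ← h0, Real.sqrt_zero, Real.zero_rpow hp.ne', Real.zero_rpow h2p,
        Real.zero_rpow h2p1]
      simp
    · have hN2 : ContDiffAt ℝ 2 N y :=
        hNsm.of_le (WithTop.coe_le_coe.mpr (le_top : (2 : ℕ∞) ≤ ⊤))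
      have hNd : DifferentiableAt ℝ N y := hN2.differentiableAt (by norm_num)
      set ν := √(N y) with hν
      have hνpos : 0 < ν := Real.sqrt_pos.mpr hpos
      have hνN : ν * ν = N y := Real.mul_self_sqrt hpos.le
      -- The lowest power of N that occurs in the second derivative of N^(p/2); all other powers
      -- become polynomial in `c`, N and ν = √N.
      set c := N y ^ (p / 2 - 2) with hc
      have e1 : N y ^ (p / 2 - 1) = c * N y := by
        rw [hc, ← Real.rpow_add_one hpos.ne']; congr 1; ring
      have e2 : ν ^ p = c * N y ^ 2 := by
        rw [hν, sqrt_rpow hpos.le, hc, ← Real.rpow_natCast, ← Real.rpow_add hpos]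
        congr 1; push_cast; ring
      have e3 : ν ^ (2 * p) = (c * N y ^ 2) ^ 2 := by
        rw [mul_comm, Real.rpow_mul hνpos.le, e2, ← Real.rpow_natCast (c * N y ^ 2) 2]; norm_num
      have e4 : ν ^ (2 * p + 1) = (c * N y ^ 2) ^ 2 * ν := by
        rw [Real.rpow_add_one hνpos.ne', e3]
      have d1 : ∀ j, pd j ((fun z => A.normCurvPlus g α z ^ p) ∘ e.symm) y
          = p / 2 * (c * N y) * pd j N y := fun j => by
        rw [pd_congr hloc, pd_rpow hNd hpos, e1]
      have d2 : ∀ i j, pd i (pd j ((fun z => A.normCurvPlus g α z ^ p) ∘ e.symm)) y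
          = p / 2 * (p / 2 - 1) * c * (pd i N y * pd j N y)
            + p / 2 * (c * N y) * pd i (pd j N) y := fun i j => by
        rw [pd_congr (pd_congr_eventuallyEq hloc j), pd_pd_rpow hN2 hpos, e1]
      have hb := hbo y hyU
      set Γ := ∑ i, ∑ j, (metricMat g e y)⁻¹ i j * pd i N y * pd j N y with hΓ
      set L := ∑ i, ∑ j, (metricMat g e y)⁻¹ i j *
        (pd i (pd j N) y - ∑ k, christoffel g e k i j y * pd k N y) with hL
      have hgrad : gradNormSq g (fun z => A.normCurvPlus g α z ^ p) x
          = (p / 2 * (c * N y)) ^ 2 * Γ := by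
        simp only [gradNormSq]
        rw [← he, ← hy, hΓ]
        simp only [d1, Finset.mul_sum]
        exact Finset.sum_congr rfl fun _ _ => Finset.sum_congr rfl fun _ _ => by ring
      have hlap : laplacian g (fun z => A.normCurvPlus g α z ^ p) x
          = p / 2 * (p / 2 - 1) * c * Γ + p / 2 * (c * N y) * L := by
        simp only [laplacian]
        rw [← he, ← hy, hΓ, hL]
        simp only [d1, d2, Finset.mul_sum, ← Finset.sum_add_distrib]
        refine Finset.sum_congr rfl fun i _ => Finset.sum_congr rfl fun j _ => ?_
        have : ∀ k, christoffel g e k i j y * (p / 2 * (c * N y) * pd k N y)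
            = p / 2 * (c * N y) * (christoffel g e k i j y * pd k N y) := fun k => by ring
        simp only [this, ← Finset.mul_sum]
        ring
      have hR : scalarCurv g x = scalarLoc g e y := rfl
      have hlam : lambdaMax g x = sSup (weylPlusEigenvalues g e y) := rfl
      rw [hgrad, hlap, hnu, e2, e3, e4, hR, hlam]
      -- The Bochner inequality for N, multiplied by this factor p·N^(p−2), is the claim. The
      -- second-order terms match because u = cN² and Δu contains (p/2)cN·ΔN.
      have hscale : 0 ≤ p * (c * N y) ^ 2 := by positivity
      have hfin := mul_le_mul_of_nonneg_left hb hscale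
      have hν3 : ν ^ 3 = N y * ν := by rw [← hνN]; ring
      rw [hν3] at hfin
      -- The gradient coefficients agree since (p/2)(p/2 − 1) + 3p/8 = p²/4 − p/8; this is where 1 −
      -- 1/(2p) comes from.
      have hp2 : (1 - 1 / (2 * p)) * ((p / 2 * (c * N y)) ^ 2 * Γ)
          = (p ^ 2 / 4 - p / 8) * ((c * N y) ^ 2 * Γ) := by
        field_simp; ring
      rw [hp2]
      nlinarith [hfin]
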